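/- **Setting.** Let $\nu:\mathbb R\to[0,\infty)$ be even, increasing on $[0,\infty)$, and such that $\lVert(s,t)\rVert_\nu=|t|\,\nu(|s/t|)$ (extended to $t=0$) is a norm on $\mathbb R^2$. Let $\Omega\subset\mathbb R^2$ and let $f,u:\Omega\to\mathbb R$ be smooth. For a regular $C^1$ curve $c:[0,1]\to\Omega$ put $$L_\nu(c)=\int_0^1\nu\!\left(\frac{(f\circ c)'(t)}{|c'(t)|}\right)|c'(t)|\,dt .$$ Let the amoeba distance $d(p,q)$ be the infimum of $L_\nu(c)$ over all such curves from $p$ to $q$ ($\infty$ if there are none). The amoeba of radius $\varrho$ around $p$ is $\mathcal A_\varrho(p)=\{q\in\Omega: d(p,q)\le\varrho\}$. One step of amoeba median filtering replaces $u(p)$ by the median, with respect to area, of $u$ on $\mathcal A_\varrho(p)$. Let $x_0$ be an interior point of $\Omega$ with $\nabla f(x_0)\neq0$ and $\nabla u(x_0)\ne0$. Write $\nabla f=|\nabla f|\,\chi$ with $\chi=(\cos\varphi,\sin\varphi)$ and $\nabla u=|\nabla u|\,\eta$ with $\eta=(\cos(\varphi+\alpha),\sin(\varphi+\alpha))$ at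 $x_0$, and put $\zeta=(-\sin\varphi,\cos\varphi)$, $\xi=(-\sin(\varphi+\alpha),\cos(\varphi+\alpha))$. **Theorem.** For all sufficiently small $\varrho>0$ the median $\mu(\varrho)$ of $u$ on $\mathcal A_\varrho(x_0)$ exists and is unique, and as $\varrho\to0^+$ $$\mu(\varrho)=u(x_0)+\frac{\varrho^2}{6}\,R(x_0)+o(\varrho^2),$$ that is, the filter step approximates an explicit time step of size $\varrho^2/6$ for the PDE $u_t=R$, where $$R=\frac{u_{\xi\xi}}{\nu(|\nabla f|\sin\alpha)^2}-\frac32\,\nu(|\nabla f|\sin\alpha)\,|\nabla u|\,\bigl(J_1(|\nabla f|,\alpha)f_{\zeta\zeta}+2J_2(|\nabla f|,\alpha)f_{\zeta\chi}+J_3(|\nabla f|,\alpha)f_{\chi\chi}\bigr)$$ and, for $(w_1,w_2,w_3)(\vartheta)=(\sin^2\vartheta,\ \sin\vartheta\cos\vartheta,\ \cos^2\vartheta)$, $$J_k(s,\alpha)=\int_{\alpha-\pi/2}^{\alpha+\pi/2}\frac{\nu'(s\cos\vartheta)}{\nu(s\cos\vartheta)^4}\,w_k(\vartheta)\,d\vartheta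 .$$ If moreover $\nu$ is $C^2$ on $[0,\infty)$ (one-sidedly at $0$), the error $o(\varrho^2)$ improves to $O(\varrho^3)$. -/

import Mathlib

open Set Filter Topology MeasureTheory Asymptotics
open scoped ENNReal ContDiff

noncomputable section

/-- The image plane `ℝ²` with its Euclidean norm. -/
abbrev Plane : Type := EuclideanSpace ℝ (Fin 2)

/-- The functions `ν` from which amoeba metrics are built: nonnegative, even, increasing on
`[0, ∞)`, and such that `(s, t) ↦ |t| ν(|s / t|)` (extended to the axis `t = 0`) is a norm
on `ℝ²`. -/
structure IsAmoebaProfile (ν : ℝ → ℝ) : Prop where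
  nonneg : ∀ s, 0 ≤ ν s
  even : ∀ s, ν (-s) = ν s
  monotoneOn : MonotoneOn ν (Ici 0)
  norm : ∃ p : Seminorm ℝ (ℝ × ℝ), (∀ v, p v = 0 → v = 0) ∧
    ∀ s t : ℝ, t ≠ 0 → p (s, t) = |t| * ν |s / t|

/-- `c` restricted to `[0, 1]` is a regular (`C¹` with nonvanishing velocity) curve in `Ω` that
connects `p` with `q`. Its lift `t ↦ (c t, f (c t))` is a regular curve on the graph of `f`. -/
structure IsRegularCurve (Ω : Set Plane) (p q : Plane) (c : ℝ → Plane) : Prop where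
  contDiffOn : ContDiffOn ℝ 1 c (Icc 0 1)
  velocity_ne_zero : ∀ t ∈ Icc (0 : ℝ) 1, derivWithin c (Icc 0 1) t ≠ 0
  mapsTo : MapsTo c (Icc 0 1) Ω
  source : c 0 = p
  target : c 1 = q

/-- The length `L_ν` of the lift of `c` to the graph of `f`. -/
def amoebaLength (ν : ℝ → ℝ) (f : Plane → ℝ) (c : ℝ → Plane) : ℝ :=
  ∫ t in (0 : ℝ)..1,
    ν (derivWithin (f ∘ c) (Icc 0 1) t / ‖derivWithin c (Icc 0 1) t‖) *
      ‖derivWithin c (Icc 0 1) t‖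

/-- The amoeba distance: the infimum of `L_ν` over the regular curves in `Ω` from `p` to `q`
(`∞` if there are none). -/
def amoebaDist (ν : ℝ → ℝ) (Ω : Set Plane) (f : Plane → ℝ) (p q : Plane) : ℝ≥0∞ :=
  ⨅ (c : ℝ → Plane) (_ : IsRegularCurve Ω p q c), ENNReal.ofReal (amoebaLength ν f c)

/-- The amoeba of radius `ρ` around `p`. -/
def amoeba (ν : ℝ → ℝ) (Ω : Set Plane) (f : Plane → ℝ) (p : Plane) (ρ : ℝ) : Set Plane :=
  {q ∈ Ω | amoebaDist ν Ω f p q ≤ ENNReal.ofReal ρ}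

/-- `m` is a median of `u` on `A` with respect to area: neither `{u < m}` nor `{u > m}` fills
more than half of `A`. -/
def IsMedianOn (u : Plane → ℝ) (A : Set Plane) (m : ℝ) : Prop :=
  2 * volume {x ∈ A | u x < m} ≤ volume A ∧ 2 * volume {x ∈ A | m < u x} ≤ volume A

/-- The unit vector with direction angle `θ`. -/
def unitVec (θ : ℝ) : Plane := !₂[Real.cos θ, Real.sin θ]

/-- The unit vector with direction angle `θ + π/2`. -/
def unitNormal (θ : ℝ) : Plane := !₂[-Real.sin θ, Real.cos θ]

/-- The second derivative `g_{vw} = vᵀ D²g(x) w`. -/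
def secondDeriv (g : Plane → ℝ) (x v w : Plane) : ℝ :=
  fderiv ℝ (fderiv ℝ g) x v w

def J₁ (ν : ℝ → ℝ) (s α : ℝ) : ℝ :=
  ∫ θ in (α - Real.pi / 2)..(α + Real.pi / 2),
    deriv ν (s * Real.cos θ) / ν (s * Real.cos θ) ^ 4 * Real.sin θ ^ 2

def J₂ (ν : ℝ → ℝ) (s α : ℝ) : ℝ :=
  ∫ θ in (α - Real.pi / 2)..(α + Real.pi / 2),
    deriv ν (s * Real.cos θ) / ν (s * Real.cos θ) ^ 4 * (Real.sin θ * Real.cos θ)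

def J₃ (ν : ℝ → ℝ) (s α : ℝ) : ℝ :=
  ∫ θ in (α - Real.pi / 2)..(α + Real.pi / 2),
    deriv ν (s * Real.cos θ) / ν (s * Real.cos θ) ^ 4 * Real.cos θ ^ 2

/-- The right-hand side at `x` of the amoeba evolution equation for `u`, steered by `f`. Here
`φ` is the direction angle of `∇f(x)` and `φ + α` that of `∇u(x)`, so that `χ = unitVec φ`,
`ζ = unitNormal φ`, `η = unitVec (φ + α)` and `ξ = unitNormal (φ + α)`. -/
def amoebaRHS (ν : ℝ → ℝ) (f u : Plane → ℝ) (x : Plane) (φ α : ℝ) : ℝ :=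
  secondDeriv u x (unitNormal (φ + α)) (unitNormal (φ + α)) /
      ν (‖gradient f x‖ * Real.sin α) ^ 2 -
    3 / 2 * ν (‖gradient f x‖ * Real.sin α) * ‖gradient u x‖ *
      (J₁ ν ‖gradient f x‖ α * secondDeriv f x (unitNormal φ) (unitNormal φ) +
        2 * J₂ ν ‖gradient f x‖ α * secondDeriv f x (unitNormal φ) (unitVec φ) +
        J₃ ν ‖gradient f x‖ α * secondDeriv f x (unitVec φ) (unitVec φ))

end

noncomputable section

/-! ### Amoeba profiles -/

/-! The profile is the restriction of a norm `p` to the line at height one, so it is convex,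
Lipschitz and bounded below by `ν 0 > 0`. No geodesics have to be computed. Jensen's inequality for
`p` bounds every curve length below by the profile of the chord slope of `f`, and the straight
segment bounds the distance above. To second order in `ρ` both bounds agree. Blown up by `1 / ρ`,
the amoeba therefore lies between two starshaped sets whose radius in direction `y` solves `q (v + c
ρ q) = 1` up to a small error. Here `v` is the profile of the directional derivative of `f`, and `c`
is half the product of the slope of `ν` there and the second directional derivative
(`exists_amoeba_radial`).

The median is located by the imbalance: twice the area of the blown-up amoeba below the level `u x +
ρ² k`, minus its whole area. Two effects of order `ρ` enter. Opposite directions have different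
radii, and in polar coordinates this gives the integral of `ν' / ν⁴` against the second derivative
of `f`, which is the combination of `J₁`, `J₂`, `J₃` (`volumeReal_starSet_neg_sub_pos`). The level
line is a parabola `w = ρ (k - U t² / 2) / G` instead of a straight line, where `G = |∇u|` and `U =
u_ξξ`. Integrated over the chord `|t| ≤ 1 / ν(|∇f| sin α)`, it gives the dependence on `k` and the
term with `u_ξξ` (`exists_abs_volume_sublevel_sub_le`). The sum is `ρ c (k - R / 6)` with `c > 0`,
up to the error (`exists_amoeba_imbalance_expansion`), so the imbalance changes sign near `k = R /
6` and the median is trapped there (`exists_median_estimate`). Uniqueness holds because a gap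
between two medians would contain no area, while `u` takes the intermediate values on an open set
inside the amoeba.

Since `ν` may have kinks, its derivative is replaced by a symmetric difference quotient at scale `h
= K ρ`, and the error is measured by the second difference at that scale. Only the integral of this
error over directions matters. It is `o(ρ)` for every profile, because a convex function has at most
countably many kinks (`tendsto_integral_secondDiff_div`). It is `O(ρ²)` if `ν` is `C²` on the half
line, because the kink at `0` is then felt only in a set of directions of measure `O(ρ)`
(`exists_integral_secondDiff_le_sq`). These two rates become the two error terms. -/

theorem IsAmoebaProfile.apply_abs {ν : ℝ → ℝ} (hν : IsAmoebaProfile ν) (s : ℝ) :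
    ν |s| = ν s := by
  rcases abs_cases s with h | h
  · rw [h.1]
  · rw [h.1, hν.even]

/-- The norm on the plane defined by an amoeba profile. -/
theorem IsAmoebaProfile.exists_seminorm {ν : ℝ → ℝ} (hν : IsAmoebaProfile ν) :
    ∃ p : Seminorm ℝ (ℝ × ℝ), (∀ v, p v = 0 → v = 0) ∧ (∀ s t : ℝ, 0 < t → p (s, t) = t * ν (s / t)) ∧
      (∀ s t, p (-s, t) = p (s, t)) ∧ (∀ s t t', 0 ≤ t → t ≤ t' → p (s, t) ≤ p (s, t')) := by
  obtain ⟨p, hp0, hp⟩ := hν.norm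
  have hpos : ∀ s t : ℝ, 0 < t → p (s, t) = t * ν (s / t) := fun s t ht => by
    rw [hp s t ht.ne', abs_of_pos ht, hν.apply_abs]
  have hnegt : ∀ s t : ℝ, p (s, -t) = p (s, t) := fun s t => by
    rcases eq_or_ne t 0 with rfl | ht
    · simp
    · rw [hp s t ht, hp s (-t) (neg_ne_zero.2 ht), abs_neg, div_neg, abs_neg]
  refine ⟨p, hp0, hpos, fun s t => ?_, fun s t t' ht htt' => ?_⟩
  · have := map_neg_eq_map p (-s, t)
    rw [← this, Prod.neg_mk, neg_neg, hnegt]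
  · rcases ht.eq_or_lt with rfl | ht
    · have h1 : ((s, 0) : ℝ × ℝ) = (1 / 2 : ℝ) • ((s, t') + (s, -t')) := by
        ext <;> simp; ring
      rw [h1, map_smul_eq_mul]
      have h2 := map_add_le_add p (s, t') (s, -t')
      rw [hnegt] at h2
      norm_num at h2 ⊢
      linarith
    · have ht' := ht.trans_le htt'
      -- Evenness in the second slot turns convexity into monotonicity: `(s, t)` lies on the segment
      -- from `(s, t')` to `(s, -t')`. The monotonicity is what later allows the Euclidean length of
      -- a curve to be replaced by that of its chord.
      have h1 : ((s, t) : ℝ × ℝ) = ((t' + t) / (2 * t')) • (s, t') + ((t' - t) / (2 * t')) • (s, -t') := by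
        ext <;> simp <;> field_simp <;> ring
      have h2 := map_add_le_add p (((t' + t) / (2 * t')) • (s, t')) (((t' - t) / (2 * t')) • (s, -t'))
      rw [← h1, map_smul_eq_mul, map_smul_eq_mul, hnegt, Real.norm_of_nonneg (by positivity),
        Real.norm_of_nonneg (div_nonneg (by linarith) (by positivity)), ← add_mul] at h2
      have h3 : (t' + t) / (2 * t') + (t' - t) / (2 * t') = 1 := by field_simp; ring
      rwa [h3, one_mul] at h2

theorem IsAmoebaProfile.pos {ν : ℝ → ℝ} (hν : IsAmoebaProfile ν) : 0 < ν 0 := by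
  obtain ⟨p, hp0, hp, -⟩ := hν.exists_seminorm
  refine (hν.nonneg 0).lt_of_ne fun h => ?_
  have := hp0 (0, 1) (by rw [hp 0 1 one_pos]; simp [← h])
  simp at this

theorem IsAmoebaProfile.zero_le {ν : ℝ → ℝ} (hν : IsAmoebaProfile ν) (s : ℝ) : ν 0 ≤ ν s := by
  rw [← hν.apply_abs s]
  exact hν.monotoneOn (by simp) (by simp) (abs_nonneg s)

theorem IsAmoebaProfile.pos' {ν : ℝ → ℝ} (hν : IsAmoebaProfile ν) (s : ℝ) : 0 < ν s :=
  hν.pos.trans_le (hν.zero_le s)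

theorem IsAmoebaProfile.mono_abs {ν : ℝ → ℝ} (hν : IsAmoebaProfile ν) {s t : ℝ} (h : |s| ≤ |t|) :
    ν s ≤ ν t := by
  rw [← hν.apply_abs s, ← hν.apply_abs t]
  exact hν.monotoneOn (by simp) (by simp) h

theorem IsAmoebaProfile.convexOn {ν : ℝ → ℝ} (hν : IsAmoebaProfile ν) : ConvexOn ℝ univ ν := by
  obtain ⟨p, -, hp, -⟩ := hν.exists_seminorm
  have h : ∀ s, ν s = p (s, 1) := fun s => by rw [hp s 1 one_pos]; simp
  refine ⟨convex_univ, fun x _ y _ a b ha hb hab => ?_⟩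
  rw [h, h, h]
  have := p.convexOn.2 (mem_univ (x, 1)) (mem_univ (y, 1)) ha hb hab
  simpa [hab] using this

/-- An amoeba profile is Lipschitz continuous. -/
theorem IsAmoebaProfile.exists_lipschitz {ν : ℝ → ℝ} (hν : IsAmoebaProfile ν) :
    ∃ L, 0 < L ∧ ∀ s t, |ν s - ν t| ≤ L * |s - t| := by
  obtain ⟨p, -, hp, -⟩ := hν.exists_seminorm
  have h : ∀ s, ν s = p (s, 1) := fun s => by rw [hp s 1 one_pos]; simp
  refine ⟨p (1, 0) + 1, by have := apply_nonneg p (1, 0); linarith, fun s t => ?_⟩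
  rw [h, h]
  have h1 := abs_sub_map_le_sub p (s, 1) (t, 1)
  have h2 : ((s, 1) - (t, 1) : ℝ × ℝ) = (s - t) • (1, 0) := by ext <;> simp
  rw [h2, map_smul_eq_mul, Real.norm_eq_abs] at h1
  nlinarith [abs_nonneg (s - t)]

theorem continuous_of_lipschitz_bound {ν : ℝ → ℝ} {L : ℝ} (hL : 0 < L)
    (h : ∀ s t, |ν s - ν t| ≤ L * |s - t|) : Continuous ν := by
  have : LipschitzWith ⟨L, hL.le⟩ ν := LipschitzWith.of_dist_le_mul fun s t => h s t
  exact this.continuous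

theorem IsAmoebaProfile.continuous {ν : ℝ → ℝ} (hν : IsAmoebaProfile ν) : Continuous ν := by
  obtain ⟨L, hL, h⟩ := hν.exists_lipschitz
  exact continuous_of_lipschitz_bound hL h

/-! ### Second differences of convex functions -/

/-- The second symmetric difference of `ν` at `a`. -/
def secondDiff (ν : ℝ → ℝ) (h a : ℝ) : ℝ := ν (a + h) + ν (a - h) - 2 * ν a

/-- The symmetric difference quotient of `ν` at `a`. -/
def symmSlope (ν : ℝ → ℝ) (h a : ℝ) : ℝ := (ν (a + h) - ν (a - h)) / (2 * h)

section
variable {ν : ℝ → ℝ} {L h : ℝ}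

theorem secondDiff_nonneg (hc : ConvexOn ℝ univ ν) (h a : ℝ) : 0 ≤ secondDiff ν h a := by
  have := hc.2 (mem_univ (a + h)) (mem_univ (a - h)) (show (0 : ℝ) ≤ 1 / 2 by norm_num)
    (show (0 : ℝ) ≤ 1 / 2 by norm_num) (by norm_num)
  simp only [smul_eq_mul] at this
  rw [show 1 / 2 * (a + h) + 1 / 2 * (a - h) = a by ring] at this
  unfold secondDiff
  linarith

theorem secondDiff_le (hL : ∀ s t, |ν s - ν t| ≤ L * |s - t|) (hh : 0 ≤ h) (a : ℝ) :
    secondDiff ν h a ≤ 2 * L * h := by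
  have h1 := (abs_le.1 (hL (a + h) a)).2
  have h2 := (abs_le.1 (hL (a - h) a)).2
  rw [show a + h - a = h by ring, abs_of_nonneg hh] at h1
  rw [show a - h - a = -h by ring, abs_neg, abs_of_nonneg hh] at h2
  unfold secondDiff
  linarith

theorem abs_symmSlope_le (hL : ∀ s t, |ν s - ν t| ≤ L * |s - t|) (hh : 0 < h) (a : ℝ) :
    |symmSlope ν h a| ≤ L := by
  have h1 := hL (a + h) (a - h)
  rw [show a + h - (a - h) = 2 * h by ring, abs_of_pos (show 0 < 2 * h by linarith)] at h1
  rw [symmSlope, abs_div, abs_of_pos (show 0 < 2 * h by linarith)]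
  rw [div_le_iff₀ (by linarith)]
  exact h1

theorem secondDiff_neg (he : ∀ s, ν (-s) = ν s) (h a : ℝ) :
    secondDiff ν h (-a) = secondDiff ν h a := by
  unfold secondDiff
  rw [← he (-a + h), ← he (-a - h), he a]
  ring_nf

theorem symmSlope_neg (he : ∀ s, ν (-s) = ν s) (h a : ℝ) :
    symmSlope ν h (-a) = -symmSlope ν h a := by
  unfold symmSlope
  rw [← he (-a + h), ← he (-a - h)]
  ring_nf

theorem continuous_secondDiff (hc : Continuous ν) (h : ℝ) : Continuous (secondDiff ν h) := by
  unfold secondDiff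
  fun_prop

theorem continuous_symmSlope (hc : Continuous ν) (h : ℝ) : Continuous (symmSlope ν h) := by
  unfold symmSlope
  fun_prop

/-- A convex function deviates from its symmetric secant by at most half the second difference. -/
theorem abs_sub_symmSlope_le_aux (hc : ConvexOn ℝ univ ν) (hh : 0 < h) (a : ℝ) {z : ℝ}
    (hz0 : 0 ≤ z) (hzh : z ≤ h) :
    |ν (a + z) - ν a - symmSlope ν h a * z| ≤ secondDiff ν h a / 2 := by
  rcases hz0.eq_or_lt with rfl | hz
  · simpa using div_nonneg (secondDiff_nonneg hc h a) zero_le_two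
  -- The increment over `z` lies between `z` times the left and `z` times the right secant slope at
  -- scale `h`. The symmetric slope is their mean, and half their gap times `z` is `secondDiff ν h a
  -- * z / (2 * h)`.
  have h1 := hc.2 (mem_univ a) (mem_univ (a + h)) 
    (show 0 ≤ 1 - z / h by rw [sub_nonneg, div_le_one hh]; exact hzh)
    (show 0 ≤ z / h by positivity) (by ring)
  have h2 := hc.2 (mem_univ (a - h)) (mem_univ (a + z)) 
    (show 0 ≤ z / (z + h) by positivity) (show 0 ≤ h / (z + h) by positivity) (by field_simp)
  simp only [smul_eq_mul] at h1 h2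
  rw [show (1 - z / h) * a + z / h * (a + h) = a + z by field_simp; ring] at h1
  rw [show z / (z + h) * (a - h) + h / (z + h) * (a + z) = a by field_simp; ring] at h2
  have h3 : ν a * (z + h) ≤ z * ν (a - h) + h * ν (a + z) := by
    rw [div_mul_eq_mul_div, div_mul_eq_mul_div, ← add_div, le_div_iff₀ (by positivity)] at h2
    exact h2
  have h4 : h * ν (a + z) ≤ (h - z) * ν a + z * ν (a + h) := by
    have := mul_le_mul_of_nonneg_left h1 hh.le
    calc _ ≤ _ := this
      _ = _ := by field_simp
  have hS : symmSlope ν h a * z * (2 * h) = (ν (a + h) - ν (a - h)) * z := by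
    unfold symmSlope; field_simp
  have hD := secondDiff_nonneg hc h a
  have hDz : secondDiff ν h a * z ≤ secondDiff ν h a * h := mul_le_mul_of_nonneg_left hzh hD
  unfold secondDiff at *
  rw [abs_le]
  constructor
  · refine le_of_mul_le_mul_right ?_ (show 0 < 2 * h by linarith)
    nlinarith
  · refine le_of_mul_le_mul_right ?_ (show 0 < 2 * h by linarith)
    nlinarith

theorem secondDiff_comp_neg (h a : ℝ) : secondDiff (fun x => ν (-x)) h a = secondDiff ν h (-a) := by
  unfold secondDiff
  ring_nf

theorem abs_sub_symmSlope_le (hc : ConvexOn ℝ univ ν) (hh : 0 < h) (a : ℝ) {z : ℝ}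
    (hz : |z| ≤ h) :
    |ν (a + z) - ν a - symmSlope ν h a * z| ≤ secondDiff ν h a / 2 := by
  rcases le_total 0 z with h0 | h0
  · exact abs_sub_symmSlope_le_aux hc hh a h0 ((le_abs_self z).trans hz)
  · have hc' : ConvexOn ℝ univ (fun x => ν (-x)) := by
      have := hc.comp_linearMap (-LinearMap.id)
      rw [preimage_univ] at this
      exact this
    have := abs_sub_symmSlope_le_aux hc' hh (-a) (z := -z) (by linarith)
      ((neg_le_abs z).trans hz)
    rw [secondDiff_comp_neg, neg_neg] at this
    convert this using 2
    unfold symmSlope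
    simp only [neg_add_rev, neg_neg, neg_sub]
    ring_nf

/-- By convexity the derivative lies between the left and right secant slopes at scale `h`; the
symmetric slope is the midpoint of that interval, and the bound is half its width. -/
theorem abs_symmSlope_sub_deriv_le (hc : ConvexOn ℝ univ ν) (hh : 0 < h) {a : ℝ}
    (ha : DifferentiableAt ℝ ν a) :
    |symmSlope ν h a - deriv ν a| ≤ secondDiff ν h a / (2 * h) := by
  have h1 : deriv ν a * h ≤ ν (a + h) - ν a := by
    have := hc.deriv_le_slope (mem_univ a) (mem_univ (a + h)) (by linarith) ha
    rw [slope_def_field, le_div_iff₀ (by linarith)] at this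
    linarith [show deriv ν a * (a + h - a) = deriv ν a * h by ring]
  have h2 : ν a - ν (a - h) ≤ deriv ν a * h := by
    have := hc.slope_le_deriv (mem_univ (a - h)) (mem_univ a) (by linarith) ha
    rw [slope_def_field, div_le_iff₀ (by linarith)] at this
    linarith [show deriv ν a * (a - (a - h)) = deriv ν a * h by ring]
  have hS : symmSlope ν h a * (2 * h) = (ν (a + h) - ν (a - h)) := by
    unfold symmSlope; field_simp
  rw [abs_sub_le_iff, le_div_iff₀ (by linarith), le_div_iff₀ (by linarith), sub_mul, sub_mul, hS]
  unfold secondDiff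
  constructor <;> linarith

theorem tendsto_secondDiff_div {a : ℝ} (ha : DifferentiableAt ℝ ν a) :
    Tendsto (fun h => secondDiff ν h a / h) (𝓝[>] 0) (𝓝 0) := by
  have h1 : HasDerivAt (fun h => secondDiff ν h a) 0 0 := by
    have e1 : HasDerivAt (fun h : ℝ => ν (a + h)) (deriv ν a) 0 := by
      have := ha.hasDerivAt
      rw [← add_zero a] at this
      simpa using this.comp_const_add a 0
    have e2 : HasDerivAt (fun h : ℝ => ν (a - h)) (-deriv ν a) 0 := by
      have := ha.hasDerivAt
      rw [← sub_zero a] at this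
      simpa using this.comp_const_sub a 0
    have := (e1.add e2).sub_const (2 * ν a)
    simpa [secondDiff] using this
  have h2 := (hasDerivAt_iff_tendsto_slope.1 h1).mono_left
    (nhdsWithin_mono 0 (show Ioi (0 : ℝ) ⊆ {0}ᶜ from fun x hx => ne_of_gt hx))
  refine h2.congr fun x => ?_
  rw [slope_def_field]
  simp [secondDiff]
  ring

end

/-! ### Kinks of convex functions are countable -/

/-- A convex function on the line is differentiable off a countable set. -/
theorem ConvexOn.countable_not_differentiableAt {ν : ℝ → ℝ} (hc : ConvexOn ℝ univ ν) :
    {x | ¬ DifferentiableAt ℝ ν x}.Countable := by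
  set R : ℝ → ℝ := fun x => derivWithin ν (Ioi x) x with hR
  have hmono : Monotone R := by
    have := hc.monotoneOn_rightDeriv
    rwa [interior_univ, monotoneOn_univ] at this
  refine hmono.countable_not_continuousAt.mono fun x (hx : ¬ _) (hcont : ContinuousAt R x) => hx ?_
  have hxi : x ∈ interior (univ : Set ℝ) := by simp
  have hr := hc.hasDerivWithinAt_rightDeriv_of_mem_interior hxi
  have hl := hc.hasDerivWithinAt_leftDeriv_of_mem_interior hxi
  have hle := hc.leftDeriv_le_rightDeriv_of_mem_interior hxi
  -- For `y < x` the right derivative at `y` is at most the slope from `y` to `x`, hence at most the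
  -- left derivative at `x`. Continuity of `R` lets `y` tend to `x`.
  have hge : R x ≤ derivWithin ν (Iio x) x := by
    have ht : Tendsto R (𝓝[<] x) (𝓝 (R x)) := hcont.mono_left nhdsWithin_le_nhds
    refine le_of_tendsto ht ?_
    filter_upwards [self_mem_nhdsWithin] with y hy
    have hyi : y ∈ interior (univ : Set ℝ) := by simp
    exact (hc.rightDeriv_le_slope_of_mem_interior hyi (mem_univ x) hy).trans
      (hc.slope_le_leftDeriv_of_mem_interior (mem_univ y) hxi hy)
  have heq := le_antisymm hle hge
  rw [heq] at hl
  have h1 : HasDerivWithinAt ν (derivWithin ν (Ioi x) x) (Iio x ∪ Ioi x) x := hl.union hr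
  have h2 : HasDerivAt ν (derivWithin ν (Ioi x) x) x := by
    rw [hasDerivAt_iff_tendsto_slope]
    rw [hasDerivWithinAt_iff_tendsto_slope] at h1
    convert h1 using 2
    ext y
    simp
  exact h2.differentiableAt

theorem countable_setOf_cos_eq (c : ℝ) : {θ : ℝ | Real.cos θ = c}.Countable := by
  rcases eq_empty_or_nonempty {θ : ℝ | Real.cos θ = c} with h | ⟨θ₀, h₀⟩
  · rw [h]; exact countable_empty
  · refine ((countable_range fun k : ℤ => 2 * k * Real.pi + θ₀).union
      (countable_range fun k : ℤ => 2 * k * Real.pi - θ₀)).mono fun θ hθ => ?_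
    obtain ⟨k, hk | hk⟩ := Real.cos_eq_cos_iff.1 (h₀.trans hθ.symm : Real.cos θ₀ = Real.cos θ)
    · exact Or.inl ⟨k, hk.symm⟩
    · exact Or.inr ⟨k, hk.symm⟩

/-- Each kink is met by only countably many angles. This fails for `s = 0`, where all directions see
the possible kink at `0`; hence the role of a nonvanishing gradient of `f`. -/
theorem ConvexOn.ae_differentiableAt_mul_cos {ν : ℝ → ℝ} (hc : ConvexOn ℝ univ ν) {s : ℝ}
    (hs : s ≠ 0) : ∀ᵐ θ : ℝ, DifferentiableAt ℝ ν (s * Real.cos θ) := by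
  have hcount : {θ : ℝ | ¬ DifferentiableAt ℝ ν (s * Real.cos θ)}.Countable := by
    have : {θ : ℝ | ¬ DifferentiableAt ℝ ν (s * Real.cos θ)} ⊆
        ⋃ x ∈ {x | ¬ DifferentiableAt ℝ ν x}, {θ : ℝ | Real.cos θ = x / s} := by
      intro θ hθ
      simp only [mem_iUnion]
      refine ⟨s * Real.cos θ, hθ, ?_⟩
      simp only [mem_ofPred_eq]
      field_simp
    exact (hc.countable_not_differentiableAt.biUnion fun x _ => countable_setOf_cos_eq _).mono this
  rw [ae_iff]
  exact hcount.measure_zero _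


/-! ### Integrals of second differences over half circles -/

/-- Dominated convergence: the quotients are bounded by `2 * L` and tend to zero wherever `ν` is
differentiable. This produces the `o(ρ²)` in the final result. -/
theorem tendsto_integral_secondDiff_div {ν : ℝ → ℝ} (hν : IsAmoebaProfile ν) {s : ℝ} (hs : s ≠ 0)
    (a b : ℝ) :
    Tendsto (fun h => (∫ θ in a..b, secondDiff ν h (s * Real.cos θ)) / h) (𝓝[>] 0) (𝓝 0) := by
  obtain ⟨L, hL0, hL⟩ := hν.exists_lipschitz
  have h1 : Tendsto (fun h => ∫ θ in a..b, secondDiff ν h (s * Real.cos θ) / h) (𝓝[>] 0)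
      (𝓝 (∫ _θ in a..b, (0 : ℝ))) := by
    refine intervalIntegral.tendsto_integral_filter_of_dominated_convergence (fun _ => 2 * L)
      ?_ ?_ ?_ ?_
    · refine Eventually.of_forall fun h => Continuous.aestronglyMeasurable ?_
      exact ((continuous_secondDiff hν.continuous h).comp (by fun_prop)).div_const h
    · filter_upwards [self_mem_nhdsWithin] with h (hh : 0 < h)
      refine Eventually.of_forall fun θ _ => ?_
      rw [Real.norm_of_nonneg (div_nonneg (secondDiff_nonneg hν.convexOn _ _) hh.le),
        div_le_iff₀ hh]
      exact secondDiff_le hL hh.le _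
    · exact intervalIntegrable_const
    · filter_upwards [hν.convexOn.ae_differentiableAt_mul_cos hs] with θ hθ _
      exact tendsto_secondDiff_div hθ
  simpa [intervalIntegral.integral_div] using h1

/-- The second difference is `h` times a difference of two values of `ν'`, by the mean value theorem
on either side of `a`, and `ν'` is Lipschitz on compact sets. The condition `h ≤ a` keeps the three
points on the half line where `ν` is `C²`, and `h ≤ 1` keeps them in a fixed interval. -/
theorem exists_secondDiff_le_sq {ν : ℝ → ℝ} (hν : ContDiffOn ℝ 2 ν (Ici 0)) (s : ℝ) :
    ∃ C, 0 ≤ C ∧ ∀ h a, 0 < h → h ≤ 1 → h ≤ a → a ≤ s → secondDiff ν h a ≤ C * h ^ 2 := by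
  set g : ℝ → ℝ := derivWithin ν (Ici 0) with hg
  have hg1 : ContDiffOn ℝ 1 g (Ici 0) := hν.derivWithin (uniqueDiffOn_Ici 0) (by norm_num)
  obtain ⟨C, hC⟩ : ∃ C : NNReal, LipschitzOnWith C g (Icc 0 (s + 1)) := by
    have hcont : ContinuousOn (derivWithin g (Ici 0)) (Icc 0 (s + 1)) :=
      (hg1.continuousOn_derivWithin (uniqueDiffOn_Ici 0) le_rfl).mono Icc_subset_Ici_self
    obtain ⟨C, hC⟩ := isCompact_Icc.exists_bound_of_continuousOn hcont
    refine ⟨C.toNNReal, (convex_Icc 0 (s + 1)).lipschitzOnWith_of_nnnorm_hasDerivWithin_le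
      (f' := derivWithin g (Ici 0)) (fun x hx => ?_) fun x hx => ?_⟩
    · exact ((hg1.differentiableOn one_ne_zero x hx.1).hasDerivWithinAt).mono Icc_subset_Ici_self
    · rw [← NNReal.coe_le_coe, coe_nnnorm]
      exact (hC x hx).trans (Real.le_coe_toNNReal C)
  have hder : ∀ x, 0 < x → HasDerivAt ν (g x) x := fun x hx =>
    ((hν.differentiableOn two_ne_zero x hx.le).hasDerivWithinAt).hasDerivAt (Ici_mem_nhds hx)
  refine ⟨2 * C, by positivity, fun h a hh h1 ha has => ?_⟩
  obtain ⟨x, hx, hxe⟩ := exists_hasDerivAt_eq_slope ν g (show a < a + h by linarith)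
    (hν.continuousOn.mono fun y hy => by simp only [mem_Ici]; linarith [hy.1])
    fun y hy => hder y (by linarith [hy.1])
  obtain ⟨y, hy, hye⟩ := exists_hasDerivAt_eq_slope ν g (show a - h < a by linarith)
    (hν.continuousOn.mono fun y hy => by simp only [mem_Ici]; linarith [hy.1])
    fun y hy => hder y (by linarith [hy.1])
  have h2 := hC.dist_le_mul x ⟨by linarith [hx.1], by linarith [hx.2]⟩ y
    ⟨by linarith [hy.1], by linarith [hy.2]⟩
  rw [Real.dist_eq, Real.dist_eq] at h2
  have h3 : |x - y| ≤ 2 * h := by rw [abs_le]; constructor <;> linarith [hx.1, hx.2, hy.1, hy.2]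
  have h4 : g x * h = ν (a + h) - ν a := by
    rw [hxe, add_sub_cancel_left, div_mul_cancel₀ _ hh.ne']
  have h5 : g y * h = ν a - ν (a - h) := by
    rw [hye, sub_sub_cancel, div_mul_cancel₀ _ hh.ne']
  have h6 : g x - g y ≤ C * (2 * h) :=
    (le_abs_self _).trans (h2.trans (mul_le_mul_of_nonneg_left h3 C.2))
  have h7 := mul_le_mul_of_nonneg_right h6 hh.le
  unfold secondDiff
  nlinarith

theorem abs_sub_pi_div_two_lt_of_abs_cos_lt {θ c : ℝ} (hθ : θ ∈ Icc 0 Real.pi)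
    (h : |Real.cos θ| < c) : |θ - Real.pi / 2| < Real.pi / 2 * c := by
  rw [← Real.sin_pi_div_two_sub, show Real.pi / 2 - θ = -(θ - Real.pi / 2) by ring, Real.sin_neg,
    abs_neg] at h
  have h1 : |θ - Real.pi / 2| ≤ Real.pi / 2 := by
    rw [abs_le]; constructor <;> linarith [hθ.1, hθ.2]
  have h2 := (Real.mul_abs_le_abs_sin h1).trans_lt h
  rw [div_mul_eq_mul_div, div_lt_iff₀ Real.pi_pos] at h2
  linarith

/-- Where `|s cos θ| ≥ h` the quadratic bound applies. The remaining angles form a set of measure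
`O(h)` around `π / 2`, by Jordan's inequality for the sine, and there the Lipschitz bound `O(h)`
suffices. Both parts contribute `O(h²)`. -/
theorem exists_integral_secondDiff_le_sq {ν : ℝ → ℝ} (hν : IsAmoebaProfile ν)
    (h2 : ContDiffOn ℝ 2 ν (Ici 0)) {s : ℝ} (hs : 0 < s) (α : ℝ) :
    ∃ C, 0 ≤ C ∧ ∀ h, 0 < h → h ≤ 1 →
      ∫ θ in (α - Real.pi / 2)..(α + Real.pi / 2), secondDiff ν h (s * Real.cos θ) ≤ C * h ^ 2 := by
  obtain ⟨L, hL0, hL⟩ := hν.exists_lipschitz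
  obtain ⟨C, hC0, hC⟩ := exists_secondDiff_le_sq h2 s
  have hpi := Real.pi_pos
  refine ⟨C * Real.pi + 2 * L * (Real.pi / s), by positivity, fun h hh hh1 => ?_⟩
  -- Evenness makes the integrand `π`-periodic, so that `[0, π]`, with one zero of the cosine in its
  -- middle, replaces the given half circle.
  have hper : Function.Periodic (fun θ => secondDiff ν h (s * Real.cos θ)) Real.pi := fun θ => by
    simp only [Real.cos_add_pi, mul_neg]
    exact secondDiff_neg hν.even _ _
  have h3 := hper.intervalIntegral_add_eq (α - Real.pi / 2) 0
  rw [show α - Real.pi / 2 + Real.pi = α + Real.pi / 2 by ring, zero_add] at h3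
  rw [h3]
  set δ : ℝ := Real.pi / 2 * (h / s) with hδ
  set I : Set ℝ := Ioo (Real.pi / 2 - δ) (Real.pi / 2 + δ) with hI
  have hbd : ∀ θ ∈ Icc 0 Real.pi, secondDiff ν h (s * Real.cos θ) ≤
      C * h ^ 2 + I.indicator (fun _ => 2 * L * h) θ := by
    intro θ hθ
    by_cases hc : |Real.cos θ| < h / s
    · have h4 := abs_lt.1 (abs_sub_pi_div_two_lt_of_abs_cos_lt hθ hc)
      rw [indicator_of_mem (show θ ∈ I from ⟨by linarith [h4.1], by linarith [h4.2]⟩)]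
      have := secondDiff_le hL hh.le (s * Real.cos θ)
      nlinarith [mul_nonneg hC0 (sq_nonneg h)]
    · have h5 : h ≤ |s * Real.cos θ| := by
        rw [abs_mul, abs_of_pos hs]
        rw [not_lt, div_le_iff₀ hs] at hc
        linarith
      have h6 : |s * Real.cos θ| ≤ s := by
        rw [abs_mul, abs_of_pos hs]
        nlinarith [Real.abs_cos_le_one θ]
      have h7 : secondDiff ν h (s * Real.cos θ) = secondDiff ν h |s * Real.cos θ| := by
        rcases abs_cases (s * Real.cos θ) with h | h
        · rw [h.1]
        · rw [h.1, secondDiff_neg hν.even]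
      rw [h7]
      have h8 : 0 ≤ I.indicator (fun _ => 2 * L * h) θ :=
        indicator_nonneg (fun _ _ => by positivity) θ
      linarith [hC h _ hh hh1 h5 h6]
  have hI1 : Integrable (I.indicator fun _ : ℝ => 2 * L * h) :=
    (integrable_indicator_iff measurableSet_Ioo).2 (integrableOn_const measure_Ioo_lt_top.ne)
  have hint : IntervalIntegrable (I.indicator fun _ : ℝ => 2 * L * h) volume 0 Real.pi :=
    hI1.intervalIntegrable
  have hcont : Continuous fun θ => secondDiff ν h (s * Real.cos θ) :=
    (continuous_secondDiff hν.continuous h).comp (by fun_prop)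
  refine (intervalIntegral.integral_mono_on hpi.le (hcont.intervalIntegrable _ _)
    (intervalIntegrable_const.add hint) hbd).trans ?_
  rw [intervalIntegral.integral_add intervalIntegrable_const hint,
    intervalIntegral.integral_const, smul_eq_mul, sub_zero]
  have h9 : ∫ θ in (0 : ℝ)..Real.pi, I.indicator (fun _ => 2 * L * h) θ ≤
      2 * L * (Real.pi / s) * h ^ 2 := by
    rw [intervalIntegral.integral_of_le hpi.le]
    refine (integral_mono_measure Measure.restrict_le_self (ae_of_all _ fun θ =>
      indicator_nonneg (fun _ _ => by positivity) θ) hI1).trans ?_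
    rw [integral_indicator measurableSet_Ioo, setIntegral_const, Real.volume_real_Ioo_of_le
      (by have : 0 ≤ δ := by positivity
          linarith), smul_eq_mul, hδ]
    apply le_of_eq
    field_simp
    ring
  nlinarith

/-! ### The integrand of the coefficients `J₁`, `J₂`, `J₃` -/

theorem IsAmoebaProfile.abs_deriv_le {ν : ℝ → ℝ} {L : ℝ} (hL0 : 0 < L)
    (hL : ∀ s t, |ν s - ν t| ≤ L * |s - t|) (a : ℝ) : |deriv ν a| ≤ L := by
  have : LipschitzWith ⟨L, hL0.le⟩ ν := LipschitzWith.of_dist_le_mul fun s t => hL s t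
  exact norm_deriv_le_of_lipschitz this

/-- At a kink `deriv ν` has its default value `0`, but it is still measurable and bounded by the
Lipschitz constant everywhere. -/
theorem IsAmoebaProfile.intervalIntegrable_deriv_div {ν : ℝ → ℝ} (hν : IsAmoebaProfile ν)
    (s a b : ℝ) {w : ℝ → ℝ} (hw : Continuous w) :
    IntervalIntegrable (fun θ => deriv ν (s * Real.cos θ) / ν (s * Real.cos θ) ^ 4 * w θ)
      volume a b := by
  obtain ⟨L, hL0, hL⟩ := hν.exists_lipschitz
  have hc := hν.continuous
  have h1 : Continuous fun θ => w θ / ν (s * Real.cos θ) ^ 4 :=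
    hw.div₀ (by fun_prop) fun θ => (pow_pos (hν.pos' _) 4).ne'
  have h2 : IntervalIntegrable (fun θ => w θ / ν (s * Real.cos θ) ^ 4) volume a b :=
    h1.intervalIntegrable _ _
  have h3 : Measurable fun θ => deriv ν (s * Real.cos θ) :=
    (measurable_deriv ν).comp (by fun_prop)
  have hb := fun θ => IsAmoebaProfile.abs_deriv_le hL0 hL (s * Real.cos θ)
  refine IntervalIntegrable.congr ?_ (⟨h2.1.bdd_mul (c := L) h3.aestronglyMeasurable (ae_of_all _ hb),
    h2.2.bdd_mul (c := L) h3.aestronglyMeasurable (ae_of_all _ hb)⟩ : IntervalIntegrable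
      (fun θ => deriv ν (s * Real.cos θ) * (w θ / ν (s * Real.cos θ) ^ 4)) volume a b)
  · refine fun θ _ => ?_
    simp only
    ring

/-- This passes from difference quotients, which the geometry produces, to the derivative that
occurs in the coefficients of the equation. The cost is again an integrated second difference. -/
theorem IsAmoebaProfile.abs_integral_symmSlope_sub_le {ν : ℝ → ℝ} (hν : IsAmoebaProfile ν) {s : ℝ}
    (hs : s ≠ 0) {a b : ℝ} (hab : a ≤ b) {w : ℝ → ℝ} (hw : Continuous w) {B : ℝ}
    (hB : ∀ θ, |w θ| ≤ B) {h : ℝ} (hh : 0 < h) :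
    |(∫ θ in a..b, symmSlope ν h (s * Real.cos θ) / ν (s * Real.cos θ) ^ 4 * w θ) -
      ∫ θ in a..b, deriv ν (s * Real.cos θ) / ν (s * Real.cos θ) ^ 4 * w θ| ≤
      B / (2 * ν 0 ^ 4) * ((∫ θ in a..b, secondDiff ν h (s * Real.cos θ)) / h) := by
  have hc := hν.continuous
  have hB0 : 0 ≤ B := (abs_nonneg _).trans (hB 0)
  have hi : IntervalIntegrable (fun θ => symmSlope ν h (s * Real.cos θ) / ν (s * Real.cos θ) ^ 4 *
      w θ) volume a b := by
    refine Continuous.intervalIntegrable (Continuous.mul (Continuous.div₀ ?_ (by fun_prop)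
      fun θ => (pow_pos (hν.pos' _) 4).ne') hw) _ _
    exact (continuous_symmSlope hc h).comp (by fun_prop)
  rw [← intervalIntegral.integral_sub hi (hν.intervalIntegrable_deriv_div s a b hw),
    ← intervalIntegral.integral_div, ← intervalIntegral.integral_const_mul, ← Real.norm_eq_abs]
  refine intervalIntegral.norm_integral_le_of_norm_le hab ?_ ?_
  · filter_upwards [hν.convexOn.ae_differentiableAt_mul_cos hs] with θ hθ _
    have h1 := abs_symmSlope_sub_deriv_le hν.convexOn hh hθ
    have h2 : 0 < ν (s * Real.cos θ) := hν.pos' _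
    have h3 : ν 0 ^ 4 ≤ ν (s * Real.cos θ) ^ 4 :=
      pow_le_pow_left₀ hν.pos.le (hν.zero_le _) 4
    have h4 : 0 < ν 0 ^ 4 := pow_pos hν.pos 4
    rw [← sub_mul, ← sub_div, Real.norm_eq_abs, abs_mul, abs_div, abs_of_pos (pow_pos h2 4)]
    calc _ ≤ (secondDiff ν h (s * Real.cos θ) / (2 * h)) / ν 0 ^ 4 * B := by
          have := secondDiff_nonneg hν.convexOn h (s * Real.cos θ)
          gcongr
          exact hB θ
      _ = _ := by field_simp
  · refine Continuous.intervalIntegrable ?_ _ _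
    have := (continuous_secondDiff hc h).comp (show Continuous fun θ => s * Real.cos θ by fun_prop)
    exact continuous_const.mul (this.div_const h)


/-! ### Second order Taylor expansion -/

section Taylor
variable {E : Type*} [NormedAddCommGroup E] [NormedSpace ℝ E]

/-- Second order Taylor expansion of a `C³` function and of its derivative, with explicit
remainders. -/
theorem ContDiffAt.exists_taylor_two {g : E → ℝ} {x : E} (hg : ContDiffAt ℝ 3 g x) :
    ∃ r C, 0 < r ∧ 0 ≤ C ∧ ∀ v, ‖v‖ ≤ r → DifferentiableAt ℝ g (x + v) ∧
      (∀ w, |fderiv ℝ g (x + v) w - fderiv ℝ g x w - fderiv ℝ (fderiv ℝ g) x v w| ≤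
        C * ‖v‖ ^ 2 * ‖w‖) ∧
      |g (x + v) - g x - fderiv ℝ g x v - fderiv ℝ (fderiv ℝ g) x v v / 2| ≤ C * ‖v‖ ^ 3 := by
  have hg1 : ContDiffAt ℝ 2 (fderiv ℝ g) x := hg.fderiv_right (by norm_num)
  have hg2 : ContDiffAt ℝ 1 (fderiv ℝ (fderiv ℝ g)) x := hg1.fderiv_right (by norm_num)
  obtain ⟨C, t, ht, hC⟩ := hg2.exists_lipschitzOnWith
  have he : ∀ᶠ y in 𝓝 x, DifferentiableAt ℝ g y ∧ DifferentiableAt ℝ (fderiv ℝ g) y ∧ y ∈ t := by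
    refine ((hg.eventually (by norm_num)).mono fun y hy => hy.differentiableAt (by norm_num)).and
      (((hg1.eventually (by norm_num)).mono fun y hy => hy.differentiableAt (by norm_num)).and ht)
  obtain ⟨r, hr, hball⟩ := Metric.nhds_basis_closedBall.mem_iff.1 he
  -- Symmetry is needed because the derivative of `D v v / 2` is `D v` only for symmetric `D`.
  have hsymm : IsSymmSndFDerivAt ℝ g x := hg.isSymmSndFDerivAt (by simp; norm_num)
  set l := fderiv ℝ g x with hl
  set D := fderiv ℝ (fderiv ℝ g) x with hD
  -- The mean value inequality is used twice, here for the derivative minus its linearization and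
  -- below for `g` minus its quadratic part. Each time one more power of `‖v‖` is gained from the
  -- Lipschitz continuity of the second derivative.
  have key1 : ∀ v, ‖v‖ ≤ r → ‖fderiv ℝ g (x + v) - l - D v‖ ≤ C * ‖v‖ ^ 2 := by
    intro v hv
    have hsub : Metric.closedBall x ‖v‖ ⊆ Metric.closedBall x r := Metric.closedBall_subset_closedBall hv
    have h := (convex_closedBall x ‖v‖).norm_image_sub_le_of_norm_hasFDerivWithin_le
      (f := fun y => fderiv ℝ g y - D (y - x)) (f' := fun y => fderiv ℝ (fderiv ℝ g) y - D)
      (C := C * ‖v‖) (x := x) (y := x + v) (𝕜 := ℝ) (fun y hy => ?_) (fun y hy => ?_)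
      (Metric.mem_closedBall_self (norm_nonneg v)) (by simp)
    · simp only [add_sub_cancel_left, sub_self, map_zero, sub_zero] at h
      rw [sub_right_comm]
      calc _ ≤ _ := h
        _ = _ := by ring
    · have h1 := (hball (hsub hy)).2.1.hasFDerivAt
      exact (h1.sub (D.hasFDerivAt.comp y ((hasFDerivAt_id y).sub_const x))).hasFDerivWithinAt
    · have h1 := hC.dist_le_mul y (hball (hsub hy)).2.2 x (mem_of_mem_nhds ht)
      rw [dist_eq_norm] at h1
      exact h1.trans (mul_le_mul_of_nonneg_left (by simpa using hy) C.2)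
  refine ⟨r, C, hr, C.2, fun v hv => ⟨(hball (by simpa using hv)).1, fun w => ?_, ?_⟩⟩
  · have h := (fderiv ℝ g (x + v) - l - D v).le_opNorm w
    rw [Real.norm_eq_abs] at h
    exact h.trans (mul_le_mul_of_nonneg_right (key1 v hv) (norm_nonneg w))
  · have hsub : Metric.closedBall x ‖v‖ ⊆ Metric.closedBall x r := Metric.closedBall_subset_closedBall hv
    have h := (convex_closedBall x ‖v‖).norm_image_sub_le_of_norm_hasFDerivWithin_le
      (f := fun y => g y - l (y - x) - D (y - x) (y - x) / 2)
      (f' := fun y => fderiv ℝ g y - l - D (y - x))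
      (C := C * ‖v‖ ^ 2) (x := x) (y := x + v) (𝕜 := ℝ) (fun y hy => ?_) (fun y hy => ?_)
      (Metric.mem_closedBall_self (norm_nonneg v)) (by simp)
    · simp only [add_sub_cancel_left, sub_self, map_zero, sub_zero, zero_div, Real.norm_eq_abs] at h
      calc _ = |g (x + v) - l v - D v v / 2 - g x| := by congr 1; ring
        _ ≤ _ := h
        _ = _ := by ring
    · have h1 := (hball (hsub hy)).1.hasFDerivAt
      have h2 : HasFDerivAt (fun y => y - x) (ContinuousLinearMap.id ℝ E) y :=
        (hasFDerivAt_id y).sub_const x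
      have h3 := (h1.sub (l.hasFDerivAt.comp y h2)).sub
        (((D.hasFDerivAt.comp y h2).clm_apply h2).const_mul (1 / 2 : ℝ))
      refine ((h3.congr_fderiv ?_).congr_of_eventuallyEq
        (Eventually.of_forall fun z => ?_)).hasFDerivWithinAt
      · ext w
        have := hsymm.eq (y - x) w
        simp only [sub_apply, ContinuousLinearMap.comp_apply,
          smul_apply, add_apply,
          ContinuousLinearMap.flip_apply, ContinuousLinearMap.id_apply, smul_eq_mul,
          Function.comp_apply]
        rw [← hD] at this
        rw [this]
        ring
      · simp only [Pi.sub_apply, Function.comp_apply]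
        ring
    · have hy' : ‖y - x‖ ≤ ‖v‖ := by simpa [dist_eq_norm] using hy
      have h1 := key1 (y - x) (hy'.trans hv)
      rw [add_sub_cancel] at h1
      exact h1.trans (mul_le_mul_of_nonneg_left (pow_le_pow_left₀ (norm_nonneg _) hy' 2) C.2)

end Taylor

/-! ### Bounds for the amoeba distance -/

theorem Seminorm.continuous_prod_real (p : Seminorm ℝ (ℝ × ℝ)) : Continuous p := by
  have h := (p.convexOn).continuousOn_interior
  rw [interior_univ, continuousOn_univ] at h
  exact h

/-- The velocity of a regular curve, and of its image under `f`, is integrated over `[0, 1]`. -/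
theorem IsRegularCurve.le_amoebaLength {ν : ℝ → ℝ} (hν : IsAmoebaProfile ν) {Ω : Set Plane}
    {f : Plane → ℝ} (hf : ContDiffOn ℝ 1 f Ω) {x q : Plane} {c : ℝ → Plane}
    (hc : IsRegularCurve Ω x q c) (hq : q ≠ x) :
    ‖q - x‖ * ν ((f q - f x) / ‖q - x‖) ≤ amoebaLength ν f c := by
  obtain ⟨p, -, hp, -, hmono⟩ := hν.exists_seminorm
  have hfc : ContDiffOn ℝ 1 (f ∘ c) (Icc 0 1) := hf.comp hc.contDiffOn hc.mapsTo
  have hu := uniqueDiffOn_Icc (zero_lt_one (α := ℝ))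
  have h1 := hc.contDiffOn.continuousOn_derivWithin hu le_rfl
  have h2 := hfc.continuousOn_derivWithin hu le_rfl
  have i1 := intervalIntegral.integral_derivWithin_Icc_of_contDiffOn_Icc hc.contDiffOn zero_le_one
  have i2 := intervalIntegral.integral_derivWithin_Icc_of_contDiffOn_Icc hfc zero_le_one
  rw [hc.source, hc.target] at i1
  simp only [Function.comp_apply, hc.source, hc.target] at i2
  set V : ℝ → Plane := derivWithin c (Icc 0 1)
  set W : ℝ → ℝ := derivWithin (f ∘ c) (Icc 0 1)
  have hV : ContinuousOn (fun t => ‖V t‖) (Icc 0 1) := h1.norm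
  have hlen : amoebaLength ν f c = ∫ t in Icc (0 : ℝ) 1, p (W t, ‖V t‖) := by
    rw [amoebaLength, intervalIntegral.integral_of_le zero_le_one, ← integral_Icc_eq_integral_Ioc]
    refine setIntegral_congr_fun measurableSet_Icc fun t ht => ?_
    have : 0 < ‖V t‖ := norm_pos_iff.2 (hc.velocity_ne_zero t ht)
    rw [hp _ _ this, mul_comm]
  have hprob : IsProbabilityMeasure (volume.restrict (Icc (0 : ℝ) 1)) := ⟨by simp⟩
  -- Jensen's inequality compares the length with `p` at the mean of `(W, ‖V‖)`. The first mean is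
  -- the increment of `f`; the second is at least the chord length, and `p` is monotone in it.
  have hJ := p.convexOn.map_integral_le (μ := volume.restrict (Icc (0 : ℝ) 1))
    (f := fun t => (W t, ‖V t‖)) p.continuous_prod_real.continuousOn isClosed_univ
    (by simp) ((h2.prodMk hV).integrableOn_Icc)
    ((p.continuous_prod_real.comp_continuousOn (h2.prodMk hV)).integrableOn_Icc)
  rw [integral_pair h2.integrableOn_Icc hV.integrableOn_Icc] at hJ
  rw [hlen, ← hp _ _ (norm_pos_iff.2 (sub_ne_zero.2 hq))]
  refine le_trans ?_ hJ
  rw [integral_Icc_eq_integral_Ioc, integral_Icc_eq_integral_Ioc,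
    ← intervalIntegral.integral_of_le zero_le_one, ← intervalIntegral.integral_of_le zero_le_one, i2]
  refine hmono _ _ _ (norm_nonneg _) ?_
  rw [← i1]
  exact intervalIntegral.norm_integral_le_integral_norm zero_le_one

theorem le_amoebaDist {ν : ℝ → ℝ} (hν : IsAmoebaProfile ν) {Ω : Set Plane}
    {f : Plane → ℝ} (hf : ContDiffOn ℝ 1 f Ω) {x q : Plane} (hq : q ≠ x) :
    ENNReal.ofReal (‖q - x‖ * ν ((f q - f x) / ‖q - x‖)) ≤ amoebaDist ν Ω f x q :=
  le_iInf₂ fun _ hc => ENNReal.ofReal_le_ofReal (hc.le_amoebaLength hν hf hq)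

/-- The amoeba distance is at most the length of the straight line. -/
theorem amoebaDist_le_integral {ν : ℝ → ℝ} {Ω : Set Plane}
    {f : Plane → ℝ} {x h : Plane} (hh : h ≠ 0) (hΩ : ∀ t ∈ Icc (0 : ℝ) 1, x + t • h ∈ Ω)
    (hf : ∀ t ∈ Icc (0 : ℝ) 1, DifferentiableAt ℝ f (x + t • h)) :
    amoebaDist ν Ω f x (x + h) ≤ ENNReal.ofReal
      (∫ t in (0 : ℝ)..1, ν (fderiv ℝ f (x + t • h) h / ‖h‖) * ‖h‖) := by
  have hd : ∀ t, HasDerivAt (fun t : ℝ => x + t • h) h t := fun t => by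
    simpa using ((hasDerivAt_id t).smul_const h).const_add x
  have hu := uniqueDiffOn_Icc (zero_lt_one (α := ℝ))
  have hdw : ∀ t ∈ Icc (0 : ℝ) 1, derivWithin (fun t : ℝ => x + t • h) (Icc 0 1) t = h :=
    fun t ht => (hd t).hasDerivWithinAt.derivWithin (hu t ht)
  have hreg : IsRegularCurve Ω x (x + h) (fun t : ℝ => x + t • h) := by
    refine ⟨?_, fun t ht => ?_, hΩ, by simp, by simp⟩
    · have : ContDiff ℝ 1 fun t : ℝ => x + t • h := by fun_prop
      exact this.contDiffOn
    · rw [hdw t ht]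
      exact hh
  refine (iInf₂_le _ hreg).trans (le_of_eq ?_)
  congr 1
  refine intervalIntegral.integral_congr fun t ht => ?_
  rw [uIcc_of_le zero_le_one] at ht
  have h1 : derivWithin (f ∘ fun t : ℝ => x + t • h) (Icc 0 1) t = fderiv ℝ f (x + t • h) h :=
    ((hf t ht).hasFDerivAt.comp_hasDerivAt t (hd t)).hasDerivWithinAt.derivWithin (hu t ht)
  rw [h1, hdw t ht]


/-! ### Areas in rotated Cartesian and polar coordinates -/

theorem inner_unitVec (β : ℝ) (y : Plane) :
    inner ℝ (unitVec β) y = Real.cos β * y 0 + Real.sin β * y 1 := by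
  simp [unitVec, PiLp.inner_apply, Fin.sum_univ_two]
  ring

theorem inner_unitNormal (β : ℝ) (y : Plane) :
    inner ℝ (unitNormal β) y = -Real.sin β * y 0 + Real.cos β * y 1 := by
  simp [unitNormal, PiLp.inner_apply, Fin.sum_univ_two]
  ring

theorem inner_unitVec_self (β : ℝ) : inner ℝ (unitVec β) (unitVec β) = (1 : ℝ) := by
  rw [inner_unitVec]
  simp [unitVec]
  linarith [Real.sin_sq_add_cos_sq β]

theorem inner_unitNormal_self (β : ℝ) : inner ℝ (unitNormal β) (unitNormal β) = (1 : ℝ) := by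
  rw [inner_unitNormal]
  simp [unitNormal]
  linarith [Real.sin_sq_add_cos_sq β]

theorem inner_unitVec_unitNormal (β : ℝ) : inner ℝ (unitVec β) (unitNormal β) = (0 : ℝ) := by
  rw [inner_unitVec]
  simp [unitNormal]
  ring

theorem inner_unitNormal_unitVec (β : ℝ) : inner ℝ (unitNormal β) (unitVec β) = (0 : ℝ) := by
  rw [real_inner_comm, inner_unitVec_unitNormal]

/-- The coordinates with respect to the orthonormal frame `unitVec β`, `unitNormal β`. -/
def frameBasis (β : ℝ) : OrthonormalBasis (Fin 2) ℝ Plane :=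
  have hon : Orthonormal ℝ ![unitVec β, unitNormal β] := by
    rw [orthonormal_iff_ite]
    simp only [Fin.forall_fin_two]
    exact ⟨⟨(inner_unitVec_self β).trans (if_pos trivial).symm,
      (inner_unitVec_unitNormal β).trans (if_neg (by decide)).symm⟩,
      (inner_unitNormal_unitVec β).trans (if_neg (by decide)).symm,
      (inner_unitNormal_self β).trans (if_pos trivial).symm⟩
  OrthonormalBasis.mk hon
    (hon.linearIndependent.span_eq_top_of_card_eq_finrank' (by simp)).ge

theorem frameBasis_zero (β : ℝ) : frameBasis β 0 = unitVec β := by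
  simp [frameBasis]

theorem frameBasis_one (β : ℝ) : frameBasis β 1 = unitNormal β := by
  simp [frameBasis]

/-- The coordinates of a point of the plane in the frame `unitVec β`, `unitNormal β`. -/
def frameEquiv (β : ℝ) : Plane ≃ᵐ ℝ × ℝ :=
  (frameBasis β).repr.toMeasurableEquiv.trans
    ((MeasurableEquiv.toLp 2 (Fin 2 → ℝ)).symm.trans MeasurableEquiv.finTwoArrow)

theorem measurePreserving_frameEquiv (β : ℝ) : MeasurePreserving (frameEquiv β) :=
  (((volume_preserving_finTwoArrow ℝ)).comp
    (EuclideanSpace.volume_preserving_symm_measurableEquiv_toLp (Fin 2))).comp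
    (frameBasis β).measurePreserving_repr

theorem frameEquiv_apply (β : ℝ) (y : Plane) :
    frameEquiv β y = (inner ℝ (unitVec β) y, inner ℝ (unitNormal β) y) := by
  rw [← frameBasis_zero, ← frameBasis_one, ← OrthonormalBasis.repr_apply_apply,
    ← OrthonormalBasis.repr_apply_apply]
  rfl

theorem eq_frame (β : ℝ) (y : Plane) :
    y = inner ℝ (unitVec β) y • unitVec β + inner ℝ (unitNormal β) y • unitNormal β := by
  have := (frameBasis β).sum_repr' y
  rw [Fin.sum_univ_two, frameBasis_zero, frameBasis_one] at this
  exact this.symm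

theorem norm_unitVec (β : ℝ) : ‖unitVec β‖ = 1 := by
  rw [← frameBasis_zero]; exact (frameBasis β).norm_eq_one 0

theorem norm_unitNormal (β : ℝ) : ‖unitNormal β‖ = 1 := by
  rw [← frameBasis_one]; exact (frameBasis β).norm_eq_one 1

theorem inner_unitVec_unitVec (β θ : ℝ) :
    inner ℝ (unitVec β) (unitVec θ) = Real.cos (θ - β) := by
  rw [inner_unitVec, Real.cos_sub]
  simp [unitVec]
  ring

theorem unitVec_add (β θ : ℝ) :
    unitVec (β + θ) = Real.cos θ • unitVec β + Real.sin θ • unitNormal β := by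
  ext i
  fin_cases i <;> simp [unitVec, unitNormal, Real.cos_add, Real.sin_add] <;> ring

theorem unitVec_add_pi (β : ℝ) : unitVec (β + Real.pi) = -unitVec β := by
  rw [unitVec_add]; simp

theorem continuous_unitVec : Continuous unitVec := by
  unfold unitVec
  refine (PiLp.continuous_toLp 2 _).comp (continuous_pi fun i => ?_)
  fin_cases i
  · exact Real.continuous_cos
  · exact Real.continuous_sin

theorem frameEquiv_smul_unitVec (β r θ : ℝ) :
    frameEquiv β (r • unitVec (β + θ)) = (r * Real.cos θ, r * Real.sin θ) := by
  rw [frameEquiv_apply, unitVec_add]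
  simp only [inner_smul_right, inner_add_right, inner_unitVec_self, inner_unitNormal_self,
    inner_unitVec_unitNormal, inner_unitNormal_unitVec, mul_zero, mul_one, add_zero, zero_add]

theorem lintegral_ofReal_Ioc {Q : ℝ} (hQ : 0 ≤ Q) :
    ∫⁻ r in Ioc 0 Q, ENNReal.ofReal r = ENNReal.ofReal (Q ^ 2 / 2) := by
  rw [← ofReal_integral_eq_lintegral_ofReal]
  · rw [← intervalIntegral.integral_of_le hQ, integral_id]
    simp
  · exact (continuous_id.integrableOn_Icc).mono_set Ioc_subset_Icc_self
  · exact (ae_restrict_mem measurableSet_Ioc).mono fun r hr => hr.1.le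

/-- The set of points whose polar radius is at most `Q`. -/
def starSet (Q : Plane → ℝ) : Set Plane := {y | 0 < ‖y‖ ∧ ‖y‖ ≤ Q y}

theorem measurableSet_starSet {Q : Plane → ℝ} (hQ : Measurable Q) : MeasurableSet (starSet Q) :=
  (measurableSet_lt measurable_const measurable_norm).inter (measurableSet_le measurable_norm hQ)

/-- The area of half of a starshaped set. -/
theorem volume_starSet_inter_halfPlane {Q : Plane → ℝ} (hQm : Measurable Q)
    (hQh : ∀ (r : ℝ) y, 0 < r → Q (r • y) = Q y) (hQ0 : ∀ θ, 0 ≤ Q (unitVec θ)) {M : ℝ}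
    (hQM : ∀ θ, Q (unitVec θ) ≤ M) (β : ℝ) :
    volume (starSet Q ∩ {y | 0 < inner ℝ (unitVec β) y}) =
      ENNReal.ofReal (∫ θ in (β - Real.pi / 2)..(β + Real.pi / 2), Q (unitVec θ) ^ 2 / 2) := by
  set S := starSet Q ∩ {y | 0 < inner ℝ (unitVec β) y} with hS
  have hSm : MeasurableSet S := (measurableSet_starSet hQm).inter
    (measurableSet_lt measurable_const (by fun_prop))
  have hpi := Real.pi_pos
  -- Angles are measured from the axis `unitVec β`, so the half plane becomes the interval `(-π/2,
  -- π/2)` and stays away from the cut of polar coordinates.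
  set q : ℝ → ℝ := fun θ => Q (unitVec (β + θ)) with hq
  have hqm : Measurable q := hQm.comp (continuous_unitVec.measurable.comp (by fun_prop))
  have hmem : ∀ r θ : ℝ, 0 < r → θ ∈ Ioo (-Real.pi) Real.pi →
      ((frameEquiv β).symm (r * Real.cos θ, r * Real.sin θ) ∈ S ↔
        θ ∈ Ioo (-(Real.pi / 2)) (Real.pi / 2) ∧ r ≤ q θ) := by
    intro r θ hr hθ
    have hcos : 0 < Real.cos θ ↔ θ ∈ Ioo (-(Real.pi / 2)) (Real.pi / 2) := by
      refine ⟨fun h => ?_, Real.cos_pos_of_mem_Ioo⟩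
      by_contra hn
      rw [mem_Ioo, not_and_or, not_lt, not_lt] at hn
      rcases hn with hn | hn
      · have := Real.cos_nonpos_of_pi_div_two_le_of_le (x := -θ) (by linarith)
          (by linarith [hθ.1])
        rw [Real.cos_neg] at this
        linarith
      · linarith [Real.cos_nonpos_of_pi_div_two_le_of_le hn (by linarith [hθ.2])]
    rw [← frameEquiv_smul_unitVec, MeasurableEquiv.symm_apply_apply]
    have hn : ‖r • unitVec (β + θ)‖ = r := by
      rw [norm_smul, norm_unitVec, mul_one, Real.norm_of_nonneg hr.le]
    have hi : inner ℝ (unitVec β) (r • unitVec (β + θ)) = r * Real.cos θ := by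
      rw [inner_smul_right, inner_unitVec_unitVec, add_sub_cancel_left]
    rw [hS, starSet, mem_inter_iff, mem_ofPred_eq, mem_ofPred_eq, hn, hi, hQh r _ hr,
      mul_pos_iff_of_pos_left hr, hcos]
    tauto
  have h1 : volume S = ∫⁻ p : ℝ × ℝ, ((frameEquiv β).symm ⁻¹' S).indicator 1 p := by
    rw [lintegral_indicator_one ((frameEquiv β).symm.measurable hSm)]
    exact (((measurePreserving_frameEquiv β).symm _).measure_preimage_equiv S).symm
  have h2 : ∀ p ∈ polarCoord.target, ENNReal.ofReal p.1 •
      ((frameEquiv β).symm ⁻¹' S).indicator (1 : ℝ × ℝ → ℝ≥0∞) (polarCoord.symm p) =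
      {p : ℝ × ℝ | p.2 ∈ Ioo (-(Real.pi / 2)) (Real.pi / 2) ∧ p.1 ≤ q p.2}.indicator
        (fun p => ENNReal.ofReal p.1) p := by
    rintro ⟨r, θ⟩ hp
    rw [polarCoord_target] at hp
    have := hmem r θ hp.1 hp.2
    simp only [polarCoord_symm_apply]
    by_cases h : θ ∈ Ioo (-(Real.pi / 2)) (Real.pi / 2) ∧ r ≤ q θ
    · rw [indicator_of_mem (show _ ∈ (frameEquiv β).symm ⁻¹' S from this.2 h),
        indicator_of_mem (by exact h)]
      simp
    · rw [indicator_of_notMem (show _ ∉ (frameEquiv β).symm ⁻¹' S from fun h' => h (this.1 h')),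
        indicator_of_notMem (by exact h)]
      simp
  have hTm : MeasurableSet {p : ℝ × ℝ | p.2 ∈ Ioo (-(Real.pi / 2)) (Real.pi / 2) ∧ p.1 ≤ q p.2} :=
    (measurable_snd measurableSet_Ioo).inter
      (measurableSet_le measurable_fst (hqm.comp measurable_snd))
  rw [h1, ← lintegral_comp_polarCoord_symm, setLIntegral_congr_fun
    (by rw [polarCoord_target]; exact measurableSet_Ioi.prod measurableSet_Ioo) h2,
    polarCoord_target, Measure.volume_eq_prod, ← Measure.prod_restrict, lintegral_prod_symm _
      (Measurable.indicator (by fun_prop) hTm).aemeasurable]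
  have h3 : ∀ θ, ∫⁻ r in Ioi (0 : ℝ),
      {p : ℝ × ℝ | p.2 ∈ Ioo (-(Real.pi / 2)) (Real.pi / 2) ∧ p.1 ≤ q p.2}.indicator
        (fun p => ENNReal.ofReal p.1) (r, θ) =
      (Ioo (-(Real.pi / 2)) (Real.pi / 2)).indicator (fun θ => ENNReal.ofReal (q θ ^ 2 / 2)) θ := by
    intro θ
    by_cases hθ : θ ∈ Ioo (-(Real.pi / 2)) (Real.pi / 2)
    · rw [indicator_of_mem hθ, ← lintegral_ofReal_Ioc (hQ0 _),
        ← lintegral_indicator measurableSet_Ioi, ← lintegral_indicator measurableSet_Ioc]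
      refine lintegral_congr fun r => ?_
      by_cases hr : 0 < r
      · by_cases hrq : r ≤ q θ
        · rw [indicator_of_mem (show r ∈ Ioi 0 from hr),
            indicator_of_mem (by exact ⟨hθ, hrq⟩),
            indicator_of_mem (show r ∈ Ioc 0 (Q _) from ⟨hr, hrq⟩)]
        · rw [indicator_of_mem (show r ∈ Ioi 0 from hr),
            indicator_of_notMem (by exact fun h => hrq h.2),
            indicator_of_notMem (show r ∉ Ioc 0 (Q _) from fun h => hrq h.2)]
      · rw [indicator_of_notMem (show r ∉ Ioi 0 from hr),
          indicator_of_notMem (show r ∉ Ioc 0 (Q _) from fun h => hr h.1)]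
    · rw [indicator_of_notMem hθ]
      simp only [indicator, mem_ofPred_eq, hθ, false_and, if_false, lintegral_zero]
  simp_rw [h3]
  rw [lintegral_indicator measurableSet_Ioo, Measure.restrict_restrict measurableSet_Ioo,
    inter_eq_self_of_subset_left (Ioo_subset_Ioo (by linarith) (by linarith)),
    ← ofReal_integral_eq_lintegral_ofReal]
  · rw [← integral_Ioc_eq_integral_Ioo, ← intervalIntegral.integral_of_le (by linarith)]
    congr 1
    have := intervalIntegral.integral_comp_add_left (a := -(Real.pi / 2)) (b := Real.pi / 2)
      (fun θ => Q (unitVec θ) ^ 2 / 2) β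
    rw [this, ← sub_eq_add_neg]
  · refine Measure.integrableOn_of_bounded (M := M ^ 2 / 2) measure_Ioo_lt_top.ne
      ((hqm.pow_const 2).div_const 2).aestronglyMeasurable (ae_of_all _ fun θ => ?_)
    rw [Real.norm_of_nonneg (by positivity)]
    have := pow_le_pow_left₀ (hQ0 (β + θ)) (hQM (β + θ)) 2
    simp only [hq]
    linarith
  · exact ae_of_all _ fun θ => by simp only [Pi.zero_apply]; positivity

theorem volume_line_eq_zero (β : ℝ) : volume {y : Plane | inner ℝ (unitVec β) y = (0 : ℝ)} = 0 := by
  have h := Measure.addHaar_submodule (volume : Measure Plane)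
    (LinearMap.ker (innerSL ℝ (unitVec β)).toLinearMap) (fun h => ?_)
  · convert h using 2
    ext y
    simp
  · have : unitVec β ∈ LinearMap.ker (innerSL ℝ (unitVec β)).toLinearMap := by rw [h]; trivial
    simp [norm_unitVec] at this


/-- Only inclusions are used, so that the bound applies to sets not known to be measurable, such as
the amoeba. -/
theorem abs_measureReal_sub_le {α : Type*} [MeasurableSpace α] {μ : Measure α} {X Y Z : Set α}
    (hX : X ⊆ Y ∪ Z) (hY : Y ⊆ X ∪ Z) (hXf : μ X ≠ ⊤) (hYf : μ Y ≠ ⊤) (hZf : μ Z ≠ ⊤) :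
    |μ.real X - μ.real Y| ≤ μ.real Z := by
  have h1 : μ.real X ≤ μ.real Y + μ.real Z :=
    (measureReal_mono hX (measure_union_ne_top hYf hZf)).trans (measureReal_union_le _ _)
  have h2 : μ.real Y ≤ μ.real X + μ.real Z :=
    (measureReal_mono hY (measure_union_ne_top hXf hZf)).trans (measureReal_union_le _ _)
  rw [abs_sub_le_iff]
  constructor <;> linarith

/-- The region between two graphs over an interval of the axis `unitNormal β`. -/
def frameRegion (β a b : ℝ) (f g : ℝ → ℝ) : Set Plane :=
  {y | inner ℝ (unitNormal β) y ∈ Icc a b ∧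
    inner ℝ (unitVec β) y ∈ Ioo (f (inner ℝ (unitNormal β) y)) (g (inner ℝ (unitNormal β) y))}

theorem volume_frameRegion (β : ℝ) {a b : ℝ} (hab : a ≤ b) {f g : ℝ → ℝ} (hf : Continuous f)
    (hg : Continuous g) (hfg : ∀ x ∈ Icc a b, f x ≤ g x) :
    volume (frameRegion β a b f g) = ENNReal.ofReal (∫ x in a..b, (g x - f x)) := by
  have h1 : frameRegion β a b f g =
      ((frameEquiv β).trans MeasurableEquiv.prodComm) ⁻¹' regionBetween f g (Icc a b) := by
    ext y
    simp only [frameRegion, regionBetween, mem_preimage, MeasurableEquiv.trans_apply,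
      frameEquiv_apply]
    rfl
  have h2 : MeasurePreserving ((frameEquiv β).trans MeasurableEquiv.prodComm) :=
    Measure.measurePreserving_swap.comp (measurePreserving_frameEquiv β)
  rw [h1, h2.measure_preimage_equiv, Measure.volume_eq_prod,
    volume_regionBetween_eq_integral hf.integrableOn_Icc hg.integrableOn_Icc measurableSet_Icc hfg,
    integral_Icc_eq_integral_Ioc, ← intervalIntegral.integral_of_le hab]
  rfl

theorem volumeReal_frameRegion (β : ℝ) {a b : ℝ} (hab : a ≤ b) {f g : ℝ → ℝ} (hf : Continuous f)
    (hg : Continuous g) (hfg : ∀ x ∈ Icc a b, f x ≤ g x) :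
    volume.real (frameRegion β a b f g) = ∫ x in a..b, (g x - f x) := by
  rw [measureReal_def, volume_frameRegion β hab hf hg hfg, ENNReal.toReal_ofReal]
  exact intervalIntegral.integral_nonneg hab fun x hx => sub_nonneg.2 (hfg x hx)

/-- Comparison, on a set `A`, of a half plane with a set `P` whose boundary is close to the graph
of `γ` over the boundary line of the half plane. -/
theorem abs_volume_inter_sub_halfPlane_le (β : ℝ) {A P : Set Plane} {γ : ℝ → ℝ} {T Λ σ τ : ℝ}
    (hA : volume A ≠ ⊤) (hT : 0 ≤ T) (hΛ : 0 ≤ Λ) (hσ : 0 ≤ σ) (hτ : 0 ≤ τ)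
    (hγ : Continuous γ)
    (hfar : ∀ y ∈ A, Λ ≤ |inner ℝ (unitVec β) y| → (y ∈ P ↔ inner ℝ (unitVec β) y < 0))
    (hAT : ∀ y ∈ A, |inner ℝ (unitVec β) y| < Λ → |inner ℝ (unitNormal β) y| ≤ T + τ)
    (hTA : ∀ y, y ≠ 0 → |inner ℝ (unitVec β) y| < Λ → |inner ℝ (unitNormal β) y| < T - τ → y ∈ A)
    (hP : ∀ y, |inner ℝ (unitVec β) y| < Λ → |inner ℝ (unitNormal β) y| ≤ T →
      (inner ℝ (unitVec β) y < γ (inner ℝ (unitNormal β) y) - σ → y ∈ P) ∧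
      (y ∈ P → inner ℝ (unitVec β) y < γ (inner ℝ (unitNormal β) y) + σ))
    (hγΛ : ∀ t, |t| ≤ T → |γ t| + σ ≤ Λ) :
    |volume.real (A ∩ P) - volume.real (A ∩ {y | inner ℝ (unitVec β) y < 0}) -
      ∫ t in (-T)..T, γ t| ≤ 2 * T * σ + 16 * Λ * τ := by
  set H : Set Plane := {y | inner ℝ (unitVec β) y < 0} with hH
  set St : Set Plane := {y | |inner ℝ (unitVec β) y| < Λ} with hSt
  have hStm : MeasurableSet St := measurableSet_lt (by fun_prop) measurable_const
  set R : Set Plane := frameRegion β (-T) T (fun _ => -Λ) (fun _ => Λ) with hR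
  set E₁ : Set Plane := frameRegion β (T - τ) (T + τ) (fun _ => -Λ) (fun _ => Λ) with hE₁
  set E₂ : Set Plane := frameRegion β (-T - τ) (-T + τ) (fun _ => -Λ) (fun _ => Λ) with hE₂
  -- Inside the strip, `A` differs from the rectangle `R` only near its two ends. The origin is
  -- added because nothing is assumed about its membership in `A`.
  set E : Set Plane := E₁ ∪ E₂ ∪ {0} with hE
  have hvol : ∀ a b, a ≤ b → volume (frameRegion β a b (fun _ => -Λ) (fun _ => Λ)) =
      ENNReal.ofReal ((b - a) * (2 * Λ)) := fun a b hab => by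
    rw [volume_frameRegion β hab continuous_const continuous_const (fun _ _ => by linarith)]
    simp only [intervalIntegral.integral_const, smul_eq_mul]
    ring_nf
  have hRf : volume R ≠ ⊤ := by rw [hR, hvol _ _ (by linarith)]; exact ENNReal.ofReal_ne_top
  have hE₁f : volume E₁ ≠ ⊤ := by rw [hE₁, hvol _ _ (by linarith)]; exact ENNReal.ofReal_ne_top
  have hE₂f : volume E₂ ≠ ⊤ := by rw [hE₂, hvol _ _ (by linarith)]; exact ENNReal.ofReal_ne_top
  have hEf : volume E ≠ ⊤ :=
    measure_union_ne_top (measure_union_ne_top hE₁f hE₂f) (by simp)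
  have hEvol : volume.real E ≤ 8 * Λ * τ := by
    refine (measureReal_union_le _ _).trans ?_
    have h0 : volume.real ({0} : Set Plane) = 0 := by simp [measureReal_def]
    have h1 : volume.real E₁ = 2 * τ * (2 * Λ) := by
      rw [measureReal_def, hE₁, hvol _ _ (by linarith), ENNReal.toReal_ofReal]
      · ring
      · have : 0 ≤ T + τ - (T - τ) := by linarith
        positivity
    have h2 : volume.real E₂ = 2 * τ * (2 * Λ) := by
      rw [measureReal_def, hE₂, hvol _ _ (by linarith), ENNReal.toReal_ofReal]
      · ring
      · have : 0 ≤ -T + τ - (-T - τ) := by linarith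
        positivity
    have := measureReal_union_le (μ := volume) E₁ E₂
    linarith
  have hmemR : ∀ y, y ∈ R ↔ |inner ℝ (unitNormal β) y| ≤ T ∧ |inner ℝ (unitVec β) y| < Λ :=
    fun y => by rw [abs_le, abs_lt]; rfl
  have hmemE : ∀ y, |inner ℝ (unitVec β) y| < Λ → T - τ ≤ |inner ℝ (unitNormal β) y| →
      |inner ℝ (unitNormal β) y| ≤ T + τ → y ∈ E := by
    intro y h1 h2 h3
    refine Or.inl ?_
    rcases abs_cases (inner ℝ (unitNormal β) y) with h | h
    · exact Or.inl ⟨⟨by linarith, by linarith⟩, abs_lt.1 h1⟩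
    · exact Or.inr ⟨⟨by linarith, by linarith⟩, abs_lt.1 h1⟩
  -- The same comparison is made for `P` and for the half plane, and each costs `8 * Λ * τ`.
  have hsub : ∀ X : Set Plane, |volume.real (A ∩ X ∩ St) - volume.real (R ∩ X)| ≤
      8 * Λ * τ := by
    intro X
    refine (abs_measureReal_sub_le (Z := E) ?_ ?_ (measure_ne_top_of_subset
      (fun y hy => hy.1.1) hA) (measure_ne_top_of_subset inter_subset_left hRf) hEf).trans hEvol
    · rintro y ⟨⟨hyA, hyX⟩, hyS⟩
      have hyS' : |inner ℝ (unitVec β) y| < Λ := hyS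
      rcases le_or_gt |inner ℝ (unitNormal β) y| T with h | h
      · exact Or.inl ⟨(hmemR y).2 ⟨h, hyS'⟩, hyX⟩
      · exact Or.inr (hmemE y hyS' (by linarith) (hAT y hyA hyS'))
    · rintro y ⟨hyR, hyX⟩
      obtain ⟨h1, h2⟩ := (hmemR y).1 hyR
      rcases eq_or_ne y 0 with h0 | h0
      · exact Or.inr (Or.inr h0)
      rcases lt_or_ge |inner ℝ (unitNormal β) y| (T - τ) with h | h
      · exact Or.inl ⟨⟨hTA y h0 h2 h, hyX⟩, h2⟩
      · exact Or.inr (hmemE y h2 h (by linarith))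
  have hsplit : ∀ X : Set Plane, volume.real (A ∩ X) =
      volume.real (A ∩ X ∩ St) + volume.real ((A ∩ X) \ St) := fun X =>
    (measureReal_inter_add_sdiff hStm (measure_ne_top_of_subset inter_subset_left hA)).symm
  have hdiff : (A ∩ P) \ St = (A ∩ H) \ St := by
    ext y
    constructor
    · rintro ⟨⟨h1, h2⟩, h3⟩
      exact ⟨⟨h1, (hfar y h1 (not_lt.1 h3)).1 h2⟩, h3⟩
    · rintro ⟨⟨h1, h2⟩, h3⟩
      exact ⟨⟨h1, (hfar y h1 (not_lt.1 h3)).2 h2⟩, h3⟩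
  have hRH : volume.real (R ∩ H) = 2 * T * Λ := by
    have : R ∩ H = frameRegion β (-T) T (fun _ => -Λ) (fun _ => 0) := by
      ext y
      constructor
      · rintro ⟨⟨h1, h2⟩, h3⟩
        exact ⟨h1, h2.1, h3⟩
      · rintro ⟨h1, h2⟩
        exact ⟨⟨h1, h2.1, h2.2.trans_le hΛ⟩, h2.2⟩
    rw [this, volumeReal_frameRegion β (by linarith) continuous_const continuous_const
      (fun _ _ => by linarith)]
    simp only [intervalIntegral.integral_const, smul_eq_mul]
    ring
  have hregion : ∀ s, |s| ≤ σ → volume.real (frameRegion β (-T) T (fun _ => -Λ)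
      (fun t => γ t + s)) = (∫ t in (-T)..T, γ t) + 2 * T * s + 2 * T * Λ := by
    intro s hs
    have hγs : Continuous fun t => γ t + s := by fun_prop
    rw [volumeReal_frameRegion β (by linarith) continuous_const (by fun_prop) fun t ht => ?_]
    · rw [intervalIntegral.integral_sub (hγs.intervalIntegrable _ _)
        intervalIntegrable_const, intervalIntegral.integral_add (hγ.intervalIntegrable _ _)
        intervalIntegrable_const]
      simp only [intervalIntegral.integral_const, smul_eq_mul]
      ring
    · have h1 := hγΛ t (abs_le.2 ht)
      have h2 := (abs_le.1 (le_refl |γ t|)).1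
      have h3 := (abs_le.1 hs).1
      linarith
  -- In the rectangle, `P` is enclosed between the regions below `γ - σ` and `γ + σ`. The bound on
  -- `|γ| + σ` keeps both graphs inside the strip.
  have hRP : |volume.real (R ∩ P) - 2 * T * Λ - ∫ t in (-T)..T, γ t| ≤ 2 * T * σ := by
    have h1 : volume.real (R ∩ P) ≤ (∫ t in (-T)..T, γ t) + 2 * T * σ + 2 * T * Λ := by
      rw [← hregion σ (abs_of_nonneg hσ).le]
      refine measureReal_mono ?_ ?_
      · rintro y ⟨hyR, hyP⟩
        obtain ⟨h1, h2⟩ := (hmemR y).1 hyR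
        exact ⟨abs_le.1 h1, (abs_lt.1 h2).1, (hP y h2 h1).2 hyP⟩
      · rw [volume_frameRegion β (by linarith) continuous_const (by fun_prop) fun t ht => ?_]
        · exact ENNReal.ofReal_ne_top
        · have h1 := hγΛ t (abs_le.2 ht)
          have h2 := (abs_le.1 (le_refl |γ t|)).1
          linarith
    have h2 : (∫ t in (-T)..T, γ t) + 2 * T * (-σ) + 2 * T * Λ ≤ volume.real (R ∩ P) := by
      rw [← hregion (-σ) (by rw [abs_neg, abs_of_nonneg hσ])]
      refine measureReal_mono ?_ (measure_ne_top_of_subset inter_subset_left hRf)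
      rintro y ⟨h1, h2⟩
      have h3 := hγΛ _ (abs_le.2 h1)
      have h4 : inner ℝ (unitVec β) y < γ (inner ℝ (unitNormal β) y) + -σ := h2.2
      have h5 : |inner ℝ (unitVec β) y| < Λ := by
        rw [abs_lt]
        exact ⟨h2.1, by linarith [le_abs_self (γ (inner ℝ (unitNormal β) y))]⟩
      exact ⟨(hmemR y).2 ⟨abs_le.2 h1, h5⟩, (hP y h5 (abs_le.2 h1)).1 (by linarith)⟩
    rw [abs_le]
    constructor <;> linarith
  have e1 := abs_le.1 (hsub P)
  have e2 := abs_le.1 (hsub H)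
  have e3 := abs_le.1 hRP
  rw [hsplit P, hsplit H, hdiff, abs_le]
  constructor <;> linarith [e1.1, e1.2, e2.1, e2.2, e3.1, e3.2]


/-! ### Radial description of amoebas -/

/-- The argument increment `z` is known only up to `E`. The symmetric slope is bounded by `L`, so
replacing `z` by its main part `c` adds `L * E`. -/
theorem profile_expansion {ν : ℝ → ℝ} {L h a z c E : ℝ} (hc : ConvexOn ℝ univ ν)
    (hL : ∀ s t, |ν s - ν t| ≤ L * |s - t|) (hh : 0 < h) (hz : |z| ≤ h) (hzc : |z - c| ≤ E) :
    |ν (a + z) - ν a - symmSlope ν h a * c| ≤ secondDiff ν h a / 2 + L * E := by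
  have h1 := abs_sub_symmSlope_le hc hh a hz
  have h2 : |symmSlope ν h a * (z - c)| ≤ L * E := by
    rw [abs_mul]
    exact mul_le_mul (abs_symmSlope_le hL hh a) hzc (abs_nonneg _)
      ((abs_nonneg _).trans (abs_symmSlope_le hL hh a))
  calc _ = |(ν (a + z) - ν a - symmSlope ν h a * z) + symmSlope ν h a * (z - c)| := by
        congr 1; ring
    _ ≤ _ := (abs_add_le _ _).trans (add_le_add h1 h2)

/-- Approximate solution of the quadratic equation `q (v + c ρ q) = 1`. -/
theorem radial_estimate {ν₀ c₀ v c ρ q e ε : ℝ} (hν₀ : 0 < ν₀) (hv : ν₀ ≤ v) (hc : |c| ≤ c₀)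
    (hρ : 0 < ρ) (hρ1 : ρ ≤ 1) (hρ2 : c₀ * ρ ≤ ν₀ ^ 3)
    (hρ3 : c₀ * ρ * (2 * (1 / ν₀ + 1)) ≤ ν₀ / 2) (hq0 : 0 < q) (he : 0 ≤ e)
    (hε : (2 * c₀ ^ 2 / ν₀ ^ 4 + c₀ ^ 3 / ν₀ ^ 6) * ρ ^ 2 + (1 / ν₀ + 1) * e ≤ ε * (ν₀ / 2)) :
    (q ≤ 1 / v - ρ * c / v ^ 3 - ε → q * (v + c * ρ * q + e) ≤ 1) ∧
    (q ≤ 1 / ν₀ + 1 → q * (v + c * ρ * q - e) ≤ 1 → q ≤ 1 / v - ρ * c / v ^ 3 + ε) := by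
  have hv0 : 0 < v := hν₀.trans_le hv
  have hc0 : 0 ≤ c₀ := (abs_nonneg c).trans hc
  set M := 1 / ν₀ + 1 with hM
  have hM0 : 0 < M := by positivity
  set Q := 1 / v - ρ * c / v ^ 3 with hQ
  have hε0 : 0 ≤ ε := by
    have : 0 ≤ ε * (ν₀ / 2) := le_trans (by positivity) hε
    exact nonneg_of_mul_nonneg_left this (by positivity)
  have hQM : |Q| ≤ M := by
    have h1 : |1 / v| ≤ 1 / ν₀ := by
      rw [abs_of_pos (by positivity)]
      exact one_div_le_one_div_of_le hν₀ hv
    have h2 : |ρ * c / v ^ 3| ≤ 1 := by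
      rw [abs_div, abs_mul, abs_of_pos hρ, abs_of_pos (pow_pos hv0 3), div_le_one (pow_pos hv0 3)]
      have := pow_le_pow_left₀ hν₀.le hv 3
      nlinarith
    exact (abs_sub _ _).trans (add_le_add h1 h2)
  -- `Q` is the first order expansion in `ρ` of the root near `1 / v`; it solves the equation up to
  -- `ρ²`.
  have hGQ : |Q * (v + c * ρ * Q) - 1| ≤ (2 * c₀ ^ 2 / ν₀ ^ 4 + c₀ ^ 3 / ν₀ ^ 6) * ρ ^ 2 := by
    have h1 : Q * (v + c * ρ * Q) - 1 = -(2 * c ^ 2 / v ^ 4 * ρ ^ 2) + c ^ 3 / v ^ 6 * ρ ^ 3 := by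
      rw [hQ]; field_simp; ring
    rw [h1, add_mul]
    refine (abs_add_le _ _).trans (add_le_add ?_ ?_)
    · rw [abs_neg, abs_mul, abs_div, abs_mul, abs_pow, abs_pow, abs_pow, abs_of_pos hρ,
        abs_of_pos hv0, abs_two]
      gcongr
    · rw [abs_mul, abs_div, abs_pow, abs_pow, abs_pow, abs_of_pos hρ, abs_of_pos hv0]
      have h2 : ρ ^ 3 ≤ ρ ^ 2 := pow_le_pow_of_le_one hρ.le hρ1 (by norm_num)
      gcongr
  -- This is the factor in the difference of two values of the quadratic, as written in `hdiff`. Its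
  -- lower bound `ν₀ / 2` converts an error in the equation into an error in the root.
  have hfac : ∀ q, 0 < q → q ≤ M → ν₀ / 2 ≤ v + c * ρ * (q + Q) := by
    intro q hq hqM
    have h1 : |c * ρ * (q + Q)| ≤ c₀ * ρ * (2 * M) := by
      rw [abs_mul, abs_mul, abs_of_pos hρ]
      have : |q + Q| ≤ 2 * M := by
        have := (abs_add_le q Q)
        rw [abs_of_pos hq] at this
        linarith
      gcongr
    have := (abs_le.1 h1).1
    linarith
  have hdiff : q * (v + c * ρ * q) - Q * (v + c * ρ * Q) = (q - Q) * (v + c * ρ * (q + Q)) := by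
    ring
  have hb := abs_le.1 hGQ
  constructor
  · intro hq
    have hqM : q ≤ M := by linarith [le_abs_self Q]
    have h1 := hfac q hq0 hqM
    have h2 : ε * (ν₀ / 2) ≤ (Q - q) * (v + c * ρ * (q + Q)) :=
      mul_le_mul (by linarith) h1 (by positivity) (by linarith)
    have h3 : q * e ≤ M * e := mul_le_mul_of_nonneg_right hqM he
    nlinarith [hb.2]
  · intro hqM hq
    by_contra hlt
    push Not at hlt
    have h1 := hfac q hq0 hqM
    have h2 : ε * (ν₀ / 2) < (q - Q) * (v + c * ρ * (q + Q)) :=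
      mul_lt_mul (by linarith) h1 (by positivity) (by linarith)
    have h3 : q * e ≤ M * e := mul_le_mul_of_nonneg_right hqM he
    nlinarith [hb.1]

/-- First order approximation, in direction `y`, of the radius of an amoeba divided by its nominal
radius `ρ`, where `l` and `D` are the first two derivatives of the steering function. -/
def approxRadius (ν : ℝ → ℝ) (l : Plane →L[ℝ] ℝ) (D : Plane →L[ℝ] Plane →L[ℝ] ℝ) (h ρ : ℝ)
    (y : Plane) : ℝ :=
  1 / ν (l y / ‖y‖) -
    ρ * (symmSlope ν h (l y / ‖y‖) * (D y y / ‖y‖ ^ 2) / 2) / ν (l y / ‖y‖) ^ 3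

/-- Bound for the error of `approxRadius`. -/
def radiusError (ν : ℝ → ℝ) (l : Plane →L[ℝ] ℝ) (C h ρ : ℝ) (y : Plane) : ℝ :=
  C * (secondDiff ν h (l y / ‖y‖) + ρ ^ 2)

set_option maxHeartbeats 1000000 in
-- The inner inclusion comes from the length of the straight segment, the outer one from the chord
-- bound. Both give `‖y‖ (ν a + c ρ ‖y‖ ± e)` with the same `c`, to which `radial_estimate` applies.
-- The center is left out: its own distance involves closed regular curves, and a single point
-- carries no area.
theorem exists_amoeba_radial {ν : ℝ → ℝ} (hν : IsAmoebaProfile ν) {Ω : Set Plane}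
    {f : Plane → ℝ} (hf : ContDiffOn ℝ ∞ f Ω) {x : Plane} (hx : x ∈ interior Ω) :
    ∃ K C ρ₀, 0 < K ∧ 0 < C ∧ 0 < ρ₀ ∧ ∀ ρ, 0 < ρ → ρ < ρ₀ → ∀ y : Plane, y ≠ 0 →
      (‖y‖ ≤ approxRadius ν (fderiv ℝ f x) (fderiv ℝ (fderiv ℝ f) x) (K * ρ) ρ y -
        radiusError ν (fderiv ℝ f x) C (K * ρ) ρ y → x + ρ • y ∈ amoeba ν Ω f x ρ) ∧
      (x + ρ • y ∈ amoeba ν Ω f x ρ → ‖y‖ ≤ 1 / ν 0 ∧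
        ‖y‖ ≤ approxRadius ν (fderiv ℝ f x) (fderiv ℝ (fderiv ℝ f) x) (K * ρ) ρ y +
          radiusError ν (fderiv ℝ f x) C (K * ρ) ρ y) := by
  obtain ⟨L, hL0, hL⟩ := hν.exists_lipschitz
  have hΩ : Ω ∈ 𝓝 x := mem_interior_iff_mem_nhds.1 hx
  have hfx : ContDiffAt ℝ 3 f x := (hf.contDiffAt hΩ).of_le (WithTop.coe_le_coe.2 (le_top (a := (3 : ℕ∞))))
  obtain ⟨r₁, C₁, hr₁, hC₁, hT⟩ := hfx.exists_taylor_two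
  obtain ⟨r₂, hr₂, hball⟩ := Metric.nhds_basis_closedBall.mem_iff.1 hΩ
  set l := fderiv ℝ f x
  set D := fderiv ℝ (fderiv ℝ f) x
  have hν₀ := hν.pos
  set ν₀ := ν 0
  set M := 1 / ν₀ + 1 with hM
  have hM0 : 0 < M := by positivity
  -- `K * ρ` bounds the variation of the slope of `f` along a ray of length `ρ * M`, so it is an
  -- admissible scale for the symmetric difference quotient.
  set K := ‖D‖ * M + C₁ * M ^ 2 + 1 with hK
  have hK0 : 0 < K := by positivity
  set c₀ := L * ‖D‖ / 2 with hc₀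
  have hc₀0 : 0 ≤ c₀ := by positivity
  set C₃ := 2 * c₀ ^ 2 / ν₀ ^ 4 + c₀ ^ 3 / ν₀ ^ 6 with hC₃
  have hC₃0 : 0 ≤ C₃ := by positivity
  set E := C₁ * M ^ 2 with hE
  have hE0 : 0 ≤ E := by positivity
  set C := 2 / ν₀ * (C₃ + M * (1 + L * E)) with hC
  have hC0 : 0 < C := by positivity
  have hsmall : ∀ᶠ ρ : ℝ in 𝓝 0, ρ < 1 ∧ ρ * M < r₁ ∧ ρ * M < r₂ ∧ c₀ * ρ < ν₀ ^ 3 ∧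
      c₀ * ρ * (2 * M) < ν₀ / 2 := by
    refine .and ?_ (.and ?_ (.and ?_ (.and ?_ ?_))) <;>
      refine ContinuousAt.eventually_lt (by fun_prop) (by fun_prop) ?_ <;> simp <;> positivity
  obtain ⟨ρ₀, hρ₀, hρ₀'⟩ := Metric.eventually_nhds_iff.1 hsmall
  refine ⟨K, C, ρ₀, hK0, hC0, hρ₀, fun ρ hρ hρlt y hy => ?_⟩
  obtain ⟨hρ1, hρr₁, hρr₂, hρ2, hρ3⟩ := hρ₀' (y := ρ) (by simpa [abs_of_pos hρ] using hρlt)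
  have hq0 : 0 < ‖y‖ := norm_pos_iff.2 hy
  set a := l y / ‖y‖ with ha
  set b := D y y / ‖y‖ ^ 2 with hb
  have hbD : |b| ≤ ‖D‖ := by
    rw [hb, abs_div, abs_of_pos (pow_pos hq0 2), div_le_iff₀ (pow_pos hq0 2), pow_two, ← mul_assoc]
    exact D.le_opNorm₂ y y
  have hκ := abs_symmSlope_le hL (mul_pos hK0 hρ) a
  have hc : |symmSlope ν (K * ρ) a * b / 2| ≤ c₀ := by
    rw [hc₀, abs_div, abs_mul, abs_two]
    gcongr
  have hΔ := secondDiff_nonneg hν.convexOn (K * ρ) a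
  set Δ := secondDiff ν (K * ρ) a with hΔdef
  set e := Δ / 2 + L * (E * ρ ^ 2) with he
  have he0 : 0 ≤ e := by positivity
  have hε : C₃ * ρ ^ 2 + M * e ≤ C * (Δ + ρ ^ 2) * (ν₀ / 2) := by
    have : C * (Δ + ρ ^ 2) * (ν₀ / 2) = (C₃ + M * (1 + L * E)) * (Δ + ρ ^ 2) := by
      rw [hC]; field_simp
    have h1 : 0 ≤ M * Δ := by positivity
    have h2 : 0 ≤ C₃ * Δ := by positivity
    have h3 : 0 ≤ M * ρ ^ 2 := by positivity
    have h4 : 0 ≤ M * (L * E) * Δ := by positivity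
    have h5 : (C₃ + M * (1 + L * E)) * (Δ + ρ ^ 2) - (C₃ * ρ ^ 2 + M * e) =
        C₃ * Δ + M * Δ / 2 + M * ρ ^ 2 + M * (L * E) * Δ := by rw [he]; ring
    linarith
  have hrad := radial_estimate (q := ‖y‖) hν₀ (hν.zero_le a) hc hρ hρ1.le hρ2.le hρ3.le hq0 he0 hε
  have hρy : ‖ρ • y‖ = ρ * ‖y‖ := by rw [norm_smul, Real.norm_of_nonneg hρ.le]
  have hρy0 : 0 < ‖ρ • y‖ := by rw [hρy]; positivity
  -- expansion of the profile along the ray through `y`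
  have hexp : ‖y‖ ≤ M → ∀ τ z, 0 ≤ τ → τ ≤ 1 → |z - τ * (ρ * b * ‖y‖)| ≤ C₁ * (ρ * ‖y‖) ^ 2 →
      |ν (a + z) - ν a - symmSlope ν (K * ρ) a * (τ * (ρ * b * ‖y‖))| ≤ e := by
    intro hyM τ z hτ0 hτ1 hz
    have hzE : |z - τ * (ρ * b * ‖y‖)| ≤ E * ρ ^ 2 := by
      refine hz.trans ?_
      rw [hE, mul_pow, mul_assoc, mul_comm (M ^ 2)]
      gcongr
    refine profile_expansion hν.convexOn hL (mul_pos hK0 hρ) ?_ hzE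
    have h1 : |τ * (ρ * b * ‖y‖)| ≤ ‖D‖ * M * ρ := by
      rw [abs_mul, abs_mul, abs_mul, abs_of_nonneg hτ0, abs_of_pos hρ, abs_norm]
      calc τ * (ρ * |b| * ‖y‖) ≤ 1 * (ρ * ‖D‖ * M) := by gcongr
        _ = _ := by ring
    have h2 : E * ρ ^ 2 ≤ E * ρ := by
      have : ρ ^ 2 ≤ ρ := pow_le_of_le_one hρ.le hρ1.le two_ne_zero
      gcongr
    calc |z| = |(z - τ * (ρ * b * ‖y‖)) + τ * (ρ * b * ‖y‖)| := by ring_nf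
      _ ≤ E * ρ ^ 2 + ‖D‖ * M * ρ := (abs_add_le _ _).trans (add_le_add hzE h1)
      _ ≤ K * ρ := by rw [hK, add_mul, add_mul, one_mul]; linarith
  have hlρ : l (ρ • y) / ‖ρ • y‖ = a := by
    rw [hρy, map_smul, smul_eq_mul, ha]; field_simp
  constructor
  · intro hin
    have hyM : ‖y‖ ≤ M := by
      have h1 : 1 / ν a ≤ 1 / ν₀ := one_div_le_one_div_of_le hν₀ (hν.zero_le a)
      have h2 : |ρ * (symmSlope ν (K * ρ) a * b / 2) / ν a ^ 3| ≤ 1 := by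
        have hva := pow_le_pow_left₀ hν₀.le (hν.zero_le a) 3
        rw [abs_div, abs_mul, abs_of_pos hρ, abs_of_pos (pow_pos (hν.pos' a) 3),
          div_le_one (pow_pos (hν.pos' a) 3)]
        exact (mul_le_mul_of_nonneg_left hc hρ.le).trans (by linarith)
      have h3 : 0 ≤ C * (Δ + ρ ^ 2) := by positivity
      simp only [approxRadius, radiusError] at hin
      linarith [(abs_le.1 h2).1]
    have hin' := hrad.1 hin
    have hseg : ∀ t ∈ Icc (0 : ℝ) 1, ‖t • ρ • y‖ ≤ ρ * M := fun t ht => by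
      rw [norm_smul, hρy, Real.norm_of_nonneg ht.1]
      calc _ ≤ 1 * (ρ * M) := by
            gcongr
            exact ht.2
        _ = _ := one_mul _
    have hmemΩ : ∀ t ∈ Icc (0 : ℝ) 1, x + t • ρ • y ∈ Ω := fun t ht =>
      hball (by simpa using (hseg t ht).trans hρr₂.le)
    refine ⟨by simpa using hmemΩ 1 ⟨zero_le_one, le_rfl⟩, ?_⟩
    refine (amoebaDist_le_integral (norm_pos_iff.1 hρy0) hmemΩ fun t ht =>
      (hT _ ((hseg t ht).trans hρr₁.le)).1).trans (ENNReal.ofReal_le_ofReal ?_)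
    have hle : ∀ t ∈ Icc (0 : ℝ) 1, ν (fderiv ℝ f (x + t • ρ • y) (ρ • y) / ‖ρ • y‖) * ‖ρ • y‖ ≤
        (ν a + e + symmSlope ν (K * ρ) a * (ρ * b * ‖y‖) * t) * (ρ * ‖y‖) := by
      intro t ht
      have h1 := (hT _ ((hseg t ht).trans hρr₁.le)).2.1 (ρ • y)
      set z := fderiv ℝ f (x + t • ρ • y) (ρ • y) / ‖ρ • y‖ - a with hz
      have h2 : |z - t * (ρ * b * ‖y‖)| ≤ C₁ * (ρ * ‖y‖) ^ 2 := by
        have h3 : z - t * (ρ * b * ‖y‖) = (fderiv ℝ f (x + t • ρ • y) (ρ • y) - l (ρ • y) -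
            D (t • ρ • y) (ρ • y)) / ‖ρ • y‖ := by
          rw [hz, ← hlρ, sub_div, sub_div]
          congr 1
          simp only [map_smul, smul_apply, smul_eq_mul, hρy, hb]
          field_simp
        rw [h3, abs_div, abs_norm, div_le_iff₀ hρy0]
        refine h1.trans ?_
        have h4 : ‖t • ρ • y‖ ≤ ρ * ‖y‖ := by
          rw [norm_smul, hρy, Real.norm_of_nonneg ht.1]
          exact mul_le_of_le_one_left (by positivity) ht.2
        gcongr
      have h5 := (abs_le.1 (hexp hyM t z ht.1 ht.2 h2)).2
      have h6 : fderiv ℝ f (x + t • ρ • y) (ρ • y) / ‖ρ • y‖ = a + z := by rw [hz]; ring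
      rw [h6, hρy]
      refine mul_le_mul_of_nonneg_right ?_ (by positivity)
      linarith
    -- Integrating the linear growth in `t` gives the factor `1 / 2` that the chord slope has as
    -- well; this is why segment and chord agree to this order.
    have hint : ∫ t in (0 : ℝ)..1, (ν a + e + symmSlope ν (K * ρ) a * (ρ * b * ‖y‖) * t) *
        (ρ * ‖y‖) = (‖y‖ * (ν a + symmSlope ν (K * ρ) a * b / 2 * ρ * ‖y‖ + e)) * ρ := by
      rw [intervalIntegral.integral_mul_const, intervalIntegral.integral_add
        intervalIntegrable_const (Continuous.intervalIntegrable (by fun_prop) _ _),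
        intervalIntegral.integral_const, intervalIntegral.integral_const_mul, integral_id]
      simp only [smul_eq_mul]
      ring
    calc _ ≤ ∫ t in (0 : ℝ)..1, (ν a + e + symmSlope ν (K * ρ) a * (ρ * b * ‖y‖) * t) *
        (ρ * ‖y‖) := by
          rw [intervalIntegral.integral_of_le zero_le_one,
            intervalIntegral.integral_of_le zero_le_one]
          refine integral_mono_of_nonneg (ae_of_all _ fun t =>
            mul_nonneg (hν.nonneg _) (norm_nonneg _)) ?_ ?_
          · exact (Continuous.integrableOn_Icc (by fun_prop)).mono_set Ioc_subset_Icc_self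
          · exact (ae_restrict_mem measurableSet_Ioc).mono fun t ht => hle t ⟨ht.1.le, ht.2⟩
      _ ≤ ρ := by
          rw [hint]
          exact mul_le_of_le_one_left hρ.le hin'
  · rintro ⟨-, hd⟩
    have hne : x + ρ • y ≠ x := by
      simpa using norm_pos_iff.1 hρy0
    have h1 := (le_amoebaDist hν (hf.of_le (mod_cast le_top (a := (1 : ℕ∞)))) hne).trans hd
    rw [ENNReal.ofReal_le_ofReal_iff hρ.le, add_sub_cancel_left, hρy] at h1
    have h2 : ‖y‖ * ν ((f (x + ρ • y) - f x) / (ρ * ‖y‖)) ≤ 1 := by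
      refine le_of_mul_le_mul_left ?_ hρ
      linarith
    have h3 : ‖y‖ ≤ 1 / ν₀ := by
      rw [le_div_iff₀ hν₀]
      exact (mul_le_mul_of_nonneg_left (hν.zero_le _) hq0.le).trans h2
    have hyM : ‖y‖ ≤ M := by linarith
    refine ⟨h3, hrad.2 hyM ?_⟩
    have h4 := (hT (ρ • y) (hρy.le.trans
      ((mul_le_mul_of_nonneg_left hyM hρ.le).trans hρr₁.le))).2.2
    set z := (f (x + ρ • y) - f x) / (ρ * ‖y‖) - a with hz
    have h5 : |z - 1 / 2 * (ρ * b * ‖y‖)| ≤ C₁ * (ρ * ‖y‖) ^ 2 := by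
      have h6 : z - 1 / 2 * (ρ * b * ‖y‖) = (f (x + ρ • y) - f x - l (ρ • y) -
          D (ρ • y) (ρ • y) / 2) / ‖ρ • y‖ := by
        rw [hz, ← hlρ, sub_div (_ - _ - l (ρ • y)), sub_div (_ - _) (l (ρ • y)), hρy]
        congr 1
        simp only [map_smul, smul_apply, smul_eq_mul, hb]
        field_simp
      rw [h6, abs_div, abs_norm, div_le_iff₀ hρy0]
      refine h4.trans (le_of_eq ?_)
      rw [hρy]; ring
    -- The chord slope from the center behaves like the directional derivative at the midpoint,
    -- hence the parameter `1 / 2`.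
    have h7 := (abs_le.1 (hexp hyM (1 / 2) z (by norm_num) (by norm_num) h5)).1
    have h8 : (f (x + ρ • y) - f x) / (ρ * ‖y‖) = a + z := by rw [hz]; ring
    rw [h8] at h2
    refine le_trans ?_ h2
    refine mul_le_mul_of_nonneg_left ?_ hq0.le
    linarith


/-! ### Areas of approximate amoebas -/

section ApproxRadius
variable {ν : ℝ → ℝ} {l : Plane →L[ℝ] ℝ} {D : Plane →L[ℝ] Plane →L[ℝ] ℝ} {h ρ C : ℝ}

theorem measurable_approxRadius (hc : Continuous ν) : Measurable (approxRadius ν l D h ρ) := by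
  have h1 : Measurable fun y : Plane => l y / ‖y‖ := by fun_prop
  have h2 : Measurable fun y : Plane => D y y := by
    have : Continuous fun y : Plane => D y y := by fun_prop
    exact this.measurable
  have h3 := (continuous_symmSlope hc h).measurable.comp h1
  have h4 := hc.measurable.comp h1
  exact (measurable_const.div h4).sub ((measurable_const.mul
    ((h3.mul (h2.div (measurable_norm.pow_const 2))).div_const 2)).div (h4.pow_const 3))

theorem measurable_radiusError (hc : Continuous ν) : Measurable (radiusError ν l C h ρ) := by
  have h1 : Measurable fun y : Plane => l y / ‖y‖ := by fun_prop
  exact (((continuous_secondDiff hc h).measurable.comp h1).add_const _).const_mul C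

theorem approxRadius_smul {r : ℝ} (hr : 0 < r) (y : Plane) :
    approxRadius ν l D h ρ (r • y) = approxRadius ν l D h ρ y := by
  have h1 : l (r • y) / ‖r • y‖ = l y / ‖y‖ := by
    rw [map_smul, norm_smul, smul_eq_mul, Real.norm_of_nonneg hr.le, mul_div_mul_left _ _ hr.ne']
  have h2 : D (r • y) (r • y) / ‖r • y‖ ^ 2 = D y y / ‖y‖ ^ 2 := by
    rw [norm_smul, Real.norm_of_nonneg hr.le, mul_pow, map_smul, map_smul, smul_apply,
      smul_eq_mul, smul_eq_mul, ← mul_assoc, ← pow_two, mul_div_mul_left _ _ (pow_pos hr 2).ne']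
  unfold approxRadius
  rw [h1, h2]

theorem radiusError_smul {r : ℝ} (hr : 0 < r) (y : Plane) :
    radiusError ν l C h ρ (r • y) = radiusError ν l C h ρ y := by
  have h1 : l (r • y) / ‖r • y‖ = l y / ‖y‖ := by
    rw [map_smul, norm_smul, smul_eq_mul, Real.norm_of_nonneg hr.le, mul_div_mul_left _ _ hr.ne']
  unfold radiusError
  rw [h1]

theorem approxRadius_unitVec (θ : ℝ) : approxRadius ν l D h ρ (unitVec θ) =
    1 / ν (l (unitVec θ)) - ρ * (symmSlope ν h (l (unitVec θ)) * D (unitVec θ) (unitVec θ) / 2) /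
      ν (l (unitVec θ)) ^ 3 := by
  simp [approxRadius, norm_unitVec]

theorem approxRadius_neg_unitVec (he : ∀ s, ν (-s) = ν s) (θ : ℝ) :
    approxRadius ν l D h ρ (-unitVec θ) =
    1 / ν (l (unitVec θ)) + ρ * (symmSlope ν h (l (unitVec θ)) * D (unitVec θ) (unitVec θ) / 2) /
      ν (l (unitVec θ)) ^ 3 := by
  simp [approxRadius, norm_unitVec, he, symmSlope_neg he]
  ring

theorem radiusError_unitVec (θ : ℝ) : radiusError ν l C h ρ (unitVec θ) =
    C * (secondDiff ν h (l (unitVec θ)) + ρ ^ 2) := by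
  simp [radiusError, norm_unitVec]

theorem radiusError_neg_unitVec (he : ∀ s, ν (-s) = ν s) (θ : ℝ) :
    radiusError ν l C h ρ (-unitVec θ) = C * (secondDiff ν h (l (unitVec θ)) + ρ ^ 2) := by
  simp [radiusError, norm_unitVec, secondDiff_neg he]

theorem abs_apply_div_norm_le (y : Plane) : |l y / ‖y‖| ≤ ‖l‖ := by
  rw [abs_div, abs_norm]
  exact div_le_of_le_mul₀ (norm_nonneg _) (norm_nonneg _) (l.le_opNorm y)

theorem abs_apply_apply_div_norm_le (y : Plane) : |D y y / ‖y‖ ^ 2| ≤ ‖D‖ := by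
  rw [abs_div, abs_of_nonneg (sq_nonneg ‖y‖)]
  refine div_le_of_le_mul₀ (sq_nonneg _) (norm_nonneg D) ((D.le_opNorm₂ y y).trans_eq ?_)
  ring

/-- On the boundary of the approximate amoeba the norm-like function `‖y‖ * ν (l y / ‖y‖)` equals
`1` up to `O(ρ)`. This crude form suffices for positivity and for the endpoints of the chord. -/
theorem abs_profile_mul_approxRadius_sub_one_le (hν : IsAmoebaProfile ν) {L : ℝ}
    (hL : ∀ s t, |ν s - ν t| ≤ L * |s - t|) (hh : 0 < h) (hρ : 0 ≤ ρ) (y : Plane) :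
    |ν (l y / ‖y‖) * approxRadius ν l D h ρ y - 1| ≤ L * ‖D‖ / 2 / ν 0 ^ 2 * ρ := by
  have h1 := abs_symmSlope_le hL hh (l y / ‖y‖)
  have h2 := abs_apply_apply_div_norm_le (D := D) y
  have h3 := hν.pos' (l y / ‖y‖)
  have h4 := hν.zero_le (l y / ‖y‖)
  have h5 := hν.pos
  have hL0 : 0 ≤ L := (abs_nonneg _).trans h1
  unfold approxRadius
  set a := l y / ‖y‖
  set b := D y y / ‖y‖ ^ 2
  have h6 : ν a * (1 / ν a - ρ * (symmSlope ν h a * b / 2) / ν a ^ 3) - 1 =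
      -(symmSlope ν h a * b / 2 / ν a ^ 2 * ρ) := by field_simp; ring
  rw [h6, abs_neg, abs_mul, abs_of_nonneg hρ, abs_div, abs_div, abs_mul, abs_two,
    abs_of_pos (pow_pos h3 2)]
  gcongr

theorem radiusError_nonneg (hν : IsAmoebaProfile ν) (hC : 0 ≤ C) (y : Plane) :
    0 ≤ radiusError ν l C h ρ y := by
  have := secondDiff_nonneg hν.convexOn h (l y / ‖y‖)
  unfold radiusError
  positivity

theorem radiusError_le {L : ℝ} (hL : ∀ s t, |ν s - ν t| ≤ L * |s - t|) (hC : 0 ≤ C)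
    (hh : 0 ≤ h) (y : Plane) : radiusError ν l C h ρ y ≤ C * (2 * L * h + ρ ^ 2) := by
  have := secondDiff_le hL hh (l y / ‖y‖)
  unfold radiusError
  gcongr

/-- Uniform bounds for the approximate radius and its error. -/
theorem exists_approxRadius_bounds (hν : IsAmoebaProfile ν) (l : Plane →L[ℝ] ℝ)
    (D : Plane →L[ℝ] Plane →L[ℝ] ℝ) {K C : ℝ} (hK : 0 < K) (hC : 0 ≤ C) :
    ∃ m ρ₀, 0 < m ∧ 0 < ρ₀ ∧ ∀ ρ, 0 < ρ → ρ < ρ₀ → ∀ y,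
      m ≤ approxRadius ν l D (K * ρ) ρ y - radiusError ν l C (K * ρ) ρ y ∧
      approxRadius ν l D (K * ρ) ρ y + radiusError ν l C (K * ρ) ρ y ≤ 1 / ν 0 + 1 := by
  obtain ⟨L, hL0, hL⟩ := hν.exists_lipschitz
  have hν0 := hν.pos
  have hN := hν.pos' ‖l‖
  set N := ν ‖l‖
  have hs : ∀ᶠ ρ : ℝ in 𝓝 0, L * ‖D‖ / 2 / ν 0 ^ 2 * ρ < 1 / 2 ∧
      C * (2 * L * (K * ρ) + ρ ^ 2) < 1 / (4 * N) ∧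
      (L * ‖D‖ / 2 / ν 0 ^ 2 * ρ) / ν 0 + C * (2 * L * (K * ρ) + ρ ^ 2) < 1 := by
    refine .and ?_ (.and ?_ ?_) <;>
      refine ContinuousAt.eventually_lt (by fun_prop) (by fun_prop) ?_ <;> simp
    exact hN
  obtain ⟨ρ₀, hρ₀, hs⟩ := Metric.eventually_nhds_iff.1 hs
  -- `N` is the largest value of the profile on directional slopes, so the radius is at least `1 /
  -- (2 * N)`, half of which is reserved for the error.
  refine ⟨1 / (4 * N), ρ₀, by positivity, hρ₀, fun ρ hρ hρlt y => ?_⟩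
  obtain ⟨s1, s2, s3⟩ := hs (y := ρ) (by simpa [abs_of_pos hρ] using hρlt)
  have h1 := abs_le.1 (abs_profile_mul_approxRadius_sub_one_le (l := l) (D := D) hν hL
    (mul_pos hK hρ) hρ.le y)
  have h2 := radiusError_le (l := l) (ρ := ρ) hL hC (mul_pos hK hρ).le y
  have ha := abs_apply_div_norm_le (l := l) y
  set a := l y / ‖y‖
  set Q := approxRadius ν l D (K * ρ) ρ y
  have hva := hν.pos' a
  have h3 : ν a ≤ N := hν.mono_abs (by rwa [abs_norm])
  constructor
  · have h4 : 1 / 2 ≤ ν a * Q := by linarith [h1.1]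
    have h5 : 0 < Q := pos_of_mul_pos_right (lt_of_lt_of_le (by norm_num) h4) hva.le
    have h6 : 1 / 2 ≤ N * Q := h4.trans (mul_le_mul_of_nonneg_right h3 h5.le)
    have h7 : 1 / (2 * N) ≤ Q := by
      rw [div_le_iff₀ (by positivity)]
      linarith
    have h8 : 1 / (2 * N) = 1 / (4 * N) + 1 / (4 * N) := by field_simp; norm_num
    linarith
  · set δ := L * ‖D‖ / 2 / ν 0 ^ 2 * ρ
    have hδ : 0 ≤ δ := by positivity
    have h4 : Q ≤ (1 + δ) / ν a := by
      rw [le_div_iff₀ hva]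
      linarith [h1.2]
    have h5 : (1 + δ) / ν a ≤ (1 + δ) / ν 0 :=
      div_le_div_of_nonneg_left (by positivity) hν0 (hν.zero_le a)
    have h6 : (1 + δ) / ν 0 = 1 / ν 0 + δ / ν 0 := add_div _ _ _
    linarith

end ApproxRadius

theorem starSet_subset_closedBall {Q : Plane → ℝ} {M : ℝ} (hQ : ∀ y, Q y ≤ M) :
    starSet Q ⊆ Metric.closedBall 0 M := fun y hy => by
  simpa using hy.2.trans (hQ y)

theorem volume_starSet_ne_top {Q : Plane → ℝ} {M : ℝ} (hQ : ∀ y, Q y ≤ M) :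
    volume (starSet Q) ≠ ⊤ :=
  measure_ne_top_of_subset (starSet_subset_closedBall hQ) measure_closedBall_lt_top.ne

theorem volumeReal_starSet_inter_pos {Q : Plane → ℝ} (hQm : Measurable Q)
    (hQh : ∀ (r : ℝ) y, 0 < r → Q (r • y) = Q y) (hQ0 : ∀ y, 0 ≤ Q y) {M : ℝ}
    (hQM : ∀ y, Q y ≤ M) (β : ℝ) :
    volume.real (starSet Q ∩ {y | 0 < inner ℝ (unitVec β) y}) =
      ∫ θ in (β - Real.pi / 2)..(β + Real.pi / 2), Q (unitVec θ) ^ 2 / 2 := by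
  rw [measureReal_def, volume_starSet_inter_halfPlane hQm hQh (fun _ => hQ0 _) (fun _ => hQM _),
    ENNReal.toReal_ofReal]
  exact intervalIntegral.integral_nonneg (by linarith [Real.pi_pos]) fun _ _ => by positivity

/-- The half plane is parametrized by antipodes of the directions used for the opposite one, so that
the two areas can be subtracted direction by direction. -/
theorem volumeReal_starSet_inter_neg {Q : Plane → ℝ} (hQm : Measurable Q)
    (hQh : ∀ (r : ℝ) y, 0 < r → Q (r • y) = Q y) (hQ0 : ∀ y, 0 ≤ Q y) {M : ℝ}
    (hQM : ∀ y, Q y ≤ M) (β : ℝ) :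
    volume.real (starSet Q ∩ {y | inner ℝ (unitVec β) y < 0}) =
      ∫ θ in (β - Real.pi / 2)..(β + Real.pi / 2), Q (-unitVec θ) ^ 2 / 2 := by
  have h := volumeReal_starSet_inter_pos hQm hQh hQ0 hQM (β + Real.pi)
  have h1 := intervalIntegral.integral_comp_add_right (a := β - Real.pi / 2)
    (b := β + Real.pi / 2) (fun θ => Q (unitVec θ) ^ 2 / 2) Real.pi
  simp only [unitVec_add_pi] at h1
  simp only [unitVec_add_pi, inner_neg_left, Left.neg_pos_iff] at h
  rw [h, h1]
  congr 1 <;> ring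

theorem volumeReal_eq_add_halfPlanes (β : ℝ) {A : Set Plane} (hA : volume A ≠ ⊤) :
    volume.real A = volume.real (A ∩ {y | 0 < inner ℝ (unitVec β) y}) +
      volume.real (A ∩ {y | inner ℝ (unitVec β) y < 0}) := by
  have hm : MeasurableSet {y : Plane | 0 < inner ℝ (unitVec β) y} :=
    measurableSet_lt measurable_const (by fun_prop)
  rw [← measureReal_inter_add_sdiff hm hA]
  congr 1
  refine measureReal_congr ?_
  have h0 : ∀ᵐ y : Plane, inner ℝ (unitVec β) y ≠ (0 : ℝ) := by
    rw [ae_iff]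
    simpa using volume_line_eq_zero β
  filter_upwards [h0] with y hy
  apply propext
  constructor
  · rintro ⟨h1, h2⟩
    exact ⟨h1, lt_of_le_of_ne (not_lt.1 h2) hy⟩
  · rintro ⟨h1, h2⟩
    exact ⟨h1, fun h3 => lt_asymm (show 0 < inner ℝ (unitVec β) y from h3)
      (show inner ℝ (unitVec β) y < 0 from h2)⟩

/-- The approximate amoeba is distributed unevenly to the two sides of the line through its
center. -/
theorem volumeReal_starSet_neg_sub_pos {ν : ℝ → ℝ} (hν : IsAmoebaProfile ν) {l : Plane →L[ℝ] ℝ}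
    {D : Plane →L[ℝ] Plane →L[ℝ] ℝ} {h ρ M : ℝ}
    (h0 : ∀ y, 0 ≤ approxRadius ν l D h ρ y) (hM : ∀ y, approxRadius ν l D h ρ y ≤ M) (β : ℝ) :
    volume.real (starSet (approxRadius ν l D h ρ) ∩ {y | inner ℝ (unitVec β) y < 0}) -
      volume.real (starSet (approxRadius ν l D h ρ) ∩ {y | 0 < inner ℝ (unitVec β) y}) =
    ρ * ∫ θ in (β - Real.pi / 2)..(β + Real.pi / 2), symmSlope ν h (l (unitVec θ)) /
      ν (l (unitVec θ)) ^ 4 * D (unitVec θ) (unitVec θ) := by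
  have hm := measurable_approxRadius (l := l) (D := D) (h := h) (ρ := ρ) hν.continuous
  have hh := fun (r : ℝ) (y : Plane) (hr : 0 < r) =>
    approxRadius_smul (ν := ν) (l := l) (D := D) (h := h) (ρ := ρ) hr y
  have hνc := hν.continuous
  have hsc := continuous_symmSlope hνc h
  have hec := continuous_unitVec
  have hne : ∀ θ, ν (l (unitVec θ)) ≠ 0 := fun θ => (hν.pos' _).ne'
  have hne3 : ∀ θ, ν (l (unitVec θ)) ^ 3 ≠ 0 := fun θ => pow_ne_zero 3 (hne θ)
  rw [volumeReal_starSet_inter_neg hm hh h0 hM, volumeReal_starSet_inter_pos hm hh h0 hM,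
    ← intervalIntegral.integral_sub, ← intervalIntegral.integral_const_mul]
  · refine intervalIntegral.integral_congr fun θ _ => ?_
    rw [approxRadius_unitVec, approxRadius_neg_unitVec hν.even]
    have := hν.pos' (l (unitVec θ))
    field_simp
    ring
  · simp only [approxRadius_neg_unitVec hν.even]
    refine Continuous.intervalIntegrable ?_ _ _
    fun_prop (disch := assumption)
  · simp only [approxRadius_unitVec]
    refine Continuous.intervalIntegrable ?_ _ _
    fun_prop (disch := assumption)

/-- In each direction the shell has area density `2 q e ≤ 2 M e`. Its thickness need not be
uniformly `o(ρ)`, as kinks may be present, but its integral is controlled by that of the second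
difference. -/
theorem volumeReal_starSet_sdiff_le {ν : ℝ → ℝ} (hν : IsAmoebaProfile ν) {l : Plane →L[ℝ] ℝ}
    {D : Plane →L[ℝ] Plane →L[ℝ] ℝ} {h ρ M C : ℝ} (hC : 0 ≤ C)
    (h0 : ∀ y, 0 ≤ approxRadius ν l D h ρ y - radiusError ν l C h ρ y)
    (hM : ∀ y, approxRadius ν l D h ρ y + radiusError ν l C h ρ y ≤ M) (β : ℝ) :
    volume.real (starSet (fun y => approxRadius ν l D h ρ y + radiusError ν l C h ρ y) \
      starSet (fun y => approxRadius ν l D h ρ y - radiusError ν l C h ρ y)) ≤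
    4 * M * C * ((∫ θ in (β - Real.pi / 2)..(β + Real.pi / 2), secondDiff ν h (l (unitVec θ))) +
      Real.pi * ρ ^ 2) := by
  have hm := measurable_approxRadius (l := l) (D := D) (h := h) (ρ := ρ) hν.continuous
  have hm' := measurable_radiusError (l := l) (C := C) (h := h) (ρ := ρ) hν.continuous
  have hh := fun (r : ℝ) (y : Plane) (hr : 0 < r) =>
    approxRadius_smul (ν := ν) (l := l) (D := D) (h := h) (ρ := ρ) hr y
  have hh' := fun (r : ℝ) (y : Plane) (hr : 0 < r) =>
    radiusError_smul (ν := ν) (l := l) (C := C) (h := h) (ρ := ρ) hr y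
  have hνc := hν.continuous
  have hsc := continuous_symmSlope hνc h
  have hdc := continuous_secondDiff hνc h
  have hec := continuous_unitVec
  have hne : ∀ θ, ν (l (unitVec θ)) ≠ 0 := fun θ => (hν.pos' _).ne'
  have hne3 : ∀ θ, ν (l (unitVec θ)) ^ 3 ≠ 0 := fun θ => pow_ne_zero 3 (hne θ)
  have hε := fun y => radiusError_nonneg (l := l) (h := h) (ρ := ρ) hν hC y
  have hpi := Real.pi_pos
  set Q := approxRadius ν l D h ρ with hQ
  set ε := radiusError ν l C h ρ with hεdef
  have hM0 : ∀ y, Q y ≤ M := fun y => by linarith [hM y, hε y]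
  have hMm : ∀ y, Q y - ε y ≤ M := fun y => by linarith [hM y, hε y]
  have h0p : ∀ y, 0 ≤ Q y + ε y := fun y => by linarith [h0 y, hε y]
  have hsub : starSet (fun y => Q y - ε y) ⊆ starSet (fun y => Q y + ε y) := fun y hy =>
    ⟨hy.1, hy.2.trans (by linarith [hε y])⟩
  have hcont : ∀ s : ℝ, (Continuous fun θ => (Q (unitVec θ) + s * ε (unitVec θ)) ^ 2 / 2) ∧
      Continuous fun θ => (Q (-unitVec θ) + s * ε (-unitVec θ)) ^ 2 / 2 := by
    intro s
    simp only [hQ, hεdef, approxRadius_unitVec, approxRadius_neg_unitVec hν.even,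
      radiusError_unitVec, radiusError_neg_unitVec hν.even]
    constructor <;> fun_prop (disch := assumption)
  have hmp : Measurable fun y => Q y + ε y := hm.add hm'
  have hmn : Measurable fun y => Q y - ε y := hm.sub hm'
  have hp := hcont 1
  have hn := hcont (-1)
  simp only [one_mul, neg_mul, ← sub_eq_add_neg] at hp hn
  rw [measureReal_sdiff hsub (measurableSet_starSet hmn) (volume_starSet_ne_top hM),
    volumeReal_eq_add_halfPlanes β (volume_starSet_ne_top hM),
    volumeReal_eq_add_halfPlanes β (volume_starSet_ne_top hMm),
    volumeReal_starSet_inter_neg hmp (fun r y hr => by rw [hh r y hr, hh' r y hr]) h0p hM,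
    volumeReal_starSet_inter_pos hmp (fun r y hr => by rw [hh r y hr, hh' r y hr]) h0p hM,
    volumeReal_starSet_inter_neg hmn (fun r y hr => by rw [hh r y hr, hh' r y hr]) h0 hMm,
    volumeReal_starSet_inter_pos hmn (fun r y hr => by rw [hh r y hr, hh' r y hr]) h0 hMm,
    add_sub_add_comm, ← intervalIntegral.integral_sub (hp.1.intervalIntegrable _ _)
      (hn.1.intervalIntegrable _ _), ← intervalIntegral.integral_sub
      (hp.2.intervalIntegrable _ _) (hn.2.intervalIntegrable _ _)]
  have hbd : ∀ (q e : ℝ), q ≤ M → 0 ≤ e → (q + e) ^ 2 / 2 - (q - e) ^ 2 / 2 ≤ 2 * M * e := by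
    intro q e hq he
    have := mul_le_mul_of_nonneg_right hq he
    linarith [show (q + e) ^ 2 / 2 - (q - e) ^ 2 / 2 = 2 * (q * e) by ring]
  have hI : Continuous fun θ => secondDiff ν h (l (unitVec θ)) := by fun_prop
  have hint : ∫ θ in (β - Real.pi / 2)..(β + Real.pi / 2),
      2 * M * (C * (secondDiff ν h (l (unitVec θ)) + ρ ^ 2)) = 2 * M * C *
      ((∫ θ in (β - Real.pi / 2)..(β + Real.pi / 2), secondDiff ν h (l (unitVec θ))) +
      Real.pi * ρ ^ 2) := by
    rw [intervalIntegral.integral_const_mul, intervalIntegral.integral_const_mul,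
      intervalIntegral.integral_add (hI.intervalIntegrable _ _) intervalIntegrable_const,
      intervalIntegral.integral_const, smul_eq_mul]
    ring
  have hc2 : Continuous fun θ => 2 * M * (C * (secondDiff ν h (l (unitVec θ)) + ρ ^ 2)) := by
    fun_prop
  have e1 : ∫ θ in (β - Real.pi / 2)..(β + Real.pi / 2), ((Q (unitVec θ) + ε (unitVec θ)) ^ 2 / 2 -
      (Q (unitVec θ) - ε (unitVec θ)) ^ 2 / 2) ≤ _ :=
    (intervalIntegral.integral_mono_on (by linarith) ((hp.1.sub hn.1).intervalIntegrable _ _)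
      (hc2.intervalIntegrable _ _) fun θ _ => by
        rw [← radiusError_unitVec]
        exact hbd _ _ (hM0 _) (hε _)).trans_eq hint
  have e2 : ∫ θ in (β - Real.pi / 2)..(β + Real.pi / 2), ((Q (-unitVec θ) + ε (-unitVec θ)) ^ 2 / 2 -
      (Q (-unitVec θ) - ε (-unitVec θ)) ^ 2 / 2) ≤ _ :=
    (intervalIntegral.integral_mono_on (by linarith) ((hp.2.sub hn.2).intervalIntegrable _ _)
      (hc2.intervalIntegrable _ _) fun θ _ => by
        rw [← radiusError_neg_unitVec hν.even]
        exact hbd _ _ (hM0 _) (hε _)).trans_eq hint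
  linarith


/-! ### Level sets inside approximate amoebas -/

/-- The function `y ↦ p (l y, ‖y‖)` is Lipschitz, and moving `y` onto the axis `unitNormal β` costs
its `unitVec β` coordinate. It locates the ends of the chord that the level line cuts out of the
amoeba. -/
theorem exists_abs_norm_mul_profile_sub_le {ν : ℝ → ℝ} (hν : IsAmoebaProfile ν)
    (l : Plane →L[ℝ] ℝ) (β : ℝ) : ∃ N, 0 ≤ N ∧ ∀ y : Plane,
      |‖y‖ * ν (l y / ‖y‖) - |inner ℝ (unitNormal β) y| * ν (l (unitNormal β))| ≤
        N * |inner ℝ (unitVec β) y| := by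
  obtain ⟨p, -, hp, -, -⟩ := hν.exists_seminorm
  refine ⟨‖l‖ * p (1, 0) + p (0, 1), by positivity, fun y => ?_⟩
  have hF : ∀ y : Plane, ‖y‖ * ν (l y / ‖y‖) = p (l y, ‖y‖) := by
    intro y
    rcases eq_or_ne y 0 with rfl | hy
    · rw [map_zero, norm_zero, zero_mul]
      exact (map_zero p).symm
    · rw [hp _ _ (norm_pos_iff.2 hy)]
  set w : ℝ := inner ℝ (unitVec β) y
  set t : ℝ := inner ℝ (unitNormal β) y
  have hy : y = w • unitVec β + t • unitNormal β := eq_frame β y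
  have ht : |t| * ν (l (unitNormal β)) = p (l (t • unitNormal β), ‖t • unitNormal β‖) := by
    rw [← hF, norm_smul, norm_unitNormal, mul_one, map_smul, smul_eq_mul, Real.norm_eq_abs]
    rcases eq_or_ne t 0 with h | h
    · simp [h]
    · congr 1
      rw [← hν.apply_abs (t * _ / _), abs_div, abs_mul, abs_abs,
        mul_div_cancel_left₀ _ (abs_pos.2 h).ne', hν.apply_abs]
  rw [hF, ht]
  refine (abs_sub_map_le_sub p _ _).trans ?_
  have hsub : y - t • unitNormal β = w • unitVec β := by rw [hy]; simp
  have h1 : |l y - l (t • unitNormal β)| ≤ ‖l‖ * |w| := by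
    rw [← map_sub, hsub]
    refine (l.le_opNorm _).trans_eq ?_
    rw [norm_smul, norm_unitVec, mul_one, Real.norm_eq_abs]
  have h2 : |‖y‖ - ‖t • unitNormal β‖| ≤ |w| := by
    refine (abs_norm_sub_norm_le _ _).trans_eq ?_
    rw [hsub, norm_smul, norm_unitVec, mul_one, Real.norm_eq_abs]
  have h3 : ((l y, ‖y‖) - (l (t • unitNormal β), ‖t • unitNormal β‖) : ℝ × ℝ) =
      (l y - l (t • unitNormal β)) • (1, 0) + (‖y‖ - ‖t • unitNormal β‖) • (0, 1) := by
    ext <;> simp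
  rw [h3]
  refine (map_add_le_add p _ _).trans ?_
  rw [map_smul_eq_mul p, map_smul_eq_mul p, Real.norm_eq_abs, Real.norm_eq_abs]
  have hp1 := apply_nonneg p (1, 0)
  have hp2 := apply_nonneg p (0, 1)
  calc _ ≤ ‖l‖ * |w| * p (1, 0) + |w| * p (0, 1) := by gcongr
    _ = _ := by ring

theorem integral_quadratic (T k U G : ℝ) :
    ∫ t in (-T)..T, (k - U / 2 * t ^ 2) / G = (2 * T * k - U * T ^ 3 / 3) / G := by
  rw [intervalIntegral.integral_div, intervalIntegral.integral_sub intervalIntegrable_const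
    (Continuous.intervalIntegrable (by fun_prop) _ _), intervalIntegral.integral_const,
    intervalIntegral.integral_const_mul, integral_pow, smul_eq_mul]
  congr 1
  ring

/-- The part of a ball, blown up about `x` by the factor `1 / ρ`, on which `u` is less than
`u x + ρ² k`. -/
def scaledSublevel (u : Plane → ℝ) (x : Plane) (M ρ k : ℝ) : Set Plane :=
  {y | ‖y‖ ≤ M ∧ u (x + ρ • y) < u x + ρ ^ 2 * k}

set_option maxHeartbeats 1000000 in
-- The blown-up level line stays in a strip of width `O(ρ)` about the line orthogonal to the
-- gradient of `u`. There it is within `O(ρ²)` of the parabola `γ`, and the chord ends are within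
-- `O(ρ)` of `±T`, which costs only `O(ρ²)` of area in so thin a strip.
theorem exists_abs_volume_sublevel_sub_le {ν : ℝ → ℝ} (hν : IsAmoebaProfile ν)
    (l : Plane →L[ℝ] ℝ) (D : Plane →L[ℝ] Plane →L[ℝ] ℝ) {K : ℝ} (hK : 0 < K)
    {u : Plane → ℝ} {x : Plane} (hu : ContDiffAt ℝ 3 u x) {β G : ℝ} (hG : 0 < G)
    (hgrad : ∀ y, fderiv ℝ u x y = G * inner ℝ (unitVec β) y) (K₀ : ℝ) :
    ∃ C ρ₀, 0 < C ∧ 0 < ρ₀ ∧ ∀ ρ, 0 < ρ → ρ < ρ₀ → ∀ k, |k| ≤ K₀ →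
      |volume.real (starSet (approxRadius ν l D (K * ρ) ρ) ∩ scaledSublevel u x (1 / ν 0 + 1) ρ k) -
        volume.real (starSet (approxRadius ν l D (K * ρ) ρ) ∩ {y | inner ℝ (unitVec β) y < 0}) -
        ρ * ((2 * (1 / ν (l (unitNormal β))) * k - secondDeriv u x (unitNormal β) (unitNormal β) *
          (1 / ν (l (unitNormal β))) ^ 3 / 3) / G)| ≤ C * ρ ^ 2 := by
  obtain ⟨L, hL0, hL⟩ := hν.exists_lipschitz
  obtain ⟨r, C₁, hr, hC₁, hT⟩ := hu.exists_taylor_two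
  obtain ⟨N₃, hN₃, hF⟩ := exists_abs_norm_mul_profile_sub_le hν l β
  -- Taken with error constant `0`, so that it bounds the approximate radius alone.
  obtain ⟨m, ρ₁, hm, hρ₁, hQ⟩ := exists_approxRadius_bounds hν l D hK le_rfl
  have hν0 := hν.pos
  set M := 1 / ν 0 + 1 with hMdef
  have hM0 : 0 < M := by positivity
  set D₂ := fderiv ℝ (fderiv ℝ u) x with hD₂
  set vξ := ν (l (unitNormal β)) with hvξ
  have hvξ0 : 0 < vξ := hν.pos' _
  set T := 1 / vξ with hTdef
  have hT0 : 0 < T := by positivity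
  have hTM : T + 1 ≤ M := by
    have : T ≤ 1 / ν 0 := one_div_le_one_div_of_le hν0 (hν.zero_le _)
    linarith
  set U := secondDeriv u x (unitNormal β) (unitNormal β) with hU
  set K₁ := max K₀ 0 with hK₁
  have hK₁0 : 0 ≤ K₁ := le_max_right _ _
  -- `ρ ^ 2 * N` bounds all terms of `u` beyond the linear one. The summand `2` in `C₄` makes the
  -- linear term dominate strictly outside the strip and leaves room for `σ` around the graph of `γ`
  -- inside it.
  set N := K₁ + ‖D₂‖ * M ^ 2 + C₁ * M ^ 3 with hN
  have hN0 : 0 ≤ N := by positivity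
  set C₄ := (N + 2) / G with hC₄
  have hC₄0 : 0 < C₄ := by positivity
  have hC₄G : C₄ * G = N + 2 := div_mul_cancel₀ _ hG.ne'
  set N₂ := ‖D₂‖ * C₄ * M + C₁ * M ^ 3 with hN₂
  have hN₂0 : 0 ≤ N₂ := by positivity
  set c₀ := L * ‖D‖ / 2 / ν 0 ^ 2 with hc₀
  have hc₀0 : 0 ≤ c₀ := by positivity
  set N₄ := c₀ + N₃ * C₄ with hN₄
  have hN₄0 : 0 ≤ N₄ := by positivity
  have hsmall : ∀ᶠ ρ : ℝ in 𝓝 0, ρ < 1 ∧ ρ * M < r ∧ ρ * (N₂ + 1) < 1 ∧ C₄ * ρ < 1 := by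
    refine .and ?_ (.and ?_ (.and ?_ ?_)) <;>
      refine ContinuousAt.eventually_lt (by fun_prop) (by fun_prop) ?_ <;> simp
    exact hr
  obtain ⟨ρ₂, hρ₂, hs⟩ := Metric.eventually_nhds_iff.1 hsmall
  refine ⟨2 * T * ((N₂ + 1) / G) + 16 * C₄ * (T * N₄) + 1, min ρ₁ ρ₂, by positivity,
    lt_min hρ₁ hρ₂, fun ρ hρ hρlt k hk => ?_⟩
  obtain ⟨hρ1, hρr, hρN, hρC⟩ := hs (y := ρ)
    (by simpa [abs_of_pos hρ] using hρlt.trans_le (min_le_right _ _))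
  have hQM : ∀ y, approxRadius ν l D (K * ρ) ρ y ≤ M := fun y => by
    have := (hQ ρ hρ (hρlt.trans_le (min_le_left _ _)) y).2
    simpa [radiusError] using this
  set Q := approxRadius ν l D (K * ρ) ρ with hQdef
  set P := scaledSublevel u x M ρ k with hP
  set γ : ℝ → ℝ := fun t => ρ * ((k - U / 2 * t ^ 2) / G) with hγ
  have hk' : |k| ≤ K₁ := hk.trans (le_max_left _ _)
  have hUD : |U| ≤ ‖D₂‖ := by
    have := D₂.le_opNorm₂ (unitNormal β) (unitNormal β)
    rw [norm_unitNormal, mul_one, mul_one] at this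
    exact this
  -- expansion of `u`
  have hexp : ∀ y : Plane, ‖y‖ ≤ M → |u (x + ρ • y) - u x - ρ * (G * inner ℝ (unitVec β) y) -
      ρ ^ 2 * (D₂ y y) / 2| ≤ ρ ^ 3 * (C₁ * M ^ 3) := by
    intro y hy
    have hρy : ‖ρ • y‖ ≤ ρ * M := by
      rw [norm_smul, Real.norm_of_nonneg hρ.le]
      gcongr
    have h1 := (hT (ρ • y) (hρy.trans hρr.le)).2.2
    have h2 : fderiv ℝ u x (ρ • y) = ρ * (G * inner ℝ (unitVec β) y) := by
      rw [map_smul, hgrad, smul_eq_mul]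
    have h3 : D₂ (ρ • y) (ρ • y) = ρ ^ 2 * D₂ y y := by
      rw [map_smul, map_smul, smul_apply, smul_eq_mul, smul_eq_mul]
      ring
    rw [h2, h3] at h1
    refine h1.trans ?_
    calc C₁ * ‖ρ • y‖ ^ 3 ≤ C₁ * (ρ * M) ^ 3 := by gcongr
      _ = _ := by ring
  have hD₂M : ∀ y : Plane, ‖y‖ ≤ M → |D₂ y y| ≤ ‖D₂‖ * M ^ 2 := by
    intro y hy
    refine (D₂.le_opNorm₂ y y).trans ?_
    rw [pow_two, ← mul_assoc]
    gcongr
  have hρ3 : ρ ^ 3 ≤ ρ ^ 2 := pow_le_pow_of_le_one hρ.le hρ1.le (by norm_num)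
  have hfar' : ∀ y : Plane, ‖y‖ ≤ M →
      |u (x + ρ • y) - u x - ρ ^ 2 * k - ρ * (G * inner ℝ (unitVec β) y)| ≤ ρ ^ 2 * N := by
    intro y hy
    have h1 := hexp y hy
    have h2 : |ρ ^ 2 * (D₂ y y) / 2| ≤ ρ ^ 2 * (‖D₂‖ * M ^ 2) := by
      rw [abs_div, abs_mul, abs_two, abs_of_pos (pow_pos hρ 2)]
      have := mul_le_mul_of_nonneg_left (hD₂M y hy) (sq_nonneg ρ)
      have h0 : 0 ≤ ρ ^ 2 * |D₂ y y| := by positivity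
      linarith
    have h3 : |ρ ^ 2 * k| ≤ ρ ^ 2 * K₁ := by
      rw [abs_mul, abs_of_pos (pow_pos hρ 2)]
      gcongr
    have h4 : ρ ^ 3 * (C₁ * M ^ 3) ≤ ρ ^ 2 * (C₁ * M ^ 3) := by gcongr
    rw [hN]
    rw [abs_le] at h1 h2 h3 ⊢
    constructor <;> linarith [h1.1, h1.2, h2.1, h2.2, h3.1, h3.2]
  have hnear : ∀ y : Plane, ‖y‖ ≤ M → |inner ℝ (unitVec β) y| < C₄ * ρ →
      |u (x + ρ • y) - u x - ρ ^ 2 * k -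
        ρ * G * (inner ℝ (unitVec β) y - γ (inner ℝ (unitNormal β) y))| ≤ ρ ^ 3 * N₂ := by
    intro y hy hw
    have h1 := hexp y hy
    set w : ℝ := inner ℝ (unitVec β) y with hwdef
    set t : ℝ := inner ℝ (unitNormal β) y with htdef
    have hyf : y = w • unitVec β + t • unitNormal β := eq_frame β y
    have ht : |t| ≤ M := by
      have := abs_real_inner_le_norm (unitNormal β) y
      rw [norm_unitNormal, one_mul] at this
      exact this.trans hy
    have h2 : D₂ y y - t ^ 2 * U = w * D₂ (unitVec β) y + t * w * D₂ (unitNormal β) (unitVec β) := by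
      have e1 : D₂ y y = w * D₂ (unitVec β) y + t * D₂ (unitNormal β) y := by
        have := congrArg (fun z => D₂ z y) hyf
        simp only [map_add, add_apply, map_smul, smul_apply, smul_eq_mul] at this
        exact this
      have e2 : D₂ (unitNormal β) y = w * D₂ (unitNormal β) (unitVec β) + t * U := by
        have := congrArg (fun z => D₂ (unitNormal β) z) hyf
        simp only [map_add, map_smul, smul_eq_mul] at this
        exact this
      rw [e1, e2]
      ring
    have h3 : |D₂ y y - t ^ 2 * U| ≤ 2 * (‖D₂‖ * C₄ * M * ρ) := by
      have e1 : |D₂ (unitVec β) y| ≤ ‖D₂‖ * M := by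
        have := D₂.le_opNorm₂ (unitVec β) y
        rw [norm_unitVec, mul_one] at this
        exact this.trans (by gcongr)
      have e2 : |D₂ (unitNormal β) (unitVec β)| ≤ ‖D₂‖ := by
        have := D₂.le_opNorm₂ (unitNormal β) (unitVec β)
        rwa [norm_unitVec, norm_unitNormal, mul_one, mul_one] at this
      rw [h2]
      refine (abs_add_le _ _).trans ?_
      rw [abs_mul, abs_mul, abs_mul]
      calc _ ≤ C₄ * ρ * (‖D₂‖ * M) + M * (C₄ * ρ) * ‖D₂‖ := by gcongr
        _ = _ := by ring
    have h4 : |ρ ^ 2 * (D₂ y y - t ^ 2 * U) / 2| ≤ ρ ^ 3 * (‖D₂‖ * C₄ * M) := by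
      rw [abs_div, abs_mul, abs_two, abs_of_pos (pow_pos hρ 2)]
      have := mul_le_mul_of_nonneg_left h3 (sq_nonneg ρ)
      linarith [show ρ ^ 2 * (2 * (‖D₂‖ * C₄ * M * ρ)) = 2 * (ρ ^ 3 * (‖D₂‖ * C₄ * M)) by ring]
    have h5 : ρ * G * (w - γ t) = ρ * (G * w) - ρ ^ 2 * k + ρ ^ 2 * (t ^ 2 * U) / 2 := by
      simp only [hγ]
      field_simp
      ring
    rw [h5, hN₂]
    rw [abs_le] at h1 h4 ⊢
    constructor <;> linarith [h1.1, h1.2, h4.1, h4.2]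
  have hkey := abs_volume_inter_sub_halfPlane_le β (A := starSet Q) (P := P) (γ := γ) (T := T)
    (Λ := C₄ * ρ) (σ := (N₂ + 1) / G * ρ ^ 2) (τ := T * N₄ * ρ) (volume_starSet_ne_top hQM) hT0.le
    (by positivity) (by positivity) (by positivity) (by simp only [hγ]; fun_prop) ?_ ?_ ?_ ?_ ?_
  · have hint : ∫ t in (-T)..T, γ t = ρ * ((2 * T * k - U * T ^ 3 / 3) / G) := by
      simp only [hγ]
      rw [intervalIntegral.integral_const_mul, integral_quadratic]
    rw [hint] at hkey
    refine hkey.trans ?_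
    have : 0 ≤ ρ ^ 2 := sq_nonneg ρ
    linarith [show 2 * T * ((N₂ + 1) / G * ρ ^ 2) + 16 * (C₄ * ρ) * (T * N₄ * ρ) =
      (2 * T * ((N₂ + 1) / G) + 16 * C₄ * (T * N₄)) * ρ ^ 2 by ring]
  · intro y hy hw
    have hyM : ‖y‖ ≤ M := hy.2.trans (hQM y)
    have h1 := abs_le.1 (hfar' y hyM)
    set w : ℝ := inner ℝ (unitVec β) y
    constructor
    · rintro ⟨-, h2⟩
      by_contra h3
      rw [not_lt] at h3
      rw [abs_of_nonneg h3] at hw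
      have h4 : ρ ^ 2 * (N + 2) ≤ ρ * (G * w) := by
        have := mul_le_mul_of_nonneg_left hw (mul_pos hρ hG).le
        linarith [show ρ * G * (C₄ * ρ) = ρ ^ 2 * (C₄ * G) by ring,
          show ρ ^ 2 * (C₄ * G) = ρ ^ 2 * (N + 2) by rw [hC₄G]]
      have h5 := pow_pos hρ 2
      linarith [h1.1]
    · intro h3
      refine ⟨hyM, ?_⟩
      rw [abs_of_neg h3] at hw
      have h4 : ρ * (G * w) ≤ -(ρ ^ 2 * (N + 2)) := by
        have := mul_le_mul_of_nonneg_left hw (mul_pos hρ hG).le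
        linarith [show ρ * G * (C₄ * ρ) = ρ ^ 2 * (C₄ * G) by ring,
          show ρ ^ 2 * (C₄ * G) = ρ ^ 2 * (N + 2) by rw [hC₄G]]
      have h5 := pow_pos hρ 2
      linarith [h1.2]
  · intro y hy hw
    have h1 := (abs_le.1 (abs_profile_mul_approxRadius_sub_one_le (l := l) (D := D) hν hL
      (mul_pos hK hρ) hρ.le y)).2
    have h2 := (abs_le.1 (hF y)).1
    have h3 : ‖y‖ * ν (l y / ‖y‖) ≤ ν (l y / ‖y‖) * Q y := by
      rw [mul_comm]
      exact mul_le_mul_of_nonneg_left hy.2 (hν.nonneg _)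
    have h4 : N₃ * |inner ℝ (unitVec β) y| ≤ N₃ * (C₄ * ρ) := by gcongr
    have h5 : |inner ℝ (unitNormal β) y| * vξ ≤ 1 + N₄ * ρ := by
      rw [hN₄]
      linarith
    have h6 : |inner ℝ (unitNormal β) y| = |inner ℝ (unitNormal β) y| * vξ * T := by
      rw [hTdef]; field_simp
    rw [h6]
    calc _ ≤ (1 + N₄ * ρ) * T := by gcongr
      _ = _ := by ring
  · intro y hy0 hw ht
    refine ⟨norm_pos_iff.2 hy0, ?_⟩
    have h1 := (abs_le.1 (abs_profile_mul_approxRadius_sub_one_le (l := l) (D := D) hν hL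
      (mul_pos hK hρ) hρ.le y)).1
    have h2 := (abs_le.1 (hF y)).2
    have h4 : N₃ * |inner ℝ (unitVec β) y| ≤ N₃ * (C₄ * ρ) := by gcongr
    have h5 : |inner ℝ (unitNormal β) y| * vξ ≤ 1 - N₄ * ρ := by
      calc _ ≤ (T - T * N₄ * ρ) * vξ := by gcongr
        _ = _ := by rw [hTdef]; field_simp
    refine le_of_mul_le_mul_left ?_ (hν.pos' (l y / ‖y‖))
    rw [hN₄] at h5
    linarith
  · intro y hw ht
    -- Here the `1` in `M = 1 / ν 0 + 1` is used: it leaves room for the strip of half-width `C₄ * ρ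
    -- < 1` around the chord.
    have hyM : ‖y‖ ≤ M := by
      have h1 : ‖y‖ ≤ |inner ℝ (unitVec β) y| + |inner ℝ (unitNormal β) y| := by
        conv_lhs => rw [eq_frame β y]
        refine (norm_add_le _ _).trans_eq ?_
        rw [norm_smul, norm_smul, norm_unitVec, norm_unitNormal, mul_one, mul_one,
          Real.norm_eq_abs, Real.norm_eq_abs]
      linarith
    have h1 := abs_le.1 (hnear y hyM hw)
    set w : ℝ := inner ℝ (unitVec β) y
    set t : ℝ := inner ℝ (unitNormal β) y
    have hσ : ρ * G * ((N₂ + 1) / G * ρ ^ 2) = ρ ^ 3 * N₂ + ρ ^ 3 := by field_simp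
    have hρ30 := pow_pos hρ 3
    constructor
    · intro h2
      refine ⟨hyM, ?_⟩
      have h3 : ρ * G * (w - γ t) ≤ -(ρ * G * ((N₂ + 1) / G * ρ ^ 2)) := by
        rw [← mul_neg]
        exact mul_le_mul_of_nonneg_left (by linarith) (mul_pos hρ hG).le
      linarith [h1.2]
    · rintro ⟨-, h2⟩
      by_contra h3
      rw [not_lt] at h3
      have h4 : ρ * G * ((N₂ + 1) / G * ρ ^ 2) ≤ ρ * G * (w - γ t) :=
        mul_le_mul_of_nonneg_left (by linarith) (mul_pos hρ hG).le
      linarith [h1.1]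
  · intro t ht
    have htM : |t| ≤ M := by linarith
    have h1 : |γ t| ≤ ρ * ((K₁ + ‖D₂‖ * M ^ 2) / G) := by
      simp only [hγ]
      rw [abs_mul, abs_of_pos hρ, abs_div, abs_of_pos hG]
      have h2 : |k - U / 2 * t ^ 2| ≤ K₁ + ‖D₂‖ * M ^ 2 := by
        refine (abs_sub _ _).trans (add_le_add hk' ?_)
        rw [abs_mul, abs_div, abs_two, abs_pow]
        have h3 : |U| / 2 ≤ ‖D₂‖ := by linarith [abs_nonneg U]
        gcongr
      gcongr
    have h2 : (N₂ + 1) / G * ρ ^ 2 ≤ ρ * (1 / G) := by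
      calc _ = ρ * (ρ * (N₂ + 1) / G) := by ring
        _ ≤ _ := by gcongr
    have h3 : C₄ * ρ = ρ * ((K₁ + ‖D₂‖ * M ^ 2) / G) + ρ * (1 / G) + ρ * ((C₁ * M ^ 3 + 1) / G) := by
      rw [hC₄, hN]; ring
    have h4 : 0 ≤ ρ * ((C₁ * M ^ 3 + 1) / G) := by positivity
    linarith


/-! ### Medians -/

/-- The median is the supremum of the levels with at most half of the mass strictly below. Each of
the two bounds follows by continuity of `μ` along an increasing union of half lines. -/
theorem MeasureTheory.Measure.exists_median (μ : Measure ℝ) [IsFiniteMeasure μ] (h0 : μ univ ≠ 0)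
    {a b : ℝ} (ha : μ (Iio a) = 0) (hb : μ (Ici b) = 0) :
    ∃ m, 2 * μ (Iio m) ≤ μ univ ∧ 2 * μ (Ioi m) ≤ μ univ := by
  set S : Set ℝ := {k | 2 * μ (Iio k) ≤ μ univ} with hS
  have hcompl : ∀ k, μ (Iio k) + μ (Ici k) = μ univ := fun k => by
    rw [← compl_Iio]
    exact measure_add_measure_compl measurableSet_Iio
  have haS : a ∈ S := by simp [hS, ha]
  have hbdd : BddAbove S := by
    refine ⟨b, fun k hk => ?_⟩
    have hk : 2 * μ (Iio k) ≤ μ univ := hk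
    by_contra hlt
    rw [not_le] at hlt
    have h1 : μ (Iio k) = μ univ := by
      have h2 : μ (Ici k) = 0 := measure_mono_null (Ici_subset_Ici.2 hlt.le) hb
      rw [← hcompl k, h2, add_zero]
    rw [h1, two_mul] at hk
    exact absurd hk (not_le.2 (ENNReal.lt_add_right (measure_ne_top _ _) h0))
  obtain ⟨v, hv, hvlt, hvt⟩ := exists_seq_strictAnti_tendsto (0 : ℝ)
  refine ⟨sSup S, ?_, ?_⟩
  · have h1 : Iio (sSup S) = ⋃ n, Iio (sSup S - v n) := by
      ext x
      simp only [mem_Iio, mem_iUnion]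
      constructor
      · intro hx
        obtain ⟨n, hn⟩ := (hvt.eventually_lt_const (show 0 < sSup S - x by linarith)).exists
        exact ⟨n, by linarith⟩
      · rintro ⟨n, hn⟩
        linarith [hvlt n]
    have hmono : Monotone fun n => Iio (sSup S - v n) := fun i j hij =>
      Iio_subset_Iio (by linarith [hv.antitone hij])
    rw [h1, hmono.measure_iUnion, ENNReal.mul_iSup]
    refine iSup_le fun n => ?_
    obtain ⟨k, hk, hlt⟩ := exists_lt_of_lt_csSup ⟨a, haS⟩ (show sSup S - v n < sSup S by
      linarith [hvlt n])
    exact (mul_le_mul_right (measure_mono (Iio_subset_Iio hlt.le)) 2).trans hk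
  · have h1 : Ioi (sSup S) = ⋃ n, Ici (sSup S + v n) := by
      ext x
      simp only [mem_Ioi, mem_Ici, mem_iUnion]
      constructor
      · intro hx
        obtain ⟨n, hn⟩ := (hvt.eventually_lt_const (show 0 < x - sSup S by linarith)).exists
        exact ⟨n, by linarith⟩
      · rintro ⟨n, hn⟩
        linarith [hvlt n]
    have hmono : Monotone fun n => Ici (sSup S + v n) := fun i j hij =>
      Ici_subset_Ici.2 (by linarith [hv.antitone hij])
    rw [h1, hmono.measure_iUnion, ENNReal.mul_iSup]
    refine iSup_le fun n => ?_
    have h2 : sSup S + v n ∉ S := fun h => by linarith [le_csSup hbdd h, hvlt n]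
    have h3 : μ univ < 2 * μ (Iio (sSup S + v n)) := not_le.1 h2
    rw [← hcompl (sSup S + v n), two_mul] at h3
    have h4 : μ (Ici (sSup S + v n)) < μ (Iio (sSup S + v n)) :=
      lt_of_add_lt_add_left h3
    rw [← hcompl (sSup S + v n), two_mul]
    exact add_le_add_left h4.le _

/-- The distribution of `u` on `A`. -/
theorem exists_distribution {u : Plane → ℝ} {A U : Set Plane} (hU : IsOpen U)
    (hu : ContinuousOn u U) (hAU : A ⊆ U) : ∃ μ : Measure ℝ, ∀ s, MeasurableSet s →
      μ s = volume {y ∈ A | u y ∈ s} := by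
  classical
  -- Extending `u` by zero makes it globally measurable; `A` itself need not be measurable, since
  -- only the preimage has to be.
  have hm : Measurable (U.piecewise u fun _ => 0) :=
    hu.measurable_piecewise continuousOn_const hU.measurableSet
  refine ⟨(volume.restrict A).map (U.piecewise u fun _ => 0), fun s hs => ?_⟩
  rw [Measure.map_apply hm hs, Measure.restrict_apply (hm hs)]
  congr 1
  ext y
  constructor
  · rintro ⟨h1, h2⟩
    refine ⟨h2, ?_⟩
    rwa [mem_preimage, piecewise_eq_of_mem _ _ _ (hAU h2)] at h1
  · rintro ⟨h1, h2⟩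
    refine ⟨?_, h1⟩
    rwa [mem_preimage, piecewise_eq_of_mem _ _ _ (hAU h1)]

theorem exists_isMedianOn {u : Plane → ℝ} {A U : Set Plane} (hU : IsOpen U)
    (hu : ContinuousOn u U) (hAU : A ⊆ U) (hA0 : volume A ≠ 0) (hA : volume A ≠ ⊤) {a b : ℝ}
    (hab : ∀ y ∈ A, u y ∈ Ico a b) : ∃ m, IsMedianOn u A m := by
  obtain ⟨μ, hμ⟩ := exists_distribution hU hu hAU
  have huniv : μ univ = volume A := by
    rw [hμ _ MeasurableSet.univ]
    simp
  have : IsFiniteMeasure μ := ⟨by rw [huniv]; exact hA.lt_top⟩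
  have ha : μ (Iio a) = 0 := by
    rw [hμ _ measurableSet_Iio]
    refine measure_mono_null (fun y hy => ?_) measure_empty
    exact absurd (hab y hy.1).1 (not_le.2 hy.2)
  have hb : μ (Ici b) = 0 := by
    rw [hμ _ measurableSet_Ici]
    refine measure_mono_null (fun y hy => ?_) measure_empty
    exact absurd (hab y hy.1).2 (not_lt.2 hy.2)
  obtain ⟨m, h1, h2⟩ := μ.exists_median (by rwa [huniv]) ha hb
  rw [hμ _ measurableSet_Iio, huniv] at h1
  rw [hμ _ measurableSet_Ioi, huniv] at h2
  exact ⟨m, h1, h2⟩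

/-- Between two medians there are almost no values. -/
theorem IsMedianOn.volume_between_eq_zero {u : Plane → ℝ} {A U : Set Plane} (hU : IsOpen U)
    (hu : ContinuousOn u U) (hAU : A ⊆ U) (hA : volume A ≠ ⊤) {m m' : ℝ} (hm : IsMedianOn u A m)
    (hm' : IsMedianOn u A m') (hlt : m < m') : volume {y ∈ A | u y ∈ Ioo m m'} = 0 := by
  obtain ⟨μ, hμ⟩ := exists_distribution hU hu hAU
  have huniv : μ univ = volume A := by
    rw [hμ _ MeasurableSet.univ]
    simp
  have h1 : 2 * μ (Ioi m) ≤ μ univ := by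
    rw [huniv, hμ _ measurableSet_Ioi]
    exact hm.2
  have h2 : 2 * μ (Iio m') ≤ μ univ := by
    rw [huniv, hμ _ measurableSet_Iio]
    exact hm'.1
  rw [← hμ _ measurableSet_Ioo]
  -- The rays above the smaller and below the larger median cover the line and overlap exactly in
  -- the gap; each has at most half of the mass.
  have h3 : μ univ + μ (Ioo m m') = μ (Ioi m) + μ (Iio m') := by
    rw [← measure_union_add_inter (Ioi m) measurableSet_Iio, Ioi_inter_Iio]
    congr 2
    ext x
    simp only [mem_univ, mem_union, mem_Ioi, mem_Iio, true_iff]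
    exact (lt_or_ge m x).imp_right fun h => h.trans_lt hlt
  have h4 : μ univ + μ univ + 2 * μ (Ioo m m') ≤ μ univ + μ univ + 0 := by
    calc _ = 2 * (μ univ + μ (Ioo m m')) := by ring
      _ = 2 * μ (Ioi m) + 2 * μ (Iio m') := by rw [h3]; ring
      _ ≤ μ univ + μ univ + 0 := by rw [add_zero]; exact add_le_add h1 h2
  have hf : μ univ + μ univ ≠ ⊤ := by rw [huniv]; simp [hA]
  have h5 := (ENNReal.add_le_add_iff_left hf).1 h4
  simpa using h5

theorem volume_preimage_homothety (x : Plane) {ρ : ℝ} (hρ : ρ ≠ 0) (S : Set Plane) :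
    volume {y | x + ρ • y ∈ S} = ENNReal.ofReal |(ρ ^ Module.finrank ℝ Plane)⁻¹| * volume S := by
  have h1 : {y | x + ρ • y ∈ S} = (fun y => ρ • y) ⁻¹' ((fun z => x + z) ⁻¹' S) := rfl
  rw [h1, Measure.addHaar_preimage_smul _ hρ, measure_preimage_add]

/-- Medians in rescaled coordinates. -/
theorem IsMedianOn.rescaled {u : Plane → ℝ} {A : Set Plane} {m : ℝ} (hm : IsMedianOn u A m)
    (x : Plane) {ρ : ℝ} (hρ : ρ ≠ 0) (hA : volume {y | x + ρ • y ∈ A} ≠ ⊤) :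
    2 * volume.real {y | x + ρ • y ∈ A ∧ u (x + ρ • y) < m} ≤ volume.real {y | x + ρ • y ∈ A} ∧
    2 * volume.real {y | x + ρ • y ∈ A ∧ m < u (x + ρ • y)} ≤ volume.real {y | x + ρ • y ∈ A} := by
  have key : ∀ S : Set Plane, 2 * volume S ≤ volume A →
      2 * volume.real {y | x + ρ • y ∈ S} ≤ volume.real {y | x + ρ • y ∈ A} := by
    intro S hS
    have h1 : 2 * volume {y | x + ρ • y ∈ S} ≤ volume {y | x + ρ • y ∈ A} := by
      rw [volume_preimage_homothety x hρ, volume_preimage_homothety x hρ, mul_left_comm]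
      gcongr
    have h2 := ENNReal.toReal_mono hA h1
    rwa [ENNReal.toReal_mul] at h2
  exact ⟨key _ hm.1, key _ hm.2⟩


/-! ### Imbalance of the amoeba with respect to sublevel sets -/

/-- The amoeba of radius `ρ` around `x`, blown up about `x` by the factor `1 / ρ`. -/
def scaledAmoeba (ν : ℝ → ℝ) (Ω : Set Plane) (f : Plane → ℝ) (x : Plane) (ρ : ℝ) : Set Plane :=
  {y | x + ρ • y ∈ amoeba ν Ω f x ρ}

theorem volume_ne_top_of_norm_le {B : Set Plane} {M : ℝ} (hB : ∀ y ∈ B, ‖y‖ ≤ M) :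
    volume B ≠ ⊤ := by
  have h : volume (Metric.closedBall (0 : Plane) M) ≠ ⊤ := measure_closedBall_lt_top.ne
  exact measure_ne_top_of_subset (fun y hy => mem_closedBall_zero_iff.2 (hB y hy)) h

/-- A set between two starshaped sets differs little from a third one between them. -/
theorem abs_volume_inter_sub_le_of_starSet {B : Set Plane} {Q ε : Plane → ℝ} {M : ℝ}
    (hε : ∀ y, 0 ≤ ε y) (hQ : ∀ y, 0 ≤ Q y - ε y) (hM : ∀ y, Q y + ε y ≤ M)
    (hin : ∀ y, y ≠ 0 → ‖y‖ ≤ Q y - ε y → y ∈ B) (hout : ∀ y, y ≠ 0 → y ∈ B → ‖y‖ ≤ Q y + ε y)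
    (P : Set Plane) :
    |volume.real (B ∩ P) - volume.real (starSet Q ∩ P)| ≤
      volume.real (starSet (fun y => Q y + ε y) \ starSet fun y => Q y - ε y) := by
  have hQM : ∀ y, Q y ≤ M := fun y => by linarith [hM y, hε y]
  have hZf : volume ((starSet (fun y => Q y + ε y) \ starSet fun y => Q y - ε y) ∪ {0}) ≠ ⊤ :=
    measure_union_ne_top (measure_ne_top_of_subset sdiff_subset (volume_starSet_ne_top hM)) (by simp)
  have hBf : volume B ≠ ⊤ := by
    refine volume_ne_top_of_norm_le (M := M) fun y hy => ?_
    rcases eq_or_ne y 0 with rfl | h0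
    · rw [norm_zero]
      linarith [hQ 0, hQM 0, hε 0]
    · exact (hout y h0 hy).trans (hM y)
  refine (abs_measureReal_sub_le (Z := (starSet (fun y => Q y + ε y) \
    starSet fun y => Q y - ε y) ∪ {0}) ?_ ?_ (measure_ne_top_of_subset inter_subset_left hBf)
    (measure_ne_top_of_subset inter_subset_left (volume_starSet_ne_top hQM)) hZf).trans ?_
  · rintro y ⟨hyB, hyP⟩
    rcases eq_or_ne y 0 with h0 | h0
    · exact Or.inr (Or.inr h0)
    have hn := norm_pos_iff.2 h0
    rcases le_or_gt ‖y‖ (Q y) with h | h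
    · exact Or.inl ⟨⟨hn, h⟩, hyP⟩
    · exact Or.inr (Or.inl ⟨⟨hn, hout y h0 hyB⟩, fun h' => by linarith [hε y, h'.2]⟩)
  · rintro y ⟨⟨hn, hyQ⟩, hyP⟩
    rcases le_or_gt ‖y‖ (Q y - ε y) with h | h
    · exact Or.inl ⟨hin y (norm_pos_iff.1 hn) h, hyP⟩
    · exact Or.inr (Or.inl ⟨⟨hn, hyQ.trans (by linarith [hε y])⟩, fun h' => absurd h'.2 (not_le.2 h)⟩)
  · refine (measureReal_union_le _ _).trans ?_
    simp [measureReal_def]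

/-- The inner ball makes the area positive and supplies the open set needed for uniqueness of the
median; the outer bound gives finite area. -/
theorem exists_ball_subset_scaledAmoeba {ν : ℝ → ℝ} (hν : IsAmoebaProfile ν) {Ω : Set Plane}
    {f : Plane → ℝ} (hf : ContDiffOn ℝ ∞ f Ω) {x : Plane} (hx : x ∈ interior Ω) :
    ∃ m ρ₀, 0 < m ∧ 0 < ρ₀ ∧ ∀ ρ, 0 < ρ → ρ < ρ₀ →
      (∀ y, y ≠ 0 → ‖y‖ ≤ m → y ∈ scaledAmoeba ν Ω f x ρ) ∧
      ∀ y ∈ scaledAmoeba ν Ω f x ρ, ‖y‖ ≤ 1 / ν 0 := by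
  obtain ⟨K, C, ρ₁, hK, hC, hρ₁, h⟩ := exists_amoeba_radial hν hf hx
  obtain ⟨m, ρ₂, hm, hρ₂, hb⟩ := exists_approxRadius_bounds hν (fderiv ℝ f x)
    (fderiv ℝ (fderiv ℝ f) x) hK hC.le
  refine ⟨m, min ρ₁ ρ₂, hm, lt_min hρ₁ hρ₂, fun ρ hρ hlt => ⟨fun y hy hym => ?_, fun y hy => ?_⟩⟩
  · exact (h ρ hρ (hlt.trans_le (min_le_left _ _)) y hy).1
      (hym.trans (hb ρ hρ (hlt.trans_le (min_le_right _ _)) y).1)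
  · rcases eq_or_ne y 0 with rfl | h0
    · rw [norm_zero]
      have := hν.pos
      positivity
    · exact ((h ρ hρ (hlt.trans_le (min_le_left _ _)) y h0).2 hy).1

theorem ContinuousLinearMap.apply_apply_unitVec_add (D : Plane →L[ℝ] Plane →L[ℝ] ℝ) {φ : ℝ}
    (hD : D (unitVec φ) (unitNormal φ) = D (unitNormal φ) (unitVec φ)) (θ : ℝ) :
    D (unitVec (φ + θ)) (unitVec (φ + θ)) =
      Real.sin θ ^ 2 * D (unitNormal φ) (unitNormal φ) +
      2 * (Real.sin θ * Real.cos θ) * D (unitNormal φ) (unitVec φ) +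
      Real.cos θ ^ 2 * D (unitVec φ) (unitVec φ) := by
  rw [unitVec_add]
  simp only [map_add, map_smul, add_apply, smul_apply, smul_eq_mul, hD]
  ring

/-- The integrals `J₁`, `J₂`, `J₃` combined into one. -/
theorem IsAmoebaProfile.integral_deriv_div_mul {ν : ℝ → ℝ} (hν : IsAmoebaProfile ν) (s α a b c : ℝ) :
    ∫ θ in (α - Real.pi / 2)..(α + Real.pi / 2), deriv ν (s * Real.cos θ) / ν (s * Real.cos θ) ^ 4 *
      (Real.sin θ ^ 2 * a + 2 * (Real.sin θ * Real.cos θ) * b + Real.cos θ ^ 2 * c) =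
    J₁ ν s α * a + 2 * J₂ ν s α * b + J₃ ν s α * c := by
  have h1 := hν.intervalIntegrable_deriv_div s (α - Real.pi / 2) (α + Real.pi / 2)
    (w := fun θ => Real.sin θ ^ 2) (by fun_prop)
  have h2 := hν.intervalIntegrable_deriv_div s (α - Real.pi / 2) (α + Real.pi / 2)
    (w := fun θ => Real.sin θ * Real.cos θ) (by fun_prop)
  have h3 := hν.intervalIntegrable_deriv_div s (α - Real.pi / 2) (α + Real.pi / 2)
    (w := fun θ => Real.cos θ ^ 2) (by fun_prop)
  rw [J₁, J₂, J₃, mul_right_comm 2, mul_comm (2 * b), ← intervalIntegral.integral_mul_const,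
    ← intervalIntegral.integral_mul_const, ← intervalIntegral.integral_mul_const,
    ← intervalIntegral.integral_add (h1.mul_const a) (h2.mul_const (2 * b)),
    ← intervalIntegral.integral_add ((h1.mul_const a).add (h2.mul_const (2 * b))) (h3.mul_const c)]
  refine intervalIntegral.integral_congr fun θ _ => ?_
  show _ = _
  ring

theorem fderiv_eq_inner_unitVec {g : Plane → ℝ} {x : Plane} {θ : ℝ}
    (h : gradient g x = ‖gradient g x‖ • unitVec θ) (y : Plane) :
    fderiv ℝ g x y = ‖gradient g x‖ * inner ℝ (unitVec θ) y := by
  have h1 : fderiv ℝ g x y = inner ℝ (gradient g x) y := by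
    simp [gradient]
  rw [h1, h, inner_smul_left]
  simp [norm_smul, norm_unitVec]

theorem ContDiffOn.contDiffAt_three {g : Plane → ℝ} {Ω : Set Plane} (hg : ContDiffOn ℝ ∞ g Ω)
    {x : Plane} (hx : x ∈ interior Ω) : ContDiffAt ℝ 3 g x :=
  (hg.contDiffAt (mem_interior_iff_mem_nhds.1 hx)).of_le
    (WithTop.coe_le_coe.2 (le_top (a := (3 : ℕ∞))))

set_option maxHeartbeats 1000000 in
-- The true amoeba is exchanged for the approximate one at the cost of the shell area. The half
-- plane imbalance and the parabola then give the two parts of `R`. The level `k` ranges over a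
-- bounded set with uniform constants, because it will be chosen depending on `ρ`.
theorem exists_amoeba_imbalance_expansion {ν : ℝ → ℝ} (hν : IsAmoebaProfile ν)
    {Ω : Set Plane} {f u : Plane → ℝ} (hf : ContDiffOn ℝ ∞ f Ω) (hu : ContDiffOn ℝ ∞ u Ω)
    {x : Plane} (hx : x ∈ interior Ω) (hf₀ : gradient f x ≠ 0) (hu₀ : gradient u x ≠ 0)
    {φ α : ℝ} (hφ : gradient f x = ‖gradient f x‖ • unitVec φ)
    (hα : gradient u x = ‖gradient u x‖ • unitVec (φ + α)) (K₀ : ℝ) :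
    ∃ K c C ρ₀, 0 < K ∧ 0 < c ∧ 0 < C ∧ 0 < ρ₀ ∧ ∀ ρ, 0 < ρ → ρ < ρ₀ → ∀ k, |k| ≤ K₀ →
      |2 * volume.real (scaledAmoeba ν Ω f x ρ ∩ scaledSublevel u x (1 / ν 0 + 1) ρ k) -
        volume.real (scaledAmoeba ν Ω f x ρ) - ρ * (c * (k - amoebaRHS ν f u x φ α / 6))| ≤
      C * ((∫ θ in (α - Real.pi / 2)..(α + Real.pi / 2),
        secondDiff ν (K * ρ) (‖gradient f x‖ * Real.cos θ)) + ρ ^ 2) := by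
  have hfx := hf.contDiffAt_three hx
  have hux := hu.contDiffAt_three hx
  obtain ⟨K, C₁, ρ₁, hK, hC₁, hρ₁, hrad⟩ := exists_amoeba_radial hν hf hx
  set l := fderiv ℝ f x with hl
  set D := fderiv ℝ (fderiv ℝ f) x with hD
  obtain ⟨m, ρ₂, hm, hρ₂, hbd⟩ := exists_approxRadius_bounds hν l D hK hC₁.le
  have hs : 0 < ‖gradient f x‖ := norm_pos_iff.2 hf₀
  have hG : 0 < ‖gradient u x‖ := norm_pos_iff.2 hu₀
  have hlφ : ∀ y, l y = ‖gradient f x‖ * inner ℝ (unitVec φ) y := fderiv_eq_inner_unitVec hφ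
  have huβ := fderiv_eq_inner_unitVec hα
  obtain ⟨C₂, ρ₃, hC₂, hρ₃, hlev⟩ := exists_abs_volume_sublevel_sub_le hν l D hK hux hG huβ K₀
  set s := ‖gradient f x‖ with hsdef
  set G := ‖gradient u x‖ with hGdef
  set β := φ + α with hβ
  have hν0 := hν.pos
  set M := 1 / ν 0 + 1 with hM
  have hM0 : 0 < M := by positivity
  -- The slope of `f` along `ξ` is `-|∇f| sin α`; evenness of the profile removes the sign.
  have hlξ : ν (l (unitNormal β)) = ν (s * Real.sin α) := by
    have h1 : l (unitNormal β) = -(s * Real.sin α) := by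
      rw [hlφ, inner_unitVec, hβ]
      simp only [unitNormal, PiLp.toLp_apply, Matrix.cons_val_zero, Matrix.cons_val_one,
        Real.sin_add, Real.cos_add]
      linear_combination (-s * Real.sin α) * Real.sin_sq_add_cos_sq φ
    rw [h1, hν.even]
  set vξ := ν (s * Real.sin α) with hvξ
  have hvξ0 : 0 < vξ := hν.pos' _
  have hlθ : ∀ θ, l (unitVec (φ + θ)) = s * Real.cos θ := fun θ => by
    rw [hlφ, inner_unitVec_unitVec, add_sub_cancel_left]
  set w : ℝ → ℝ := fun θ => D (unitVec (φ + θ)) (unitVec (φ + θ)) with hw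
  have hwc : Continuous w := by
    have := continuous_unitVec
    simp only [hw]
    fun_prop
  have hwB : ∀ θ, |w θ| ≤ ‖D‖ := fun θ => by
    have := D.le_opNorm₂ (unitVec (φ + θ)) (unitVec (φ + θ))
    rwa [norm_unitVec, mul_one, mul_one] at this
  have hsymm : IsSymmSndFDerivAt ℝ f x := hfx.isSymmSndFDerivAt (by simp; norm_num)
  set I := ∫ θ in (α - Real.pi / 2)..(α + Real.pi / 2),
    deriv ν (s * Real.cos θ) / ν (s * Real.cos θ) ^ 4 * w θ with hI
  have hIJ : I = J₁ ν s α * secondDeriv f x (unitNormal φ) (unitNormal φ) +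
      2 * J₂ ν s α * secondDeriv f x (unitNormal φ) (unitVec φ) +
      J₃ ν s α * secondDeriv f x (unitVec φ) (unitVec φ) := by
    rw [hI, ← hν.integral_deriv_div_mul]
    simp only [hw, D.apply_apply_unitVec_add (hsymm.eq _ _)]
    rfl
  have hR : amoebaRHS ν f u x φ α =
      secondDeriv u x (unitNormal β) (unitNormal β) / vξ ^ 2 - 3 / 2 * vξ * G * I := by
    rw [hIJ]
    rfl
  set U := secondDeriv u x (unitNormal β) (unitNormal β) with hU
  set S : ℝ → ℝ := fun ρ => ∫ θ in (α - Real.pi / 2)..(α + Real.pi / 2),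
    secondDiff ν (K * ρ) (s * Real.cos θ) with hS
  have hpi := Real.pi_pos
  have hS0 : ∀ ρ, 0 ≤ S ρ := fun ρ => intervalIntegral.integral_nonneg (by linarith) fun _ _ =>
    secondDiff_nonneg hν.convexOn _ _
  -- change of variables from absolute to relative angles
  have hshift : ∀ g : ℝ → ℝ, ∫ θ in (β - Real.pi / 2)..(β + Real.pi / 2), g θ =
      ∫ θ in (α - Real.pi / 2)..(α + Real.pi / 2), g (φ + θ) := fun g => by
    rw [intervalIntegral.integral_comp_add_left]
    congr 1 <;> rw [hβ] <;> ring
  refine ⟨K, 4 / (vξ * G), 2 * C₂ + 12 * M * C₁ * (1 + Real.pi) + ‖D‖ / (2 * ν 0 ^ 4) / K,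
    min ρ₁ (min ρ₂ ρ₃), hK, by positivity, by positivity, lt_min hρ₁ (lt_min hρ₂ hρ₃),
    fun ρ hρ hlt k hk => ?_⟩
  rw [lt_min_iff, lt_min_iff] at hlt
  obtain ⟨hlt1, hlt2, hlt3⟩ := hlt
  have hKρ : 0 < K * ρ := mul_pos hK hρ
  have hlev' := hlev ρ hρ hlt3 k hk
  rw [hlξ] at hlev'
  set Q := approxRadius ν l D (K * ρ) ρ with hQdef
  set ε := radiusError ν l C₁ (K * ρ) ρ with hεdef
  have hε0 : ∀ y, 0 ≤ ε y := fun y => radiusError_nonneg hν hC₁.le y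
  have hQm : ∀ y, 0 ≤ Q y - ε y := fun y => hm.le.trans (hbd ρ hρ hlt2 y).1
  have hQM : ∀ y, Q y + ε y ≤ M := fun y => (hbd ρ hρ hlt2 y).2
  have hQ0 : ∀ y, 0 ≤ Q y := fun y => by linarith [hQm y, hε0 y]
  have hQM' : ∀ y, Q y ≤ M := fun y => by linarith [hQM y, hε0 y]
  set B := scaledAmoeba ν Ω f x ρ with hB
  have hcmp := abs_volume_inter_sub_le_of_starSet (B := B) hε0 hQm hQM
    (fun y hy h => (hrad ρ hρ hlt1 y hy).1 h) (fun y hy h => ((hrad ρ hρ hlt1 y hy).2 h).2)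
  have hZ := volumeReal_starSet_sdiff_le (l := l) (D := D) (h := K * ρ) (ρ := ρ) hν hC₁.le hQm hQM β
  rw [hshift] at hZ
  simp only [hlθ] at hZ
  set Z := volume.real (starSet (fun y => Q y + ε y) \ starSet fun y => Q y - ε y) with hZdef
  have hodd := volumeReal_starSet_neg_sub_pos hν hQ0 hQM' β
  rw [hshift] at hodd
  simp only [hlθ] at hodd
  have hsum := volumeReal_eq_add_halfPlanes β (volume_starSet_ne_top hQM')
  have hII := hν.abs_integral_symmSlope_sub_le hs.ne' (a := α - Real.pi / 2)
    (b := α + Real.pi / 2) (by linarith) hwc hwB hKρ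
  set Iρ := ∫ θ in (α - Real.pi / 2)..(α + Real.pi / 2),
    symmSlope ν (K * ρ) (s * Real.cos θ) / ν (s * Real.cos θ) ^ 4 * w θ with hIρ
  have h1 := hcmp (scaledSublevel u x M ρ k)
  have h2 := hcmp univ
  rw [inter_univ, inter_univ] at h2
  -- This identity fixes the normalization: with chord half-length `1 / vξ`, the zero in `k` is `U /
  -- (6 vξ²) - vξ G I / 4`, a sixth of the right-hand side of the equation.
  have hX : ρ * (4 / (vξ * G) * (k - amoebaRHS ν f u x φ α / 6)) =
      ρ * I + 2 * (ρ * ((2 * (1 / vξ) * k - U * (1 / vξ) ^ 3 / 3) / G)) := by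
    rw [hR]
    field_simp
    ring
  have h3 : |ρ * Iρ - ρ * I| ≤ ‖D‖ / (2 * ν 0 ^ 4) / K * S ρ := by
    rw [← mul_sub, abs_mul, abs_of_pos hρ]
    calc _ ≤ ρ * (‖D‖ / (2 * ν 0 ^ 4) * (S ρ / (K * ρ))) := by gcongr
      _ = _ := by field_simp
  have h4 : Z ≤ 4 * M * C₁ * (S ρ + Real.pi * ρ ^ 2) := hZ
  have h5 : 0 ≤ M * C₁ * Real.pi * S ρ := mul_nonneg (by positivity) (hS0 ρ)
  have h6 : 0 ≤ M * C₁ * ρ ^ 2 := by positivity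
  have h7 : 0 ≤ ‖D‖ / (2 * ν 0 ^ 4) / K * ρ ^ 2 := by positivity
  have h8 : 0 ≤ C₂ * S ρ := mul_nonneg hC₂.le (hS0 ρ)
  rw [hX]
  -- The shell enters three times: twice through the sublevel area and once through the total area.
  have h9 : |2 * volume.real (B ∩ scaledSublevel u x M ρ k) - volume.real B -
      (ρ * I + 2 * (ρ * ((2 * (1 / vξ) * k - U * (1 / vξ) ^ 3 / 3) / G)))| ≤
      3 * Z + 2 * (C₂ * ρ ^ 2) + ‖D‖ / (2 * ν 0 ^ 4) / K * S ρ := by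
    have e1 := abs_le.1 h1
    have e2 := abs_le.1 h2
    have e3 := abs_le.1 h3
    have e4 := abs_le.1 hlev'
    rw [abs_le]
    constructor <;> linarith [e1.1, e1.2, e2.1, e2.2, e3.1, e3.2, e4.1, e4.2]
  refine h9.trans ?_
  have h10 : (2 * C₂ + 12 * M * C₁ * (1 + Real.pi) + ‖D‖ / (2 * ν 0 ^ 4) / K) * (S ρ + ρ ^ 2) =
      3 * (4 * M * C₁ * (S ρ + Real.pi * ρ ^ 2)) + 2 * (C₂ * ρ ^ 2) +
      ‖D‖ / (2 * ν 0 ^ 4) / K * S ρ + (12 * (M * C₁ * Real.pi * S ρ) + 12 * (M * C₁ * ρ ^ 2) +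
      ‖D‖ / (2 * ν 0 ^ 4) / K * ρ ^ 2 + 2 * (C₂ * S ρ)) := by ring
  calc _ ≤ (2 * C₂ + 12 * M * C₁ * (1 + Real.pi) + ‖D‖ / (2 * ν 0 ^ 4) / K) * (S ρ + ρ ^ 2) := by
        rw [h10]
        linarith
    _ = _ := rfl


/-! ### Amoeba medians -/

theorem measurableSet_scaledSublevel {u : Plane → ℝ} {U : Set Plane} (hU : IsOpen U)
    (hu : ContinuousOn u U) {x : Plane} {M ρ : ℝ} (hM : ∀ y, ‖y‖ ≤ M → x + ρ • y ∈ U) (k : ℝ) :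
    MeasurableSet (scaledSublevel u x M ρ k) := by
  have hc : Continuous fun y : Plane => x + ρ • y := by fun_prop
  have h1 : IsOpen ((fun y : Plane => x + ρ • y) ⁻¹' U ∩
      (fun y => u (x + ρ • y)) ⁻¹' Iio (u x + ρ ^ 2 * k)) :=
    (hu.comp hc.continuousOn fun _ h => h).isOpen_inter_preimage (hU.preimage hc) isOpen_Iio
  have h2 : scaledSublevel u x M ρ k = Metric.closedBall 0 M ∩
      ((fun y : Plane => x + ρ • y) ⁻¹' U ∩
        (fun y => u (x + ρ • y)) ⁻¹' Iio (u x + ρ ^ 2 * k)) := by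
    ext y
    constructor
    · rintro ⟨h, h'⟩
      exact ⟨mem_closedBall_zero_iff.2 h, hM y h, h'⟩
    · rintro ⟨h, -, h'⟩
      exact ⟨mem_closedBall_zero_iff.1 h, h'⟩
  rw [h2]
  exact Metric.isClosed_closedBall.measurableSet.inter h1.measurableSet

section
variable {u : Plane → ℝ} {A : Set Plane} {m : ℝ} {x : Plane} {ρ M k : ℝ}

theorem IsMedianOn.le_of_volume_lt (hm : IsMedianOn u A m) (hρ : ρ ≠ 0)
    (hB : ∀ y, x + ρ • y ∈ A → ‖y‖ ≤ M)
    (h : volume.real {y | x + ρ • y ∈ A} <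
      2 * volume.real ({y | x + ρ • y ∈ A} ∩ scaledSublevel u x M ρ k)) :
    m ≤ u x + ρ ^ 2 * k := by
  by_contra! hlt
  have hf : volume {y | x + ρ • y ∈ A} ≠ ⊤ := volume_ne_top_of_norm_le hB
  have h1 := (hm.rescaled x hρ hf).1
  have h2 : volume.real ({y | x + ρ • y ∈ A} ∩ scaledSublevel u x M ρ k) ≤
      volume.real {y | x + ρ • y ∈ A ∧ u (x + ρ • y) < m} :=
    measureReal_mono (fun y hy => ⟨hy.1, hy.2.2.trans hlt⟩)
      (measure_ne_top_of_subset (fun y hy => hy.1) hf)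
  linarith

/-- Unlike the upper bound, this passes to the complement within the amoeba, so the sublevel set has
to be measurable. -/
theorem IsMedianOn.ge_of_volume_lt (hm : IsMedianOn u A m) (hρ : ρ ≠ 0)
    (hB : ∀ y, x + ρ • y ∈ A → ‖y‖ ≤ M) (hP : MeasurableSet (scaledSublevel u x M ρ k))
    (h : 2 * volume.real ({y | x + ρ • y ∈ A} ∩ scaledSublevel u x M ρ k) <
      volume.real {y | x + ρ • y ∈ A}) :
    u x + ρ ^ 2 * k ≤ m := by
  by_contra! hlt
  have hf : volume {y | x + ρ • y ∈ A} ≠ ⊤ := volume_ne_top_of_norm_le hB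
  have h1 := (hm.rescaled x hρ hf).2
  have h2 : volume.real ({y | x + ρ • y ∈ A} \ scaledSublevel u x M ρ k) ≤
      volume.real {y | x + ρ • y ∈ A ∧ m < u (x + ρ • y)} := by
    refine measureReal_mono (fun y hy => ⟨hy.1, hlt.trans_le ?_⟩)
      (measure_ne_top_of_subset (fun y hy => hy.1) hf)
    by_contra! hc
    exact hy.2 ⟨hB y hy.1, hc⟩
  have h3 := measureReal_inter_add_sdiff (s := {y | x + ρ • y ∈ A}) hP hf
  linarith

end

/-- Near a noncritical point, `u` takes all nearby values at a controlled distance. -/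
theorem eventually_exists_eq_add_sq_mul {u : Plane → ℝ} {U : Set Plane} {x : Plane}
    (hU : U ∈ 𝓝 x) (hu : ContinuousOn u U) (hd : DifferentiableAt ℝ u x)
    (hu₀ : gradient u x ≠ 0) {m : ℝ} (hm : 0 < m) (N : ℝ) :
    ∀ᶠ ρ : ℝ in 𝓝[>] 0, ∀ t, |t| ≤ N → ∃ y : Plane, ‖y‖ < m ∧ u (x + ρ • y) = u x + ρ ^ 2 * t := by
  set G := ‖gradient u x‖ with hG
  have hG0 : 0 < G := norm_pos_iff.2 hu₀
  -- Along the gradient `u` changes by `± ρ m G / 2` at the ends of the segment. One half of this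
  -- absorbs the differentiability error and the other half the shift `ρ² t`, after which the
  -- intermediate value theorem applies.
  set e : Plane := (m / 2 / G) • gradient u x with he
  have hen : ‖e‖ = m / 2 := by
    rw [he, norm_smul, Real.norm_eq_abs, abs_of_pos (by positivity), ← hG]
    field_simp
  have hue : fderiv ℝ u x e = m / 2 * G := by
    have h1 : fderiv ℝ u x e = inner ℝ (gradient u x) e := by simp [gradient]
    rw [h1, he, inner_smul_right, real_inner_self_eq_norm_sq, ← hG]
    field_simp
  have hlo := hd.hasFDerivAt.isLittleO.def (c := G / 2) (by positivity)
  obtain ⟨r, hr, hball⟩ := Metric.eventually_nhds_iff_ball.1 (hlo.and hU)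
  have hev : ∀ᶠ ρ : ℝ in 𝓝[>] 0, ρ < r / m ∧ ρ < m * G / 4 / (|N| + 1) :=
    ((eventually_lt_nhds (by positivity)).and (eventually_lt_nhds (by positivity))).filter_mono
      nhdsWithin_le_nhds
  filter_upwards [hev, self_mem_nhdsWithin] with ρ ⟨h1, h2⟩ (hρ : 0 < ρ) t ht
  rw [lt_div_iff₀ hm] at h1
  rw [lt_div_iff₀ (by positivity)] at h2
  have hin : ∀ τ ∈ Icc (-1 : ℝ) 1, x + ρ • (τ • e) ∈ Metric.ball x r := by
    intro τ hτ
    rw [mem_ball_iff_norm, add_sub_cancel_left, norm_smul, norm_smul, hen, Real.norm_eq_abs,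
      Real.norm_eq_abs, abs_of_pos hρ]
    have : |τ| ≤ 1 := abs_le.2 hτ
    have : ρ * (|τ| * (m / 2)) ≤ ρ * (1 * (m / 2)) := by gcongr
    nlinarith
  have hcont : ContinuousOn (fun τ : ℝ => u (x + ρ • (τ • e))) (Icc (-1) 1) :=
    hu.comp (by fun_prop) fun τ hτ => (hball _ (hin τ hτ)).2
  have hest : ∀ τ : ℝ, |τ| = 1 → |u (x + ρ • (τ • e)) - u x - ρ * τ * (m / 2 * G)| ≤
      ρ * (m * G / 4) := by
    intro τ hτ
    have := (hball _ (hin τ (abs_le.1 hτ.le))).1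
    rw [add_sub_cancel_left, map_smul, map_smul, hue, norm_smul, norm_smul, hen, Real.norm_eq_abs,
      Real.norm_eq_abs, Real.norm_eq_abs, hτ, abs_of_pos hρ, smul_eq_mul, smul_eq_mul] at this
    calc _ = |u (x + ρ • (τ • e)) - u x - ρ * (τ * (m / 2 * G))| := by rw [mul_assoc ρ]
      _ ≤ _ := this
      _ = _ := by ring
  have hbd : |ρ ^ 2 * t| ≤ ρ * (m * G / 4) := by
    rw [abs_mul, abs_of_nonneg (sq_nonneg ρ), sq, mul_assoc]
    have : |t| ≤ |N| + 1 := by linarith [le_abs_self N]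
    have : ρ * |t| ≤ ρ * (|N| + 1) := by gcongr
    gcongr
    linarith
  have hbd' := abs_le.1 hbd
  have e1 := abs_le.1 (hest 1 (by simp))
  have e2 := abs_le.1 (hest (-1) (by simp))
  obtain ⟨τ, hτ, h⟩ := intermediate_value_Icc (by norm_num) hcont
    (show u x + ρ ^ 2 * t ∈ Icc (u (x + ρ • ((-1 : ℝ) • e))) (u (x + ρ • ((1 : ℝ) • e))) from
      ⟨by linarith [e2.2, hbd'.1], by linarith [e1.1, hbd'.2]⟩)
  refine ⟨τ • e, ?_, h⟩
  rw [norm_smul, hen, Real.norm_eq_abs]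
  have : |τ| ≤ 1 := abs_le.2 hτ
  nlinarith

/-- Two different medians leave a gap that no interior value can fill. -/
theorem IsMedianOn.not_lt_of_ball_subset {u : Plane → ℝ} {A U : Set Plane} (hU : IsOpen U)
    (hu : ContinuousOn u U) (hAU : A ⊆ U) (hA : volume A ≠ ⊤) {m m' : ℝ} (hm : IsMedianOn u A m)
    (hm' : IsMedianOn u A m') {x z : Plane} {r : ℝ} (hrU : Metric.ball x r ⊆ U)
    (hr : Metric.ball x r \ {x} ⊆ A) (hz : z ∈ Metric.ball x r) (hzm : u z = (m + m') / 2) :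
    ¬ m < m' := by
  intro hlt
  have h0 := hm.volume_between_eq_zero hU hu hAU hA hm' hlt
  have hopen : IsOpen (Metric.ball x r ∩ u ⁻¹' Ioo m m') :=
    (hu.mono hrU).isOpen_inter_preimage Metric.isOpen_ball isOpen_Ioo
  have hpos := hopen.measure_pos volume ⟨z, hz, by
    rw [mem_preimage, hzm]; constructor <;> linarith⟩
  have hsub : Metric.ball x r ∩ u ⁻¹' Ioo m m' ⊆ {y ∈ A | u y ∈ Ioo m m'} ∪ {x} := by
    rintro y ⟨hy, hy'⟩
    rcases eq_or_ne y x with h | h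
    · exact Or.inr h
    · exact Or.inl ⟨hr ⟨hy, h⟩, hy'⟩
  have : volume ({y ∈ A | u y ∈ Ioo m m'} ∪ {x}) = 0 :=
    measure_union_null h0 (by simp)
  exact hpos.ne' (measure_mono_null hsub this)

theorem tendsto_integral_secondDiff_comp_mul_div {ν : ℝ → ℝ} (hν : IsAmoebaProfile ν) {s K : ℝ}
    (hs : s ≠ 0) (hK : 0 < K) (a b : ℝ) :
    Tendsto (fun ρ => (∫ θ in a..b, secondDiff ν (K * ρ) (s * Real.cos θ)) / ρ) (𝓝[>] 0) (𝓝 0) := by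
  have h1 : Tendsto (fun ρ : ℝ => K * ρ) (𝓝[>] 0) (𝓝[>] 0) := by
    refine tendsto_nhdsWithin_iff.2 ⟨?_, ?_⟩
    · have : Tendsto (fun ρ : ℝ => K * ρ) (𝓝 0) (𝓝 (K * 0)) := (continuous_const_mul K).tendsto 0
      rw [mul_zero] at this
      exact this.mono_left nhdsWithin_le_nhds
    · filter_upwards [self_mem_nhdsWithin] with ρ (hρ : 0 < ρ)
      exact mul_pos hK hρ
  have h2 := ((tendsto_integral_secondDiff_div hν hs a b).comp h1).const_mul K
  rw [mul_zero] at h2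
  refine h2.congr fun ρ => ?_
  simp only [Function.comp]
  field_simp

/-- Existence, uniqueness and location of the median on small amoebas. -/
theorem exists_median_estimate {ν : ℝ → ℝ} (hν : IsAmoebaProfile ν)
    {Ω : Set Plane} {f u : Plane → ℝ} (hf : ContDiffOn ℝ ∞ f Ω) (hu : ContDiffOn ℝ ∞ u Ω)
    {x : Plane} (hx : x ∈ interior Ω) (hf₀ : gradient f x ≠ 0) (hu₀ : gradient u x ≠ 0)
    {φ α : ℝ} (hφ : gradient f x = ‖gradient f x‖ • unitVec φ)
    (hα : gradient u x = ‖gradient u x‖ • unitVec (φ + α)) :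
    ∃ K C, 0 < K ∧ 0 < C ∧ ∀ᶠ ρ : ℝ in 𝓝[>] 0, (∃! m, IsMedianOn u (amoeba ν Ω f x ρ) m) ∧
      ∀ m, IsMedianOn u (amoeba ν Ω f x ρ) m →
        |m - (u x + ρ ^ 2 / 6 * amoebaRHS ν f u x φ α)| ≤
          C * ρ * ((∫ θ in (α - Real.pi / 2)..(α + Real.pi / 2),
            secondDiff ν (K * ρ) (‖gradient f x‖ * Real.cos θ)) + ρ ^ 2) := by
  set R := amoebaRHS ν f u x φ α with hR
  -- The range `|R| / 6 + 1` admits the levels `R / 6 ± δ` as soon as `δ ≤ 1`.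
  obtain ⟨K, c, C, ρ₁, hK, hc, hC, hρ₁, himb⟩ :=
    exists_amoeba_imbalance_expansion hν hf hu hx hf₀ hu₀ hφ hα (|R| / 6 + 1)
  obtain ⟨m₀, ρ₂, hm₀, hρ₂, hball⟩ := exists_ball_subset_scaledAmoeba hν hf hx
  rw [← hR] at himb
  set S : ℝ → ℝ := fun ρ => ∫ θ in (α - Real.pi / 2)..(α + Real.pi / 2),
    secondDiff ν (K * ρ) (‖gradient f x‖ * Real.cos θ) with hS
  have hpi := Real.pi_pos
  have hS0 : ∀ ρ, 0 ≤ S ρ := fun ρ => intervalIntegral.integral_nonneg (by linarith) fun _ _ =>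
    secondDiff_nonneg hν.convexOn _ _
  have hν0 := hν.pos
  set M := 1 / ν 0 + 1 with hM
  have hM0 : 0 < M := by positivity
  have hU : IsOpen (interior Ω) := isOpen_interior
  have huc : ContinuousOn u (interior Ω) := hu.continuousOn.mono interior_subset
  obtain ⟨r, hr, hrΩ⟩ := Metric.isOpen_iff.1 hU x hx
  have hrad : Tendsto (fun ρ : ℝ => 2 * C / c * (S ρ / ρ + ρ)) (𝓝[>] 0) (𝓝 0) := by
    have h1 := tendsto_integral_secondDiff_comp_mul_div hν (norm_ne_zero_iff.2 hf₀) hK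
      (α - Real.pi / 2) (α + Real.pi / 2)
    have h2 : Tendsto (fun ρ : ℝ => ρ) (𝓝[>] 0) (𝓝 0) := tendsto_id.mono_left nhdsWithin_le_nhds
    simpa using (h1.add h2).const_mul (2 * C / c)
  refine ⟨K, 2 * C / c, hK, by positivity, ?_⟩
  have hev : ∀ᶠ ρ : ℝ in 𝓝[>] 0, ρ < ρ₁ ∧ ρ < ρ₂ ∧ ρ < r / (M + m₀) :=
    ((eventually_lt_nhds hρ₁).and ((eventually_lt_nhds hρ₂).and
      (eventually_lt_nhds (by positivity)))).filter_mono nhdsWithin_le_nhds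
  filter_upwards [hev, hrad.eventually_le_const zero_lt_one, self_mem_nhdsWithin,
    eventually_exists_eq_add_sq_mul (hU.mem_nhds hx) huc
      (hu.contDiffAt_three hx |>.differentiableAt (by norm_num)) hu₀ hm₀ (|R| / 6 + 1)]
    with ρ ⟨hlt1, hlt2, hlt3⟩ hδ1 (hρ : 0 < ρ) hval
  rw [lt_div_iff₀ (by positivity)] at hlt3
  have hρM : ρ * M < r := by nlinarith
  have hρm : ρ * m₀ < r := by nlinarith
  set A := amoeba ν Ω f x ρ with hA
  obtain ⟨hin, hout⟩ := hball ρ hρ hlt2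
  have hB : ∀ y, x + ρ • y ∈ A → ‖y‖ ≤ M := fun y hy => (hout y hy).trans (by rw [hM]; linarith)
  have hMU : ∀ y : Plane, ‖y‖ ≤ M → x + ρ • y ∈ interior Ω := fun y hy => hrΩ <| by
    rw [mem_ball_iff_norm, add_sub_cancel_left, norm_smul, Real.norm_eq_abs, abs_of_pos hρ]
    exact (mul_le_mul_of_nonneg_left hy hρ.le).trans_lt hρM
  have hscale : ∀ z : Plane, x + ρ • (ρ⁻¹ • (z - x)) = z := fun z => by
    rw [smul_inv_smul₀ hρ.ne', add_sub_cancel]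
  have hscale_norm : ∀ z : Plane, ρ * ‖ρ⁻¹ • (z - x)‖ = ‖z - x‖ := fun z => by
    rw [norm_smul, Real.norm_eq_abs, abs_of_pos (inv_pos.2 hρ), mul_inv_cancel_left₀ hρ.ne']
  have hAM : A ⊆ Metric.closedBall x (ρ * M) := fun z hz => by
    rw [mem_closedBall_iff_norm, ← hscale_norm z]
    exact mul_le_mul_of_nonneg_left (hB _ (by rwa [hscale])) hρ.le
  have hMΩ : Metric.closedBall x (ρ * M) ⊆ interior Ω :=
    (Metric.closedBall_subset_ball hρM).trans hrΩ
  have hAU : A ⊆ interior Ω := hAM.trans hMΩ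
  have hAf : volume A ≠ ⊤ := measure_ne_top_of_subset hAM measure_closedBall_lt_top.ne
  have hmA : Metric.ball x (ρ * m₀) \ {x} ⊆ A := fun z hz => by
    have h1 : ‖z - x‖ < ρ * m₀ := mem_ball_iff_norm.1 hz.1
    rw [← hscale_norm z] at h1
    have := hin (ρ⁻¹ • (z - x)) (smul_ne_zero (inv_ne_zero hρ.ne') (sub_ne_zero.2 hz.2))
      (lt_of_mul_lt_mul_left h1 hρ.le).le
    rwa [scaledAmoeba, mem_ofPred_eq, hscale] at this
  have hA0 : volume A ≠ 0 := fun h0 => by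
    have h1 : volume (Metric.ball x (ρ * m₀)) = 0 :=
      measure_mono_null (t := A ∪ {x}) (fun z hz => by
        rcases eq_or_ne z x with h | h
        · exact Or.inr h
        · exact Or.inl (hmA ⟨hz, h⟩)) (measure_union_null h0 (by simp))
    exact (Metric.measure_ball_pos volume x (by positivity)).ne' h1
  set δ := 2 * C / c * (S ρ / ρ + ρ) with hδ
  have hδ0 : 0 ≤ δ := by have := hS0 ρ; positivity
  have hest : ∀ m, IsMedianOn u A m → |m - (u x + ρ ^ 2 / 6 * R)| ≤ ρ ^ 2 * δ := by
    intro m hm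
    have hk : ∀ σ : ℝ, |σ| ≤ 1 → |R / 6 + σ * δ| ≤ |R| / 6 + 1 := fun σ hσ => by
      refine (abs_add_le _ _).trans (add_le_add ?_ ?_)
      · rw [abs_div, abs_of_pos (by norm_num : (0 : ℝ) < 6)]
      · rw [abs_mul, abs_of_nonneg hδ0]
        exact mul_le_one₀ hσ hδ0 hδ1
    have he : 0 < C * (S ρ + ρ ^ 2) := by have := hS0 ρ; positivity
    -- The factor `2` in `δ` makes the main term twice the error bound, so that the imbalance has a
    -- strict sign at both levels.
    have hcδ : ρ * (c * δ) = 2 * (C * (S ρ + ρ ^ 2)) := by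
      rw [hδ]
      field_simp
    have h1 := abs_le.1 (himb ρ hρ hlt1 _ (hk 1 (by simp)))
    have h2 := abs_le.1 (himb ρ hρ hlt1 _ (hk (-1) (by simp)))
    have e1 : ρ * (c * (R / 6 + 1 * δ - R / 6)) = ρ * (c * δ) := by ring
    have e2 : ρ * (c * (R / 6 + -1 * δ - R / 6)) = -(ρ * (c * δ)) := by ring
    rw [e1, hcδ] at h1
    rw [e2, hcδ] at h2
    have h3 := hm.le_of_volume_lt (k := R / 6 + 1 * δ) hρ.ne' hB (by
      have := h1.1
      change volume.real (scaledAmoeba ν Ω f x ρ) < 2 * volume.real (scaledAmoeba ν Ω f x ρ ∩ _)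
      linarith)
    have h4 := hm.ge_of_volume_lt (k := R / 6 + -1 * δ) hρ.ne' hB
      (measurableSet_scaledSublevel hU huc hMU _) (by
      have := h2.2
      change 2 * volume.real (scaledAmoeba ν Ω f x ρ ∩ _) < volume.real (scaledAmoeba ν Ω f x ρ)
      linarith)
    rw [abs_le]
    constructor <;> linarith
  have hval' : ∀ m m', IsMedianOn u A m → IsMedianOn u A m' → ¬ m < m' := by
    intro m m' hm hm'
    have h1 := abs_le.1 (hest m hm)
    have h2 := abs_le.1 (hest m' hm')
    have hρ2 : 0 < ρ ^ 2 := by positivity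
    have hle : ρ ^ 2 * δ ≤ ρ ^ 2 * 1 := by gcongr
    -- Both medians lie within `ρ²` of the predicted value, so their midpoint is among the values
    -- that `u` attains in the inner ball.
    obtain ⟨y, hy, hyu⟩ := hval (((m + m') / 2 - u x) / ρ ^ 2) (by
      rw [abs_div, abs_of_pos hρ2, div_le_iff₀ hρ2]
      have h3 := abs_le.1 (le_refl |R|)
      have h4 : ρ ^ 2 * R ≤ ρ ^ 2 * |R| := by gcongr; exact le_abs_self R
      have h5 : ρ ^ 2 * -|R| ≤ ρ ^ 2 * R := by gcongr; exact neg_abs_le R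
      rw [abs_le]
      constructor <;> linarith)
    refine hm.not_lt_of_ball_subset hU huc hAU hAf hm' (x := x) (z := x + ρ • y) (r := ρ * m₀)
      ((Metric.ball_subset_ball hρm.le).trans hrΩ) hmA ?_ ?_
    · rw [mem_ball_iff_norm, add_sub_cancel_left, norm_smul, Real.norm_eq_abs, abs_of_pos hρ]
      exact mul_lt_mul_of_pos_left hy hρ
    · rw [hyu]
      field_simp
      ring
  refine ⟨?_, fun m hm => (hest m hm).trans_eq ?_⟩
  · obtain ⟨b, hb⟩ := (isCompact_closedBall x (ρ * M)).exists_bound_of_continuousOn (huc.mono hMΩ)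
    obtain ⟨m, hm⟩ := exists_isMedianOn hU huc hAU hA0 hAf (a := -b) (b := b + 1) fun z hz => by
      have := abs_le.1 (hb z (hAM hz))
      exact ⟨this.1, by linarith [this.2]⟩
    exact ⟨m, hm, fun m' hm' => le_antisymm (not_lt.1 (hval' m m' hm hm'))
      (not_lt.1 (hval' m' m hm' hm))⟩
  · change _ = 2 * C / c * ρ * (S ρ + ρ ^ 2)
    rw [hδ]
    field_simp

end

/-! ### From the median estimate to the asymptotic expansion -/

theorem theorem1 (ν : ℝ → ℝ) (hν : IsAmoebaProfile ν)
    (Ω : Set Plane) (f u : Plane → ℝ)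
    (hf : ContDiffOn ℝ ∞ f Ω) (hu : ContDiffOn ℝ ∞ u Ω)
    (x₀ : Plane) (hx₀ : x₀ ∈ interior Ω)
    (hf₀ : gradient f x₀ ≠ 0) (hu₀ : gradient u x₀ ≠ 0)
    (φ α : ℝ)
    (hφ : gradient f x₀ = ‖gradient f x₀‖ • unitVec φ)
    (hα : gradient u x₀ = ‖gradient u x₀‖ • unitVec (φ + α)) :
    (∀ᶠ ρ : ℝ in 𝓝[>] 0, ∃! m : ℝ, IsMedianOn u (amoeba ν Ω f x₀ ρ) m) ∧
    ∀ μ : ℝ → ℝ, (∀ᶠ ρ : ℝ in 𝓝[>] 0, IsMedianOn u (amoeba ν Ω f x₀ ρ) (μ ρ)) →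
      ((fun ρ : ℝ => μ ρ - (u x₀ + ρ ^ 2 / 6 * amoebaRHS ν f u x₀ φ α))
          =o[𝓝[>] 0] fun ρ : ℝ => ρ ^ 2) ∧
      (ContDiffOn ℝ 2 ν (Ici 0) →
        (fun ρ : ℝ => μ ρ - (u x₀ + ρ ^ 2 / 6 * amoebaRHS ν f u x₀ φ α))
          =O[𝓝[>] 0] fun ρ : ℝ => ρ ^ 3) := by
  obtain ⟨K, C, hK, hC, h⟩ := exists_median_estimate hν hf hu hx₀ hf₀ hu₀ hφ hα
  have hs : 0 < ‖gradient f x₀‖ := norm_pos_iff.2 hf₀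
  refine ⟨h.mono fun ρ hρ => hρ.1, fun μ hμ => ⟨?_, fun h2 => ?_⟩⟩
  · have h1 := tendsto_integral_secondDiff_comp_mul_div hν hs.ne' hK
      (α - Real.pi / 2) (α + Real.pi / 2)
    have h3 : Tendsto (fun ρ : ℝ => ρ) (𝓝[>] 0) (𝓝 0) := tendsto_id.mono_left nhdsWithin_le_nhds
    have h4 := (h1.add h3).const_mul C
    rw [add_zero, mul_zero] at h4
    refine isLittleO_iff.2 fun ε hε => ?_
    filter_upwards [h, hμ, h4.eventually_le_const hε, self_mem_nhdsWithin]
      with ρ hρ hμρ hle (hpos : 0 < ρ)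
    rw [Real.norm_eq_abs, Real.norm_eq_abs, abs_of_nonneg (sq_nonneg ρ)]
    refine (hρ.2 _ hμρ).trans ?_
    calc _ = C * ((∫ θ in (α - Real.pi / 2)..(α + Real.pi / 2),
          secondDiff ν (K * ρ) (‖gradient f x₀‖ * Real.cos θ)) / ρ + ρ) * ρ ^ 2 := by field_simp
      _ ≤ ε * ρ ^ 2 := by gcongr
  · obtain ⟨C', hC', hle⟩ := exists_integral_secondDiff_le_sq hν h2 hs α
    refine IsBigO.of_bound (C * (C' * K ^ 2 + 1)) ?_
    have hev : ∀ᶠ ρ : ℝ in 𝓝[>] 0, ρ < 1 / K :=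
      (eventually_lt_nhds (by positivity)).filter_mono nhdsWithin_le_nhds
    filter_upwards [h, hμ, hev, self_mem_nhdsWithin] with ρ hρ hμρ hlt (hpos : 0 < ρ)
    rw [lt_div_iff₀ hK] at hlt
    rw [Real.norm_eq_abs, Real.norm_eq_abs, abs_of_pos (by positivity : 0 < ρ ^ 3)]
    refine (hρ.2 _ hμρ).trans ?_
    -- The second difference bound needs scale at most `1`, which is why `ρ < 1 / K` was imposed.
    have := hle (K * ρ) (mul_pos hK hpos) (by linarith)
    calc _ ≤ C * ρ * (C' * (K * ρ) ^ 2 + ρ ^ 2) := by gcongr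
      _ = _ := by ring
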